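/- Let $D(t)=\{z\in\mathbb C:|z|<t\}$ and $\overline D(t)=\{z\in\mathbb C:|z|\le t\}$. A subharmonic function on an open set $\Omega\subset\mathbb C$ is an upper semicontinuous function $u:\Omega\to[-\infty,+\infty)$ with the local submean property; $u^+=\max\{0,u\}$, $u^-=\max\{0,-u\}$. Its Riesz measure is $\Delta_u=\frac1{2\pi}\triangle u$, in the sense of distributions. For an extended-real-valued function $f$ let ${\sf C}_f(r)=\frac1{2\pi}\int_0^{2\pi}f(re^{i\varphi})\,d\varphi$, and for a positive Borel measure $\mu$ let ${\sf N}_\mu(r,R)=\int_r^R\frac{\mu(\overline D(t))}{t}\,dt$. A $\delta$-subharmonic function $U\not\equiv\pm\infty$ on $\overline D(R)$, $0<R<+\infty$, is a difference $U=u-v$ of functions $u\not\equiv-\infty$ and $v\not\equiv-\infty$ that are subharmonic on an open neighbourhood of $\overline D(R)$. Two such differences $u-v$ and $u_1-v_1$ represent the same function if $u+v_1=u_1+v$. Let $\Delta_U=\Delta_u-\Delta_v$ be the Riesz charge of $U$ and $\Delta_U^-=\sup\{\Delta_v,\Delta_u\}-\Delta_u$ its lower variation. The difference Nevanlinna characteristic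 of $U$ is $$ {\sf T}_U(r,R)={\sf C}_{U^+}(R)-{\sf C}_{U^+}(r)+{\sf N}_{\Delta_U^-}(r,R),\qquad 0<r<R . $$ **Proposition.** Let $0<R<+\infty$ and let $U\not\equiv\pm\infty$ be a $\delta$-subharmonic function on $\overline D(R)$. Then: (i) ${\sf T}_U$ does not depend on the representation of $U$ as a difference of subharmonic functions; (ii) ${\sf T}_U$ is finite, $\ge 0$, and continuous in each variable: $t\mapsto{\sf T}_U(r,t)$ is continuous on $(r,R]$ for each $r\in(0,R)$, and $r\mapsto{\sf T}_U(r,R)$ is continuous on $(0,R)$; (iii) on these intervals ${\sf T}_U$ is increasing (not necessarily strictly) and convex with respect to $\ln$ in the second argument, and decreasing (not necessarily strictly) and concave with respect to $\ln$ in the first argument (a function $f$ on an interval $I\subset(0,+\infty)$ is convex, respectively concave, with respect to $\ln$ if $s\mapsto f(e^s)$ is convex, respectively concave, on $\ln I$); (iv) there exists a finite or infinite limit $\lim_{0<r\to0}{\sf T}_U(r,R)=:{\sf T}_U(R)\in[0,+\infty]$; (v) ${\sf T}_U={\sf T}_{-U}$; (vi) if $u\not\equiv-\infty$ is subharmonic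 on a neighbourhood of $\overline D(R)$ with Riesz measure $\Delta_u$, then for $0<r<R$ $$ {\sf T}_u(r,R)={\sf C}_{u^+}(R)-{\sf C}_{u^+}(r)={\sf C}_{u^-}(R)-{\sf C}_{u^-}(r)+{\sf N}_{\Delta_u}(r,R)={\sf T}_{-u}(r,R); $$ (vii) if $U=u-v$ with subharmonic $u,v$ as above and $u(0)\ne-\infty$ or $v(0)\ne-\infty$, then the limit in (iv) is finite, that is, ${\sf T}_U(R)\in[0,+\infty)$. -/

import Mathlib

open MeasureTheory Set Filter Topology
open scoped ENNReal ContDiff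

noncomputable section

namespace DeltaSubharmonic

/-- The mean `(1/2π) ∫₀^{2π} f (c + r e^{iθ}) dθ` of an extended-real-valued function over the
circle of centre `c` and radius `r`, as a Lebesgue integral with values in `[-∞, +∞]`: the integral
of the positive part minus the integral of the negative part. It has its usual meaning whenever one
of these two integrals is finite. -/
def circleMean (f : ℂ → EReal) (c : ℂ) (r : ℝ) : EReal :=
  (((∫⁻ θ in Ioc 0 (2 * Real.pi), (f (circleMap c r θ)).toENNReal) /
      ENNReal.ofReal (2 * Real.pi) : ℝ≥0∞) : EReal) -
    (((∫⁻ θ in Ioc 0 (2 * Real.pi), (-f (circleMap c r θ)).toENNReal) /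
      ENNReal.ofReal (2 * Real.pi) : ℝ≥0∞) : EReal)

/-- Subharmonic functions on an open set `Ω ⊆ ℂ` (the function `-∞` is allowed): upper
semicontinuous functions with values in `[-∞, +∞)` that satisfy the local submean inequality. -/
structure SubharmonicOn (u : ℂ → EReal) (Ω : Set ℂ) : Prop where
  lt_top : ∀ z ∈ Ω, u z < ⊤
  usc : UpperSemicontinuousOn u Ω
  submean : ∀ w ∈ Ω, ∃ ρ : ℝ, 0 < ρ ∧ ∀ r : ℝ, 0 < r → r < ρ → u w ≤ circleMean u w r

/-- `μ` is the Riesz measure of `u` on the open set `Ω`: a Borel measure carried by `Ω`, finite on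
the compact subsets of `Ω`, that equals `(1/2π) Δu` on `Ω` in the sense of distributions. -/
structure IsRieszMeasure (u : ℂ → EReal) (Ω : Set ℂ) (μ : Measure ℂ) : Prop where
  compl_eq_zero : μ Ωᶜ = 0
  lt_top_of_isCompact : ∀ K : Set ℂ, IsCompact K → K ⊆ Ω → μ K < ⊤
  integral_eq : ∀ φ : ℂ → ℝ, ContDiff ℝ ∞ φ → HasCompactSupport φ → tsupport φ ⊆ Ω →
    ∫ z, φ z ∂μ = (1 / (2 * Real.pi)) * ∫ z, (u z).toReal * Laplacian.laplacian φ z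

open Classical in
/-- The Riesz measure `Δ_u = (1/2π) Δu` of `u` on `Ω`; the value `0` is used only if the
distribution `(1/2π) Δu` is not a Radon measure on `Ω`. -/
def rieszMeasure (u : ℂ → EReal) (Ω : Set ℂ) : Measure ℂ :=
  if h : ∃ μ : Measure ℂ, IsRieszMeasure u Ω μ then h.choose else 0

/-- The lower variation `Δ_U⁻ = sup {Δ_v, Δ_u} - Δ_u` of the Riesz charge `Δ_U = Δ_u - Δ_v` of
`U = u - v`. -/
def lowerVariation (Ω : Set ℂ) (u v : ℂ → EReal) : Measure ℂ :=
  (rieszMeasure v Ω ⊔ rieszMeasure u Ω) - rieszMeasure u Ω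

/-- The difference integrated radial counting function
`N_μ(r, R) = ∫_r^R μ({|z| ≤ t}) / t dt ∈ [0, +∞]`. -/
def diffCounting (μ : Measure ℂ) (r R : ℝ) : ℝ≥0∞ :=
  ∫⁻ t in Icc r R, μ (Metric.closedBall 0 t) / ENNReal.ofReal t

/-- The positive part `U⁺ = sup {0, u - v}` of `U = u - v`. (At the points where
`u = v = -∞`, at which `U` is undefined, it takes the value `0`.) -/
def posPart (u v : ℂ → EReal) (z : ℂ) : EReal := max 0 (u z - v z)

/-- The difference Nevanlinna characteristic
`T_U(r, R) = C_{U⁺}(R) - C_{U⁺}(r) + N_{Δ_U⁻}(r, R)` of `U = u - v`, where `u` and `v` are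
subharmonic on `Ω`. -/
def nevanlinnaT (Ω : Set ℂ) (u v : ℂ → EReal) (r R : ℝ) : EReal :=
  circleMean (posPart u v) 0 R - circleMean (posPart u v) 0 r +
    (diffCounting (lowerVariation Ω u v) r R : EReal)

/-- `U = u - v` is a representation of a δ-subharmonic function `U ≢ ±∞` on the closed disc
`{|z| ≤ R}`: the functions `u ≢ -∞` and `v ≢ -∞` are subharmonic on the open neighbourhood
`Ω` of that disc. -/
structure IsRepresentation (R : ℝ) (Ω : Set ℂ) (u v : ℂ → EReal) : Prop where
  isOpen : IsOpen Ω
  subset : Metric.closedBall 0 R ⊆ Ω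
  left : SubharmonicOn u Ω
  right : SubharmonicOn v Ω
  left_ne_bot : ∃ z ∈ Metric.closedBall (0 : ℂ) R, u z ≠ ⊥
  right_ne_bot : ∃ z ∈ Metric.closedBall (0 : ℂ) R, v z ≠ ⊥

end DeltaSubharmonic

end

/-! ### Circle means of subharmonic functions -/

namespace DeltaSubharmonic

/-! Everything reduces to one identity: T_U(r, t) = N_κ(r, t) for a finite positive measure κ. The
derivative of N_κ in ln t is κ({|z| ≤ t}), which is increasing in t. Finiteness, continuity,
monotonicity, logarithmic convexity or concavity, and the limit at radius 0 are then general facts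
about counting functions.

To find κ, write U⁺ = max(u, v) - v. Jensen's formula (`IsRieszMeasure.centeredCounting_eq`) turns
the growth of the mean of U⁺ into N of Δ_max minus N of Δ_v, where Δ_max is the Riesz measure of
max(u, v). Adding the lower variation leaves κ = Δ_max - m, where m = Δ_v - (Δ_v - Δ_u)⁺ is the
minimum of Δ_u and Δ_v. Positivity of κ is the inequality m ≤ Δ_max, proved in
`le_rieszMeasure_max`. If u(z) ≤ v(z), then max(u, v) agrees with v at z and has the larger circle
means, so by Jensen its counting function about z dominates that of v, hence that of m; the other
case is symmetric.

Domination of counting functions about almost all centres implies domination of measures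
(`measure_le_of_centeredCounting_le`), because integrating over the centres smears each point mass
by the same amount. This principle also gives independence of the representation, and it replaces a
separate uniqueness theorem: the Riesz measure is chosen by `Exists.choose` and is used only through
its finiteness on compact sets and Jensen's formula.

Jensen's formula comes from testing the Laplacian against smooth cut-offs of the logarithm, together
with monotonicity and right-continuity of circle means. Those follow from a maximum principle
against real parts of entire functions, without the Poisson integral. Existence of the Riesz measure
follows from positivity of the distributional Laplacian, the M. Riesz extension theorem and the
Riesz–Markov–Kakutani theorem.

Symmetry in u and v reflects the symmetry of max(u, v) and of m; the formula for a subharmonic u is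
this symmetry for the pair (u, 0). The limit is finite when u(0) or v(0) is, because the mean of
max(u, v) cannot fall below its value at the centre. -/

lemma circleMean_mono_ae {f g : ℂ → EReal} {c : ℂ} {r : ℝ}
    (h : ∀ᵐ θ ∂(volume.restrict (Ioc 0 (2 * Real.pi))), f (circleMap c r θ) ≤ g (circleMap c r θ)) :
    circleMean f c r ≤ circleMean g c r := by
  unfold circleMean
  refine EReal.sub_le_sub ?_ ?_
  · rw [EReal.coe_ennreal_le_coe_ennreal_iff]
    gcongr 1
    refine lintegral_mono_ae ?_
    filter_upwards [h] with θ hθ using EReal.toENNReal_le_toENNReal hθ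
  · rw [EReal.coe_ennreal_le_coe_ennreal_iff]
    gcongr 1
    refine lintegral_mono_ae ?_
    filter_upwards [h] with θ hθ using EReal.toENNReal_le_toENNReal (EReal.neg_le_neg_iff.2 hθ)

lemma circleMean_congr_ae {f g : ℂ → EReal} {c : ℂ} {r : ℝ}
    (h : ∀ᵐ θ ∂(volume.restrict (Ioc 0 (2 * Real.pi))), f (circleMap c r θ) = g (circleMap c r θ)) :
    circleMean f c r = circleMean g c r :=
  le_antisymm (circleMean_mono_ae (h.mono fun _ hθ => hθ.le))
    (circleMean_mono_ae (h.mono fun _ hθ => hθ.ge))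

lemma circleMean_mono {f g : ℂ → EReal} {c : ℂ} {r : ℝ} (hr : 0 ≤ r)
    (h : ∀ z ∈ Metric.sphere c r, f z ≤ g z) : circleMean f c r ≤ circleMean g c r :=
  circleMean_mono_ae (Eventually.of_forall fun θ => h _ (circleMap_mem_sphere c hr θ))

lemma coe_div_sub_coe_div {a b : ℝ≥0∞} (ha : a ≠ ⊤) (hb : b ≠ ⊤) :
    ((a / ENNReal.ofReal (2 * Real.pi) : ℝ≥0∞) : EReal) -
      ((b / ENNReal.ofReal (2 * Real.pi) : ℝ≥0∞) : EReal) =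
    (((2 * Real.pi)⁻¹ * (a.toReal - b.toReal) : ℝ) : EReal) := by
  have h2 : (0 : ℝ) < 2 * Real.pi := Real.two_pi_pos
  have key : ∀ x : ℝ≥0∞, x ≠ ⊤ → ((x / ENNReal.ofReal (2 * Real.pi) : ℝ≥0∞) : EReal) =
      (((2 * Real.pi)⁻¹ * x.toReal : ℝ) : EReal) := by
    intro x hx
    have h1 : x / ENNReal.ofReal (2 * Real.pi) ≠ ⊤ :=
      ENNReal.div_ne_top hx (by simpa using Real.pi_pos)
    rw [← EReal.coe_toReal (x := ((x / ENNReal.ofReal (2 * Real.pi) : ℝ≥0∞) : EReal))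
      (by simpa using h1) (by simp)]
    congr 1
    rw [EReal.toReal_coe_ennreal, ENNReal.toReal_div, ENNReal.toReal_ofReal h2.le]
    ring
  rw [key a ha, key b hb, ← EReal.coe_sub]
  congr 1
  ring

lemma circleMean_coe {g : ℂ → ℝ} {c : ℂ} {r : ℝ} (hg : CircleIntegrable g c r) :
    circleMean (fun z => (g z : EReal)) c r = ((Real.circleAverage g c r : ℝ) : EReal) := by
  have h2 : (0 : ℝ) < 2 * Real.pi := Real.two_pi_pos
  have hi : IntegrableOn (fun θ => g (circleMap c r θ)) (Ioc 0 (2 * Real.pi)) :=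
    (intervalIntegrable_iff_integrableOn_Ioc_of_le h2.le).1 hg
  unfold circleMean
  simp only [← EReal.coe_neg, EReal.real_coe_toENNReal]
  rw [coe_div_sub_coe_div, Real.circleAverage_def, intervalIntegral.integral_of_le h2.le,
    integral_eq_lintegral_pos_part_sub_lintegral_neg_part hi, smul_eq_mul]
  · exact hi.lintegral_lt_top.ne
  · exact hi.neg.lintegral_lt_top.ne

lemma circleMean_radius_zero (f : ℂ → EReal) (c : ℂ) : circleMean f c 0 = f c := by
  have h2 : ENNReal.ofReal (2 * Real.pi) ≠ 0 := by simpa using Real.pi_pos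
  have key : ∀ x : ℝ≥0∞, (∫⁻ _ in Ioc 0 (2 * Real.pi), x) / ENNReal.ofReal (2 * Real.pi) = x := by
    intro x
    simp only [lintegral_const, Measure.restrict_apply, MeasurableSet.univ, univ_inter,
      Real.volume_Ioc, sub_zero]
    exact ENNReal.mul_div_cancel_right h2 ENNReal.ofReal_ne_top
  unfold circleMean
  simp only [circleMap_zero_radius, Function.const_apply]
  rw [key, key, EReal.coe_toENNReal_eq_max, EReal.coe_toENNReal_eq_max]
  rcases le_total 0 (f c) with h | h
  · rw [max_eq_right h, max_eq_left (by simpa using h)]; simp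
  · rw [max_eq_left h, max_eq_right (by simpa using h)]; simp

/-- After expanding around z, the cross term is the real part of a holomorphic function vanishing at
z, so it averages to 0. The surplus r² is what makes -ε‖w - c‖² strictly superharmonic. -/
lemma circleAverage_norm_sub_sq (c z : ℂ) (r : ℝ) :
    Real.circleAverage (fun w => ‖w - c‖ ^ 2) z r = ‖z - c‖ ^ 2 + r ^ 2 := by
  have h1 : Real.circleAverage (fun w : ℂ => 2 * ((starRingEnd ℂ) (z - c) * (w - z)).re) z r = 0 := by
    have hd : Differentiable ℂ (fun w : ℂ => 2 * ((starRingEnd ℂ) (z - c) * (w - z))) := by fun_prop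
    have h3 : Real.circleAverage (fun w : ℂ => 2 * ((starRingEnd ℂ) (z - c) * (w - z))) z r = 0 := by
      rw [hd.diffContOnCl.circleAverage]; simp
    have := Complex.reCLM.circleAverage_comp_comm
      (hd.continuous.continuousOn.circleIntegrable' (c := z) (R := r))
    rw [h3] at this
    simpa [Function.comp_def] using this
  have h2 : Real.circleAverage (fun w => ‖w - c‖ ^ 2) z r =
      Real.circleAverage (fun w : ℂ => (‖z - c‖ ^ 2 + r ^ 2) +
        2 * ((starRingEnd ℂ) (z - c) * (w - z)).re) z r := by
    refine Real.circleAverage_congr_sphere fun w hw => ?_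
    have hw' : ‖w - z‖ ^ 2 = r ^ 2 := by
      rw [mem_sphere_iff_norm.1 hw, sq_abs]
    have h4 : ‖w - c‖ ^ 2 = ‖(z - c) + (w - z)‖ ^ 2 := by congr 2; ring
    rw [h4, ← hw']
    simp only [← Complex.normSq_eq_norm_sq, Complex.normSq_apply]
    simp
    ring
  rw [h2, Real.circleAverage_fun_add (circleIntegrable_const _ _ _), h1, Real.circleAverage_const,
    add_zero]
  exact (by fun_prop : Continuous fun w : ℂ => 2 * ((starRingEnd ℂ) (z - c) * (w - z)).re)
    |>.continuousOn.circleIntegrable'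

lemma circleAverage_re {p : ℂ → ℂ} (hp : Differentiable ℂ p) (c : ℂ) (r : ℝ) :
    Real.circleAverage (fun z => (p z).re) c r = (p c).re := by
  have := Complex.reCLM.circleAverage_comp_comm
      (hp.continuous.continuousOn.circleIntegrable' (c := c) (R := r))
  rw [hp.diffContOnCl.circleAverage] at this
  simpa [Function.comp_def] using this

/-- Sup-convolution of u, truncated below at -n, with the penalty n · dist. Larger n lowers the
truncation and raises the penalty, so the sequence decreases; upper semicontinuity localises the
supremum in the limit. -/
lemma exists_continuous_antitone_tendsto {S : Set ℂ} (hS : IsCompact S) (hne : S.Nonempty)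
    {u : ℂ → EReal} (hu : UpperSemicontinuousOn u S) (hlt : ∀ z ∈ S, u z < ⊤) :
    ∃ g : ℕ → ℂ → ℝ, (∀ n, Continuous (g n)) ∧ (∀ z ∈ S, Antitone fun n => g n z) ∧
      (∀ n, ∀ z ∈ S, u z ≤ g n z) ∧
      ∀ z ∈ S, Tendsto (fun n => (g n z : EReal)) atTop (𝓝 (u z)) := by
  obtain ⟨z₀, hz₀, hmax⟩ := hu.exists_isMaxOn hne hS
  obtain ⟨M, hM0, hM⟩ : ∃ M : ℝ, 0 ≤ M ∧ ∀ z ∈ S, u z ≤ M := by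
    refine ⟨max 0 (u z₀).toReal, le_max_left _ _, fun z hz => ?_⟩
    refine (hmax hz).trans ((EReal.le_coe_toReal (hlt z₀ hz₀).ne).trans ?_)
    exact EReal.coe_le_coe_iff.2 (le_max_right _ _)
  set f : ℕ → ℂ → ℝ := fun n y => (max (u y) ((-(n : ℝ) : ℝ) : EReal)).toReal with hf
  have hfc : ∀ n, ∀ y ∈ S, (f n y : EReal) = max (u y) ((-(n : ℝ) : ℝ) : EReal) := by
    intro n y hy
    refine EReal.coe_toReal ?_ ?_
    · exact (max_lt (hlt y hy) (EReal.coe_lt_top _)).ne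
    · exact ((EReal.bot_lt_coe _).trans_le (le_max_right _ _)).ne'
  have hfM : ∀ n, ∀ y ∈ S, f n y ≤ M := by
    intro n y hy
    rw [← EReal.coe_le_coe_iff, hfc n y hy]
    refine max_le (hM y hy) (EReal.coe_le_coe_iff.2 ?_)
    have : (0 : ℝ) ≤ n := n.cast_nonneg
    linarith
  have : Nonempty S := ⟨⟨z₀, hz₀⟩⟩
  set g : ℕ → ℂ → ℝ := fun n z => ⨆ y : S, (f n y - n * dist z (y : ℂ)) with hg
  have hbdd : ∀ (n : ℕ) (z : ℂ), BddAbove (range fun y : S => f n y - n * dist z (y : ℂ)) := by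
    intro n z
    refine ⟨M, ?_⟩
    rintro _ ⟨y, rfl⟩
    have := hfM n y y.2
    have : 0 ≤ n * dist z (y : ℂ) := by positivity
    simp only
    linarith
  have hfg : ∀ n, ∀ z ∈ S, f n z ≤ g n z := by
    intro n z hz
    have := le_ciSup (hbdd n z) ⟨z, hz⟩
    simpa using this
  have hug : ∀ n, ∀ z ∈ S, u z ≤ g n z := by
    intro n z hz
    refine (le_max_left _ _).trans ((hfc n z hz).symm.le.trans ?_)
    exact EReal.coe_le_coe_iff.2 (hfg n z hz)
  refine ⟨g, fun n => ?_, fun z hz n m hnm => ?_, hug, fun z hz => ?_⟩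
  · refine (LipschitzWith.of_le_add_mul (n : NNReal) (f := g n) fun x y => ?_).continuous
    refine ciSup_le fun w => ?_
    have h1 := le_ciSup (hbdd n y) w
    have h2 : dist y w ≤ dist x y + dist x w := by
      rw [dist_comm x y]; exact dist_triangle _ _ _
    have h3 : (n : ℝ) * dist y w ≤ n * (dist x y + dist x w) := by gcongr
    simp only [hg] at h1 ⊢
    push_cast
    nlinarith
  · refine ciSup_mono (hbdd n z) fun y => ?_
    have h1 : f m y ≤ f n y := by
      rw [← EReal.coe_le_coe_iff, hfc n y y.2, hfc m y y.2]
      refine max_le_max le_rfl (EReal.coe_le_coe_iff.2 ?_)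
      simpa using hnm
    have h2 : (n : ℝ) * dist z y ≤ m * dist z y := by gcongr
    linarith
  · rw [tendsto_order]
    refine ⟨fun a ha => Eventually.of_forall fun n => ha.trans_le (hug n z hz), fun a ha => ?_⟩
    obtain ⟨b, hb1, hb2⟩ := EReal.lt_iff_exists_real_btwn.1 ha
    have h1 := hu z hz _ hb1
    obtain ⟨δ, hδ, hδu⟩ := Metric.mem_nhdsWithin_iff.1 h1
    -- The first bound puts the truncation level -n below b; the second makes the penalty at
    -- distance δ at least M - b, so distant points also contribute at most b.
    obtain ⟨N, hN⟩ := exists_nat_ge (max (-b) ((M - b) / δ))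
    filter_upwards [eventually_ge_atTop N] with n hn
    refine lt_of_le_of_lt (EReal.coe_le_coe_iff.2 ?_) hb2
    have hn' : max (-b) ((M - b) / δ) ≤ n := hN.trans (by exact_mod_cast hn)
    refine ciSup_le fun y => ?_
    rcases lt_or_ge (dist (y : ℂ) z) δ with hd | hd
    · have h2 : f n y ≤ b := by
        rw [← EReal.coe_le_coe_iff, hfc n y y.2]
        refine max_le (le_of_lt (hδu ⟨hd, y.2⟩)) (EReal.coe_le_coe_iff.2 ?_)
        have := (le_max_left _ _).trans hn'
        linarith
      have : 0 ≤ n * dist z (y : ℂ) := by positivity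
      linarith
    · have h2 : M - b ≤ n * δ := (div_le_iff₀ hδ).1 ((le_max_right _ _).trans hn')
      have h3 : (n : ℝ) * δ ≤ n * dist z (y : ℂ) := by
        rw [dist_comm]; gcongr
      have := hfM n y y.2
      linarith

/-- Trigonometric polynomials are uniformly dense on the circle, and each has the form p₁ + conj p₂
with entire p₁ and p₂, so its real part is Re (p₁ + p₂). This stands in for harmonic extension of
the boundary data. -/
lemma exists_differentiable_re_approx {g : ℂ → ℝ} (hg : Continuous g) (c : ℂ) {R : ℝ} (hR : 0 < R)
    {ε : ℝ} (hε : 0 < ε) :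
    ∃ p : ℂ → ℂ, Differentiable ℂ p ∧ ∀ z ∈ Metric.sphere c R, |g z - (p z).re| < ε := by
  have : Fact (0 < 2 * Real.pi) := ⟨Real.two_pi_pos⟩
  let F : C(AddCircle (2 * Real.pi), ℂ) :=
    ⟨fun x => (g (c + R * (AddCircle.toCircle x : ℂ)) : ℂ), by
      have := AddCircle.continuous_toCircle (T := 2 * Real.pi)
      fun_prop⟩
  have hF : F ∈ (Submodule.span ℂ (range (@fourier (2 * Real.pi)))).topologicalClosure := by
    rw [span_fourier_closure_eq_top]; trivial
  obtain ⟨q, hq, hFq⟩ := Metric.mem_closure_iff.1 hF ε hε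
  have key : ∀ q ∈ Submodule.span ℂ (range (@fourier (2 * Real.pi))),
      ∃ p₁ p₂ : ℂ → ℂ, Differentiable ℂ p₁ ∧ Differentiable ℂ p₂ ∧
        ∀ x, q x = p₁ (AddCircle.toCircle x : ℂ) + (starRingEnd ℂ) (p₂ (AddCircle.toCircle x : ℂ)) := by
    intro q hq
    induction hq using Submodule.span_induction with
    | mem q hq =>
      obtain ⟨n, rfl⟩ := hq
      rcases n with n | n
      · refine ⟨fun z => z ^ n, 0, by fun_prop, by fun_prop, fun x => ?_⟩
        simp [fourier_apply, AddCircle.toCircle_nsmul]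
      · refine ⟨0, fun z => z ^ (n + 1), by fun_prop, by fun_prop, fun x => ?_⟩
        simp only [Pi.zero_apply, zero_add]
        -- `Int.negSucc n` is the frequency -(n + 1), so the conjugated side carries the exponent n
        -- + 1.
        rw [Int.negSucc_eq, fourier_neg, show ((n : ℤ) + 1) = ((n + 1 : ℕ) : ℤ) by push_cast; rfl]
        simp [fourier_apply, AddCircle.toCircle_nsmul, -Nat.cast_add, pow_succ]
    | zero => exact ⟨0, 0, by fun_prop, by fun_prop, fun x => by simp⟩
    | add a b _ _ ha hb =>
      obtain ⟨p₁, p₂, h1, h2, h⟩ := ha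
      obtain ⟨q₁, q₂, h1', h2', h'⟩ := hb
      refine ⟨p₁ + q₁, p₂ + q₂, h1.add h1', h2.add h2', fun x => ?_⟩
      simp [h, h']; ring
    | smul k a _ ha =>
      obtain ⟨p₁, p₂, h1, h2, h⟩ := ha
      refine ⟨k • p₁, (starRingEnd ℂ k) • p₂, h1.const_smul k, h2.const_smul _, fun x => ?_⟩
      simp [h]; ring
  obtain ⟨p₁, p₂, h1, h2, h⟩ := key q hq
  refine ⟨fun z => p₁ ((z - c) / R) + p₂ ((z - c) / R), by fun_prop, fun z hz => ?_⟩
  have hRc : (R : ℂ) ≠ 0 := by exact_mod_cast hR.ne'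
  obtain ⟨θ, rfl⟩ : ∃ θ, circleMap c R θ = z := by
    have : z ∈ range (circleMap c R) := by rw [range_circleMap, abs_of_pos hR]; exact hz
    exact this
  have hx : (AddCircle.toCircle (θ : AddCircle (2 * Real.pi)) : ℂ) = (circleMap c R θ - c) / R := by
    rw [AddCircle.toCircle_apply_mk]
    simp only [Circle.coe_exp, circleMap, add_sub_cancel_left]
    have : (2 * Real.pi / (2 * Real.pi) * θ : ℝ) = θ := by
      rw [div_self Real.two_pi_pos.ne', one_mul]
    rw [this]
    field_simp
  have hd := (ContinuousMap.dist_lt_iff hε).1 hFq (θ : AddCircle (2 * Real.pi))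
  have hFx : F (θ : AddCircle (2 * Real.pi)) = (g (circleMap c R θ) : ℂ) := by
    change ((g (c + R * (AddCircle.toCircle (θ : AddCircle (2 * Real.pi)) : ℂ)) : ℝ) : ℂ) = _
    rw [hx, mul_div_cancel₀ _ hRc, add_sub_cancel]
  rw [hFx, h, hx, Complex.dist_eq] at hd
  refine lt_of_le_of_lt ?_ hd
  refine le_trans (le_of_eq ?_) (Complex.abs_re_le_norm _)
  simp

/-! ### Maximum principle; monotonicity and right-continuity of circle means. -/

variable {u : ℂ → EReal} {Ω : Set ℂ}

/-- At a positive interior maximum of u - Q, the submean inequality for u contradicts the strict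
inequality for Q on a small circle. Strictness removes the need for a connectedness argument. -/
lemma SubharmonicOn.le_of_le_sphere (hu : SubharmonicOn u Ω) {c : ℂ} {R : ℝ}
    (hΩ : Metric.closedBall c R ⊆ Ω) {Q : ℂ → ℝ} (hQ : Continuous Q)
    (hav : ∀ z, ∀ ρ : ℝ, 0 < ρ → Real.circleAverage Q z ρ < Q z)
    (hle : ∀ z ∈ Metric.sphere c R, u z ≤ Q z) :
    ∀ z ∈ Metric.closedBall c R, u z ≤ Q z := by
  intro z hz
  have husc : UpperSemicontinuousOn (fun z => u z + ((-Q z : ℝ) : EReal)) (Metric.closedBall c R) := by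
    refine (hu.usc.mono hΩ).add' ?_ fun x hx => ?_
    · exact (continuous_coe_real_ereal.comp hQ.neg).continuousOn.upperSemicontinuousOn
    · exact EReal.continuousAt_add (Or.inr (EReal.coe_ne_bot _)) (Or.inr (EReal.coe_ne_top _))
  obtain ⟨z₀, hz₀, hmax⟩ := husc.exists_isMaxOn ⟨z, hz⟩ (isCompact_closedBall c R)
  have sub_iff : ∀ x : ℂ, ∀ a : ℝ, u x + ((-Q x : ℝ) : EReal) ≤ a ↔ u x ≤ ((Q x + a : ℝ) : EReal) := by
    intro x a
    rw [EReal.coe_neg, ← sub_eq_add_neg, EReal.sub_le_iff_le_add (by simp) (by simp), ← EReal.coe_add,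
      add_comm]
  by_cases h0 : u z₀ + ((-Q z₀ : ℝ) : EReal) ≤ (0 : ℝ)
  · have := (sub_iff z 0).1 ((hmax hz).trans h0)
    simpa using this
  exfalso
  have hbot : u z₀ ≠ ⊥ := by
    intro h; simp [h] at h0
  have htop : u z₀ ≠ ⊤ := (hu.lt_top z₀ (hΩ hz₀)).ne
  set a : ℝ := (u z₀).toReal - Q z₀ with ha
  have hu0 : u z₀ = ((u z₀).toReal : EReal) := (EReal.coe_toReal htop hbot).symm
  have hw0 : u z₀ + ((-Q z₀ : ℝ) : EReal) = a := by
    rw [hu0, ← EReal.coe_add, ha]; simp [sub_eq_add_neg]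
  have hbd : ∀ x ∈ Metric.closedBall c R, u x ≤ ((Q x + a : ℝ) : EReal) := by
    intro x hx
    exact (sub_iff x a).1 (hw0 ▸ hmax hx)
  have hball : z₀ ∈ Metric.ball c R := by
    by_contra hn
    have : z₀ ∈ Metric.sphere c R := by
      rw [Metric.mem_sphere]
      exact le_antisymm hz₀ (by simpa using hn)
    refine h0 ((sub_iff z₀ 0).2 ?_)
    simpa using hle z₀ this
  obtain ⟨ρ, hρ, hsub⟩ := hu.submean z₀ (hΩ hz₀)
  obtain ⟨ρ', hρ', hρball⟩ := Metric.isOpen_ball.mem_nhds hball |> Metric.mem_nhds_iff.1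
  set s := min ρ ρ' / 2 with hs
  have hs0 : 0 < s := by positivity
  have hsρ : s < ρ := by
    have := min_le_left ρ ρ'
    have : 0 < min ρ ρ' := by positivity
    linarith
  have hsρ' : s < ρ' := by
    have := min_le_right ρ ρ'
    have : 0 < min ρ ρ' := by positivity
    linarith
  have h1 : u z₀ ≤ ((Real.circleAverage (fun x => Q x + a) z₀ s : ℝ) : EReal) := by
    refine (hsub s hs0 hsρ).trans ?_
    rw [← circleMean_coe (by fun_prop : Continuous fun x => Q x + a).continuousOn.circleIntegrable']
    refine circleMean_mono hs0.le fun x hx => hbd x ?_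
    refine Metric.ball_subset_closedBall (hρball ?_)
    rw [Metric.mem_ball, Metric.mem_sphere.1 hx]; exact hsρ'
  rw [Real.circleAverage_fun_add hQ.continuousOn.circleIntegrable' (circleIntegrable_const _ _ _),
    Real.circleAverage_const, hu0, EReal.coe_le_coe_iff] at h1
  have := hav z₀ s hs0
  linarith

/-- Circle means over a disc are dominated by the mean over the boundary of any continuous
majorant. -/
lemma SubharmonicOn.circleMean_le_circleAverage (hu : SubharmonicOn u Ω) {c : ℂ} {R : ℝ} (hR : 0 < R)
    (hΩ : Metric.closedBall c R ⊆ Ω) {g : ℂ → ℝ} (hg : Continuous g)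
    (hle : ∀ z ∈ Metric.sphere c R, u z ≤ g z) {r : ℝ} (hr0 : 0 ≤ r) (hr : r ≤ R) :
    circleMean u c r ≤ ((Real.circleAverage g c R : ℝ) : EReal) := by
  refine EReal.le_of_forall_lt_iff_le.1 fun b hb => ?_
  -- The losses add up to ε(2 + R²): one ε for the mean of Re p against that of g, one to lift Re p
  -- above g on the circle, and εR² to compensate the quadratic term there.
  set ε := (b - Real.circleAverage g c R) / (2 + R ^ 2) with hεd
  have hε : 0 < ε := div_pos (sub_pos.2 (EReal.coe_lt_coe_iff.1 hb)) (by positivity)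
  have hεb : Real.circleAverage g c R + ε * (2 + R ^ 2) = b := by
    rw [hεd, div_mul_cancel₀ _ (by positivity)]; ring
  obtain ⟨p, hp, hpg⟩ := exists_differentiable_re_approx hg c hR hε
  have hpc : Continuous fun z => (p z).re := Complex.continuous_re.comp hp.continuous
  set Q : ℂ → ℝ := fun z => ((p z).re + (ε + ε * R ^ 2)) - ε * ‖z - c‖ ^ 2 with hQ
  have hQc : Continuous Q := by fun_prop
  have hQav : ∀ z ρ, Real.circleAverage Q z ρ = Q z - ε * ρ ^ 2 := by
    intro z ρ
    rw [hQ, Real.circleAverage_fun_sub, Real.circleAverage_fun_add, Real.circleAverage_const,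
      circleAverage_re hp]
    · have := Real.circleAverage_fun_smul (a := ε) (f := fun w => ‖w - c‖ ^ 2) (c := z) (R := ρ)
      simp only [smul_eq_mul] at this
      rw [this, circleAverage_norm_sub_sq]; dsimp only; ring
    all_goals exact Continuous.continuousOn (by fun_prop) |>.circleIntegrable'
  have h1 := hu.le_of_le_sphere hΩ hQc (fun z ρ hρ => by
    rw [hQav]; have : 0 < ε * ρ ^ 2 := by positivity
    linarith) (fun z hz => (hle z hz).trans (EReal.coe_le_coe_iff.2 (by
      have h2 := hpg z hz
      rw [mem_sphere_iff_norm] at hz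
      simp only [hQ, hz]
      have := (abs_lt.1 h2).2
      linarith)))
  have h2 : circleMean u c r ≤ ((Real.circleAverage Q c r : ℝ) : EReal) := by
    rw [← circleMean_coe hQc.continuousOn.circleIntegrable']
    exact circleMean_mono hr0 fun z hz => h1 z
      (Metric.sphere_subset_closedBall.trans (Metric.closedBall_subset_closedBall hr) hz)
  refine h2.trans (EReal.coe_le_coe_iff.2 ?_)
  rw [hQav]
  have h3 : (p c).re ≤ Real.circleAverage g c R + ε := by
    rw [← circleAverage_re hp c R, ← Real.circleAverage_const ε c R, ← Real.circleAverage_fun_add]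
    · refine Real.circleAverage_mono hpc.continuousOn.circleIntegrable'
        (by fun_prop : Continuous fun z => g z + ε).continuousOn.circleIntegrable' fun z hz => ?_
      rw [abs_of_pos hR] at hz
      have := (abs_lt.1 (hpg z hz)).1
      linarith
    · exact hg.continuousOn.circleIntegrable'
    · exact circleIntegrable_const _ _ _
  simp only [hQ, sub_self, norm_zero]
  have : 0 ≤ ε * r ^ 2 := by positivity
  nlinarith

lemma upperSemicontinuousOn_exists_coe_le {S : Set ℂ} (hS : IsCompact S)
    (hu : UpperSemicontinuousOn u S) (hlt : ∀ z ∈ S, u z < ⊤) :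
    ∃ M : ℝ, 0 ≤ M ∧ ∀ z ∈ S, u z ≤ M := by
  rcases S.eq_empty_or_nonempty with rfl | hne
  · exact ⟨0, le_rfl, by simp⟩
  obtain ⟨z₀, hz₀, hmax⟩ := hu.exists_isMaxOn hne hS
  refine ⟨max 0 (u z₀).toReal, le_max_left _ _, fun z hz => ?_⟩
  refine (hmax hz).trans ((EReal.le_coe_toReal (hlt z₀ hz₀).ne).trans ?_)
  exact EReal.coe_le_coe_iff.2 (le_max_right _ _)

/-- Monotone convergence, applied separately to the positive and negative parts of the decreasing
continuous majorants, shows that their averages tend to the mean of u, even when that mean is -∞. -/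
lemma exists_continuous_circleAverage_lt {c : ℂ} {R : ℝ} (hR : 0 ≤ R)
    (hu : UpperSemicontinuousOn u (Metric.sphere c R)) (hlt : ∀ z ∈ Metric.sphere c R, u z < ⊤)
    {b : ℝ} (hb : circleMean u c R < b) :
    ∃ g : ℂ → ℝ, Continuous g ∧ (∀ z ∈ Metric.sphere c R, u z ≤ g z) ∧
      Real.circleAverage g c R < b := by
  obtain ⟨g, hgc, hga, hug, hgt⟩ := exists_continuous_antitone_tendsto (isCompact_sphere c R)
    ⟨circleMap c R 0, circleMap_mem_sphere c hR 0⟩ hu hlt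
  have hmem : ∀ θ, circleMap c R θ ∈ Metric.sphere c R := circleMap_mem_sphere c hR
  have hneg : Continuous fun x : EReal => -x := continuous_neg
  have h2 : (ENNReal.ofReal (2 * Real.pi)) ≠ 0 := by simpa using Real.pi_pos
  have hfin : ∫⁻ θ in Ioc 0 (2 * Real.pi), ((g 0 (circleMap c R θ) : ℝ) : EReal).toENNReal ≠ ⊤ := by
    have : IntegrableOn (fun θ => g 0 (circleMap c R θ)) (Ioc 0 (2 * Real.pi)) :=
      (intervalIntegrable_iff_integrableOn_Ioc_of_le Real.two_pi_pos.le).1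
        (hgc 0).continuousOn.circleIntegrable'
    simp only [EReal.real_coe_toENNReal]
    exact this.lintegral_lt_top.ne
  have hmono : ∀ θ, ∀ n m, n ≤ m → ((g m (circleMap c R θ) : ℝ) : EReal) ≤ g n (circleMap c R θ) :=
    fun θ n m hnm => EReal.coe_le_coe_iff.2 (hga _ (hmem θ) hnm)
  have hmeas : ∀ n, Measurable fun θ => ((g n (circleMap c R θ) : ℝ) : EReal) := fun n =>
    (continuous_coe_real_ereal.comp ((hgc n).comp (continuous_circleMap c R))).measurable
  have t1 : Tendsto (fun n => ∫⁻ θ in Ioc 0 (2 * Real.pi),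
      ((g n (circleMap c R θ) : ℝ) : EReal).toENNReal) atTop
      (𝓝 (∫⁻ θ in Ioc 0 (2 * Real.pi), (u (circleMap c R θ)).toENNReal)) := by
    refine lintegral_tendsto_of_tendsto_of_antitone (fun n => (hmeas n).ereal_toENNReal.aemeasurable)
      (Eventually.of_forall fun θ n m hnm => EReal.toENNReal_le_toENNReal (hmono θ n m hnm)) hfin
      (Eventually.of_forall fun θ => ?_)
    exact (EReal.continuous_toENNReal.tendsto _).comp (hgt _ (hmem θ))
  have t2 : Tendsto (fun n => ∫⁻ θ in Ioc 0 (2 * Real.pi),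
      (-((g n (circleMap c R θ) : ℝ) : EReal)).toENNReal) atTop
      (𝓝 (∫⁻ θ in Ioc 0 (2 * Real.pi), (-u (circleMap c R θ)).toENNReal)) := by
    refine lintegral_tendsto_of_tendsto_of_monotone
      (fun n => ((hneg.measurable.comp (hmeas n))).ereal_toENNReal.aemeasurable)
      (Eventually.of_forall fun θ n m hnm => EReal.toENNReal_le_toENNReal
        (EReal.neg_le_neg_iff.2 (hmono θ n m hnm)))
      (Eventually.of_forall fun θ => ?_)
    exact ((EReal.continuous_toENNReal.comp hneg).tendsto _).comp (hgt _ (hmem θ))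
  have hPfin : (∫⁻ θ in Ioc 0 (2 * Real.pi), (u (circleMap c R θ)).toENNReal) /
      ENNReal.ofReal (2 * Real.pi) ≠ ⊤ := by
    refine ENNReal.div_ne_top (ne_top_of_le_ne_top hfin (lintegral_mono fun θ => ?_)) h2
    exact EReal.toENNReal_le_toENNReal (hug 0 _ (hmem θ))
  have t3 : Tendsto (fun n => circleMean (fun z => (g n z : EReal)) c R) atTop
      (𝓝 (circleMean u c R)) := by
    unfold circleMean
    simp only [sub_eq_add_neg]
    refine (EReal.continuousAt_add (Or.inl (mt EReal.coe_ennreal_eq_top_iff.1 hPfin))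
      (Or.inl (EReal.coe_ennreal_ne_bot _))).tendsto.comp
      (Tendsto.prodMk_nhds ?_ ?_)
    · exact (continuous_coe_ennreal_ereal.tendsto _).comp
        (ENNReal.Tendsto.div_const t1 (Or.inr h2))
    · exact ((hneg.comp continuous_coe_ennreal_ereal).tendsto _).comp
        (ENNReal.Tendsto.div_const t2 (Or.inr h2))
  obtain ⟨n, hn⟩ := (t3.eventually_lt_const hb).exists
  rw [circleMean_coe (hgc n).continuousOn.circleIntegrable'] at hn
  exact ⟨g n, hgc n, hug n, EReal.coe_lt_coe_iff.1 hn⟩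

/-- Circle means of a subharmonic function increase with the radius (including the radius `0`). -/
theorem SubharmonicOn.circleMean_le_circleMean (hu : SubharmonicOn u Ω) {c : ℂ} {r R : ℝ}
    (hΩ : Metric.closedBall c R ⊆ Ω) (hr0 : 0 ≤ r) (hr : r ≤ R) :
    circleMean u c r ≤ circleMean u c R := by
  rcases (hr0.trans hr).eq_or_lt with rfl | hR
  · rw [le_antisymm hr hr0]
  have hS : Metric.sphere c R ⊆ Ω := Metric.sphere_subset_closedBall.trans hΩ
  refine EReal.le_of_forall_lt_iff_le.1 fun b hb => ?_
  obtain ⟨g, hg, hug, hgb⟩ := exists_continuous_circleAverage_lt hR.le (hu.usc.mono hS)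
    (fun z hz => hu.lt_top z (hS hz)) hb
  exact (hu.circleMean_le_circleAverage hR hΩ hg hug hr0 hr).trans
    (EReal.coe_le_coe_iff.2 hgb.le)

/-- Circle means of a subharmonic function are right-continuous in the radius (including the
radius `0`). -/
theorem SubharmonicOn.tendsto_circleMean (hu : SubharmonicOn u Ω) {c : ℂ} {r R : ℝ}
    (hΩ : Metric.closedBall c R ⊆ Ω) (hr0 : 0 ≤ r) (hr : r < R) :
    Tendsto (fun t => circleMean u c t) (𝓝[>] r) (𝓝 (circleMean u c r)) := by
  have hIoo : Ioo r R ∈ 𝓝[>] r := Ioo_mem_nhdsGT hr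
  rw [tendsto_order]
  refine ⟨fun a ha => ?_, fun a ha => ?_⟩
  · filter_upwards [hIoo] with t ht
    exact ha.trans_le (hu.circleMean_le_circleMean
      ((Metric.closedBall_subset_closedBall ht.2.le).trans hΩ) hr0 ht.1.le)
  have hS : Metric.sphere c r ⊆ Metric.ball c R := fun z hz => by
    rw [Metric.mem_ball, Metric.mem_sphere.1 hz]; exact hr
  have hb : Metric.ball c R ⊆ Ω := Metric.ball_subset_closedBall.trans hΩ
  obtain ⟨b, hb1, hb2⟩ := EReal.lt_iff_exists_real_btwn.1 ha
  obtain ⟨g, hg, hug, hgb⟩ := exists_continuous_circleAverage_lt hr0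
    (hu.usc.mono (hS.trans hb)) (fun z hz => hu.lt_top z (hb (hS hz))) hb1
  set ε := b - Real.circleAverage g c r with hε
  have hε0 : 0 < ε := sub_pos.2 hgb
  have hgt : Tendsto (fun t => Real.circleAverage g c t) (𝓝[>] r) (𝓝 (Real.circleAverage g c r)) :=
    (Real.Continuous.circleAverage hg).continuousAt.tendsto.mono_left nhdsWithin_le_nhds
  -- The majorisation by g survives off the circle with slack ε/2: one ε/4 from semicontinuity of u,
  -- one from continuity of g.
  have hnear : ∀ z ∈ Metric.sphere c r, ∀ᶠ w in 𝓝 z, u w < ((g w + ε / 2 : ℝ) : EReal) := by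
    intro z hz
    have hz' : u z < ((g z + ε / 4 : ℝ) : EReal) :=
      (hug z hz).trans_lt (EReal.coe_lt_coe_iff.2 (by linarith))
    have h1 : ∀ᶠ w in 𝓝 z, u w < ((g z + ε / 4 : ℝ) : EReal) := by
      have := hu.usc z (hb (hS hz)) _ hz'
      exact this.filter_mono (le_of_eq (nhdsWithin_eq_nhds.2
        (Filter.mem_of_superset (Metric.isOpen_ball.mem_nhds (hS hz)) hb)).symm)
    filter_upwards [h1, (hg.tendsto z).eventually_const_lt (show g z - ε / 4 < g z by linarith)]
      with w hw1 hw2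
    exact hw1.trans (EReal.coe_lt_coe_iff.2 (by linarith))
  -- Compactness makes the neighbourhood uniform. The set of good points need not be open, since u
  -- is unconstrained off Ω, so an open subset V is carried through the induction.
  obtain ⟨δ, hδ, hδu⟩ : ∃ δ > 0, Metric.thickening δ (Metric.sphere c r) ⊆
      {w | u w < ((g w + ε / 2 : ℝ) : EReal)} := by
    obtain ⟨V, hSV, hVo, hV⟩ := (isCompact_sphere c r).induction_on
      (p := fun s => ∃ V, s ⊆ V ∧ IsOpen V ∧ V ⊆ {w | u w < ((g w + ε / 2 : ℝ) : EReal)})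
      ⟨∅, by simp, isOpen_empty, by simp⟩
      (fun s t hst ⟨V, h1, h2⟩ => ⟨V, hst.trans h1, h2⟩)
      (fun s t ⟨V, h1, h2, h3⟩ ⟨W, h1', h2', h3'⟩ => ⟨V ∪ W, union_subset_union h1 h1',
        h2.union h2', union_subset h3 h3'⟩)
      (fun z hz => by
        obtain ⟨V, h1, h2, h3⟩ := eventually_nhds_iff.1 (hnear z hz)
        exact ⟨V, mem_nhdsWithin_of_mem_nhds (h2.mem_nhds h3), V, le_rfl, h2, h1⟩)
    obtain ⟨δ, hδ, h⟩ := (isCompact_sphere c r).exists_thickening_subset_open hVo hSV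
    exact ⟨δ, hδ, h.trans hV⟩
  filter_upwards [hgt.eventually_lt_const (show Real.circleAverage g c r <
    Real.circleAverage g c r + ε / 2 by linarith), Ioo_mem_nhdsGT (show r < r + δ by linarith)]
    with t ht1 ht2
  refine lt_of_le_of_lt ?_ hb2
  have hc : Continuous fun w => g w + ε / 2 := by fun_prop
  have : circleMean u c t ≤ circleMean (fun w => ((g w + ε / 2 : ℝ) : EReal)) c t := by
    refine circleMean_mono_ae (Eventually.of_forall fun θ => le_of_lt (hδu ?_))
    refine Metric.mem_thickening_iff.2 ⟨circleMap c r θ, circleMap_mem_sphere c hr0 θ, ?_⟩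
    have : circleMap c t θ - circleMap c r θ = (t - r : ℝ) * Complex.exp (θ * Complex.I) := by
      simp only [circleMap]; push_cast; ring
    rw [dist_eq_norm, this, norm_mul, Complex.norm_exp_ofReal_mul_I, mul_one, Complex.norm_real,
      Real.norm_eq_abs, abs_of_pos (sub_pos.2 ht2.1)]
    linarith [ht2.2]
  refine this.trans ?_
  rw [circleMean_coe hc.continuousOn.circleIntegrable', Real.circleAverage_fun_add
    hg.continuousOn.circleIntegrable' (circleIntegrable_const _ _ _), Real.circleAverage_const]
  exact EReal.coe_le_coe_iff.2 (by linarith)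

end DeltaSubharmonic

/-! ### Local integrability of subharmonic functions -/

namespace DeltaSubharmonic

variable {u : ℂ → EReal} {Ω : Set ℂ}

/-- Polar coordinates use angles in (-π, π) and circle means use (0, 2π]; up to null sets both are
fundamental domains for translation by 2π. -/
lemma setLIntegral_circleMap_shift (F : ℂ → ℝ≥0∞) (c : ℂ) (t : ℝ) :
    ∫⁻ θ in Ioo (-Real.pi) Real.pi, F (circleMap c t θ) =
      ∫⁻ θ in Ioc 0 (2 * Real.pi), F (circleMap c t θ) := by
  rw [setLIntegral_congr Ioo_ae_eq_Ioc]
  have h1 := isAddFundamentalDomain_Ioc Real.two_pi_pos (-Real.pi)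
  have h2 := isAddFundamentalDomain_Ioc Real.two_pi_pos 0
  have := h1.setLIntegral_eq h2 (fun θ => F (circleMap c t θ)) (fun g x => by
    congr 1
    obtain ⟨n, hn⟩ := AddSubgroup.mem_zmultiples_iff.1 g.2
    rw [AddSubgroup.vadd_def, ← hn, vadd_eq_add, add_comm]
    exact (periodic_circleMap c t).zsmul n x)
  simpa [show -Real.pi + 2 * Real.pi = Real.pi by ring] using this

lemma lintegral_polar {F : ℂ → ℝ≥0∞} (hF : Measurable F) (c : ℂ) :
    ∫⁻ z, F z = ∫⁻ t in Ioi (0 : ℝ), ENNReal.ofReal t *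
      ∫⁻ θ in Ioc 0 (2 * Real.pi), F (circleMap c t θ) := by
  rw [← lintegral_add_left_eq_self F c, ← Complex.lintegral_comp_polarCoord_symm,
    polarCoord_target, Measure.volume_eq_prod, setLIntegral_prod]
  · refine setLIntegral_congr_fun measurableSet_Ioi fun t ht => ?_
    simp only [smul_eq_mul]
    rw [lintegral_const_mul' _ _ ENNReal.ofReal_ne_top, ← setLIntegral_circleMap_shift]
    congr 1
    refine setLIntegral_congr_fun measurableSet_Ioo fun θ _ => ?_
    simp only [Complex.polarCoord_symm_apply, circleMap, Complex.exp_mul_I, Complex.ofReal_cos,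
      Complex.ofReal_sin]
  · refine AEMeasurable.restrict (Measurable.aemeasurable ?_)
    simp only [smul_eq_mul, Complex.polarCoord_symm_apply]
    refine (ENNReal.measurable_ofReal.comp measurable_fst).mul (hF.comp ?_)
    exact Continuous.measurable (by fun_prop)

lemma lintegral_closedBall_polar {F : ℂ → ℝ≥0∞} (hF : Measurable F) (c : ℂ) (R : ℝ) :
    ∫⁻ z in Metric.closedBall c R, F z = ∫⁻ t in Ioc 0 R, ENNReal.ofReal t *
      ∫⁻ θ in Ioc 0 (2 * Real.pi), F (circleMap c t θ) := by
  rw [← lintegral_indicator Metric.isClosed_closedBall.measurableSet,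
    lintegral_polar (hF.indicator Metric.isClosed_closedBall.measurableSet) c,
    ← lintegral_indicator measurableSet_Ioi, ← lintegral_indicator measurableSet_Ioc]
  refine lintegral_congr fun t => ?_
  by_cases h0 : 0 < t
  · rw [indicator_of_mem (mem_Ioi.2 h0)]
    have hmem : ∀ θ, circleMap c t θ ∈ Metric.closedBall c R ↔ t ≤ R := by
      intro θ
      rw [Metric.mem_closedBall, Metric.mem_sphere.1 (circleMap_mem_sphere c h0.le θ)]
    by_cases hR : t ≤ R
    · rw [indicator_of_mem (mem_Ioc.2 ⟨h0, hR⟩)]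
      simp [indicator, hmem, hR]
    · rw [indicator_of_notMem (fun h => hR h.2)]
      simp [indicator, hmem, hR]
  · rw [indicator_of_notMem (by simpa using h0), indicator_of_notMem (fun h => h0 h.1)]

/-- Off Ω nothing is known about u, so measurability is available only for the extension by zero;
integrals over subsets of Ω are transferred to it. -/
lemma measurable_indicator_of_usc (hΩ : IsOpen Ω) (hu : UpperSemicontinuousOn u Ω) :
    Measurable (Ω.indicator u) := by
  refine measurable_of_restrict_of_restrict_compl hΩ.measurableSet ?_ ?_
  · rw [show Ω.domRestrict (Ω.indicator u) = Ω.domRestrict u from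
      funext fun x => indicator_of_mem x.2 _]
    exact (upperSemicontinuousOn_iff_restrict.2 hu).measurable
  · rw [show Ωᶜ.domRestrict (Ω.indicator u) = fun _ => 0 from
      funext fun x => indicator_of_notMem x.2 _]
    exact measurable_const

lemma SubharmonicOn.measurable_circle (hΩ : IsOpen Ω) (hu : SubharmonicOn u Ω) {c : ℂ} {r : ℝ}
    (hr : 0 ≤ r) (hs : Metric.sphere c r ⊆ Ω) : Measurable fun θ => u (circleMap c r θ) := by
  have := (measurable_indicator_of_usc hΩ hu.usc).comp (continuous_circleMap c r).measurable
  convert this using 2 with θ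
  simp [hs (circleMap_mem_sphere c hr θ)]

/-- The positive part has mean at most M, so a mean of at least a leaves at most M - a for the
negative part. -/
lemma lintegral_neg_circle_le {c : ℂ} {r M a : ℝ} (hr : 0 ≤ r) (hM : 0 ≤ M)
    (hu : ∀ z ∈ Metric.sphere c r, u z ≤ M) (ha : (a : EReal) ≤ circleMean u c r) :
    ∫⁻ θ in Ioc 0 (2 * Real.pi), (-u (circleMap c r θ)).toENNReal ≤
      ENNReal.ofReal (2 * Real.pi) * ENNReal.ofReal (M - a) := by
  have h2 : ENNReal.ofReal (2 * Real.pi) ≠ 0 := by simpa using Real.pi_pos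
  unfold circleMean at ha
  set p := (∫⁻ θ in Ioc 0 (2 * Real.pi), (u (circleMap c r θ)).toENNReal) /
    ENNReal.ofReal (2 * Real.pi) with hp
  set n := (∫⁻ θ in Ioc 0 (2 * Real.pi), (-u (circleMap c r θ)).toENNReal) /
    ENNReal.ofReal (2 * Real.pi) with hn
  have hpM : p ≤ ENNReal.ofReal M := by
    rw [hp, ENNReal.div_le_iff h2 ENNReal.ofReal_ne_top]
    calc ∫⁻ θ in Ioc 0 (2 * Real.pi), (u (circleMap c r θ)).toENNReal
        ≤ ∫⁻ θ in Ioc 0 (2 * Real.pi), ENNReal.ofReal M := by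
          refine lintegral_mono fun θ => ?_
          exact EReal.toENNReal_le_toENNReal (hu _ (circleMap_mem_sphere c hr θ))
      _ = _ := by simp
  have hn' : n ≤ ENNReal.ofReal (M - a) := by
    have hp' : p ≠ ⊤ := ne_top_of_le_ne_top ENNReal.ofReal_ne_top hpM
    have hnt : n ≠ ⊤ := by
      intro h; rw [h] at ha; simp at ha
    clear_value p n
    lift p to NNReal using hp'
    lift n to NNReal using hnt
    have h1 : ((a : ℝ) : EReal) ≤ ((p - n : ℝ) : EReal) := by
      rw [EReal.coe_sub]; exact ha
    have h2 := EReal.coe_le_coe_iff.1 h1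
    have h3 : (p : ℝ) ≤ M := by
      rw [ENNReal.ofReal, ENNReal.coe_le_coe] at hpM
      have : (p : ℝ) ≤ (Real.toNNReal M : ℝ) := by exact_mod_cast hpM
      rwa [Real.coe_toNNReal _ hM] at this
    rw [ENNReal.ofReal, ENNReal.coe_le_coe]
    refine NNReal.coe_le_coe.1 (le_trans ?_ (Real.le_coe_toNNReal _))
    linarith
  rw [hn, ENNReal.div_le_iff h2 ENNReal.ofReal_ne_top] at hn'
  rwa [mul_comm (ENNReal.ofReal _)]

lemma measurable_indicator_neg (hΩ : IsOpen Ω) (hu : UpperSemicontinuousOn u Ω) :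
    Measurable (Ω.indicator fun z => (-u z).toENNReal) := by
  have := ((continuous_neg (G := EReal)).measurable.comp
    (measurable_indicator_of_usc hΩ hu)).ereal_toENNReal
  convert this using 1
  ext z
  by_cases h : z ∈ Ω <;> simp [h]

lemma SubharmonicOn.lintegral_closedBall_neg_polar (hΩ : IsOpen Ω) (hu : SubharmonicOn u Ω) {c : ℂ}
    {R : ℝ} (hs : Metric.closedBall c R ⊆ Ω) :
    ∫⁻ z in Metric.closedBall c R, (-u z).toENNReal = ∫⁻ t in Ioc 0 R, ENNReal.ofReal t *
      ∫⁻ θ in Ioc 0 (2 * Real.pi), (-u (circleMap c t θ)).toENNReal := by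
  have h1 := lintegral_closedBall_polar (measurable_indicator_neg hΩ hu.usc) c R
  rw [setLIntegral_congr_fun (g := fun z => (-u z).toENNReal)
    Metric.isClosed_closedBall.measurableSet (fun z hz => indicator_of_mem (hs hz) _)] at h1
  rw [h1]
  refine setLIntegral_congr_fun measurableSet_Ioc fun t ht => ?_
  congr 1
  refine lintegral_congr fun θ => indicator_of_mem (hs ?_) _
  rw [Metric.mem_closedBall, Metric.mem_sphere.1 (circleMap_mem_sphere c ht.1.le θ)]
  exact ht.2

/-- A finite value at the centre bounds every circle mean from below, which controls the negative
part on all circles uniformly in the radius; then integrate in polar coordinates. -/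
lemma SubharmonicOn.lintegral_closedBall_neg_lt_top_of_center (hΩ : IsOpen Ω)
    (hu : SubharmonicOn u Ω) {c : ℂ} {R : ℝ} (hs : Metric.closedBall c R ⊆ Ω) (hc : u c ≠ ⊥) :
    ∫⁻ z in Metric.closedBall c R, (-u z).toENNReal < ⊤ := by
  rcases lt_or_ge R 0 with hR | hR
  · simp [Metric.closedBall_eq_empty.2 hR]
  have hcΩ : c ∈ Ω := hs (Metric.mem_closedBall_self hR)
  obtain ⟨M, hM, hMu⟩ := upperSemicontinuousOn_exists_coe_le (isCompact_closedBall c R)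
    (hu.usc.mono hs) fun z hz => hu.lt_top z (hs hz)
  rw [hu.lintegral_closedBall_neg_polar hΩ hs]
  calc _ ≤ ∫⁻ t in Ioc 0 R, ENNReal.ofReal R *
        (ENNReal.ofReal (2 * Real.pi) * ENNReal.ofReal (M - (u c).toReal)) := by
        refine setLIntegral_mono measurable_const fun t ht => ?_
        gcongr
        · exact ht.2
        have hts : Metric.closedBall c t ⊆ Metric.closedBall c R :=
          Metric.closedBall_subset_closedBall ht.2
        refine lintegral_neg_circle_le ht.1.le hM
          (fun z hz => hMu z (hts (Metric.sphere_subset_closedBall hz))) ?_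
        rw [EReal.coe_toReal (hu.lt_top c hcΩ).ne hc, ← circleMean_radius_zero u c]
        exact hu.circleMean_le_circleMean (hts.trans hs) le_rfl ht.1.le
    _ < ⊤ := by
        rw [lintegral_const]
        simp [ENNReal.mul_lt_top_iff]

lemma SubharmonicOn.eventually_eq_bot_or (hΩ : IsOpen Ω) (hu : SubharmonicOn u Ω) {z : ℂ}
    (hz : z ∈ Ω) : (∀ᶠ w in 𝓝 z, u w = ⊥) ∨ ∃ V ∈ 𝓝 z, ∫⁻ w in V, (-u w).toENNReal < ⊤ := by
  obtain ⟨r, hr, hrΩ⟩ := Metric.nhds_basis_closedBall.mem_iff.1 (hΩ.mem_nhds hz)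
  -- With w within r/3 of z, the disc of radius 2r/3 about w lies in the disc of radius r about z
  -- and contains the ball of radius r/3 about z.
  by_cases h : ∃ w ∈ Metric.ball z (r / 3), u w ≠ ⊥
  · obtain ⟨w, hw, hwb⟩ := h
    right
    refine ⟨Metric.ball z (r / 3), Metric.ball_mem_nhds _ (by positivity), ?_⟩
    rw [Metric.mem_ball] at hw
    have h1 : Metric.closedBall w (2 * r / 3) ⊆ Ω :=
      (Metric.closedBall_subset_closedBall' (by linarith)).trans hrΩ
    have h2 : Metric.ball z (r / 3) ⊆ Metric.closedBall w (2 * r / 3) :=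
      Metric.ball_subset_closedBall.trans
        (Metric.closedBall_subset_closedBall' (by rw [dist_comm]; linarith))
    exact (lintegral_mono_set h2).trans_lt (hu.lintegral_closedBall_neg_lt_top_of_center hΩ h1 hwb)
  · push Not at h
    left
    filter_upwards [Metric.ball_mem_nhds z (show 0 < r / 3 by positivity)] with w hw using h w hw

/-- The points near which u is identically -∞ and those near which its negative part is integrable
form two disjoint open sets covering Ω. A preconnected set containing a finite value of u lies in
the second. -/
lemma SubharmonicOn.exists_lintegral_lt_top_of_isPreconnected (hΩ : IsOpen Ω)
    (hu : SubharmonicOn u Ω) {U : Set ℂ} (hU : IsPreconnected U) (hUΩ : U ⊆ Ω)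
    (hne : ∃ z ∈ U, u z ≠ ⊥) : ∀ z ∈ U, ∃ V ∈ 𝓝 z, ∫⁻ w in V, (-u w).toENNReal < ⊤ := by
  set A := {z : ℂ | ∀ᶠ w in 𝓝 z, u w = ⊥} with hA
  set B := {z : ℂ | ∃ V ∈ 𝓝 z, ∫⁻ w in V, (-u w).toENNReal < ⊤} with hB
  have hAo : IsOpen A := isOpen_setOfPred_eventually_nhds
  have hBo : IsOpen B := by
    refine isOpen_iff_mem_nhds.2 fun z ⟨V, hV, hlt⟩ => ?_
    filter_upwards [eventually_mem_nhds_iff.2 hV] with w hw using ⟨V, hw, hlt⟩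
  have hAB : A ∩ B = ∅ := by
    rw [eq_empty_iff_forall_notMem]
    rintro z ⟨h1, V, hV, hlt⟩
    have hW : V ∩ {w | u w = ⊥} ∈ 𝓝 z := inter_mem hV h1
    have h2 : ∫⁻ w in V ∩ {w | u w = ⊥}, (-u w).toENNReal < ⊤ :=
      (lintegral_mono_set inter_subset_left).trans_lt hlt
    obtain ⟨W, hWs, hWo, hzW⟩ := mem_nhds_iff.1 hW
    have h3 : ∫⁻ w in W, (-u w).toENNReal < ⊤ := (lintegral_mono_set hWs).trans_lt h2
    rw [setLIntegral_congr_fun (g := fun _ => ⊤) hWo.measurableSet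
      (fun w hw => by rw [show u w = ⊥ from (hWs hw).2]; simp), lintegral_const] at h3
    have h4 : volume W ≠ 0 := (hWo.measure_pos volume ⟨z, hzW⟩).ne'
    simp [ENNReal.top_mul, h4] at h3
  obtain ⟨x, hxU, hx⟩ := hne
  have hxB : x ∈ B := (hu.eventually_eq_bot_or hΩ (hUΩ hxU)).resolve_left fun h => hx h.self_of_nhds
  intro z hz
  by_contra hzB
  have hzA : z ∈ A := (hu.eventually_eq_bot_or hΩ (hUΩ hz)).resolve_right hzB
  obtain ⟨y, _, hy⟩ := hU A B hAo hBo (fun w hw => hu.eventually_eq_bot_or hΩ (hUΩ hw))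
    ⟨z, hz, hzA⟩ ⟨x, hxU, hxB⟩
  rw [hAB] at hy
  exact hy

lemma lintegral_lt_top_of_isCompact {K : Set ℂ} (hK : IsCompact K) {F : ℂ → ℝ≥0∞}
    (h : ∀ z ∈ K, ∃ V ∈ 𝓝 z, ∫⁻ w in V, F w < ⊤) : ∫⁻ w in K, F w < ⊤ := by
  refine hK.induction_on (p := fun s => ∫⁻ w in s, F w < ⊤) (by simp)
    (fun s t hst h => (lintegral_mono_set hst).trans_lt h)
    (fun s t hs ht => (lintegral_union_le _ _ _).trans_lt (ENNReal.add_lt_top.2 ⟨hs, ht⟩))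
    fun z hz => ?_
  obtain ⟨V, hV, hlt⟩ := h z hz
  exact ⟨V, mem_nhdsWithin_of_mem_nhds hV, hlt⟩

lemma SubharmonicOn.lintegral_closedBall_neg_lt_top (hΩ : IsOpen Ω) (hu : SubharmonicOn u Ω) {c : ℂ}
    {R : ℝ} (hs : Metric.closedBall c R ⊆ Ω) (hne : ∃ z ∈ Metric.closedBall c R, u z ≠ ⊥) :
    ∫⁻ z in Metric.closedBall c R, (-u z).toENNReal < ⊤ :=
  lintegral_lt_top_of_isCompact (isCompact_closedBall c R)
    (hu.exists_lintegral_lt_top_of_isPreconnected hΩ (convex_closedBall c R).isPreconnected hs hne)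

lemma enorm_toReal_le {x : EReal} {M : ℝ} (hx : x ≤ M) :
    ‖x.toReal‖ₑ ≤ ENNReal.ofReal M + (-x).toENNReal := by
  induction x with
  | bot => simp
  | top => simp at hx
  | coe a =>
    rw [← EReal.coe_neg, EReal.real_coe_toENNReal, EReal.toReal_coe, Real.enorm_eq_ofReal_abs]
    rcases le_total 0 a with h | h
    · rw [abs_of_nonneg h]
      exact (ENNReal.ofReal_le_ofReal (EReal.coe_le_coe_iff.1 hx)).trans le_self_add
    · rw [abs_of_nonpos h]
      exact le_add_self

lemma SubharmonicOn.locallyIntegrableOn_toReal (hΩ : IsOpen Ω) (hu : SubharmonicOn u Ω) :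
    LocallyIntegrableOn (fun z => (u z).toReal) Ω := by
  intro z hz
  rw [nhdsWithin_eq_nhds.2 (hΩ.mem_nhds hz)]
  -- Where u is identically -∞ near z, `EReal.toReal` takes the value 0 and integrability is
  -- trivial.
  rcases hu.eventually_eq_bot_or hΩ hz with h | ⟨V, hV, hlt⟩
  · refine ⟨{w | u w = ⊥} ∩ Ω, inter_mem h (hΩ.mem_nhds hz), ?_⟩
    have hm : MeasurableSet ({w | u w = ⊥} ∩ Ω) := by
      have : {w | u w = ⊥} ∩ Ω = {w | (Ω.indicator u) w = ⊥} ∩ Ω := by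
        ext w; constructor <;> rintro ⟨h1, h2⟩ <;> simp_all
      rw [this]
      exact ((measurable_indicator_of_usc hΩ hu.usc) (measurableSet_singleton ⊥)).inter
        hΩ.measurableSet
    refine (integrableOn_zero (s := {w | u w = ⊥} ∩ Ω) (μ := volume)).congr_fun (fun w hw => ?_) hm
    simp [show u w = ⊥ from hw.1]
  · obtain ⟨r, hr, hrV⟩ := Metric.nhds_basis_closedBall.mem_iff.1 (inter_mem hV (hΩ.mem_nhds hz))
    refine ⟨Metric.closedBall z r, Metric.closedBall_mem_nhds z hr, ?_⟩
    have hrΩ : Metric.closedBall z r ⊆ Ω := hrV.trans inter_subset_right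
    obtain ⟨M, hM, hMu⟩ := upperSemicontinuousOn_exists_coe_le (isCompact_closedBall z r)
      (hu.usc.mono hrΩ) fun z hz => hu.lt_top z (hrΩ hz)
    have hmeas : Measurable fun w => ((Ω.indicator u) w).toReal :=
      (measurable_indicator_of_usc hΩ hu.usc).ereal_toReal
    have hEq : EqOn (fun w => ((Ω.indicator u) w).toReal) (fun w => (u w).toReal)
        (Metric.closedBall z r) := fun w hw => by simp [hrΩ hw]
    have hcm := (Metric.isClosed_closedBall (x := z) (ε := r)).measurableSet
    refine ⟨(hmeas.aestronglyMeasurable.congr (ae_restrict_of_forall_mem hcm hEq)), ?_⟩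
    have hb : ∀ w ∈ Metric.closedBall z r, ‖(u w).toReal‖ₑ ≤ ENNReal.ofReal M + (-u w).toENNReal := by
      exact fun w hw => enorm_toReal_le (hMu w hw)
    calc ∫⁻ w in Metric.closedBall z r, ‖(u w).toReal‖ₑ
        ≤ ∫⁻ w in Metric.closedBall z r, (ENNReal.ofReal M + (-u w).toENNReal) :=
          setLIntegral_mono' hcm hb
      _ = (∫⁻ w in Metric.closedBall z r, ENNReal.ofReal M) +
          ∫⁻ w in Metric.closedBall z r, (-u w).toENNReal := by
          rw [lintegral_add_left measurable_const]
      _ < ⊤ := by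
          refine ENNReal.add_lt_top.2 ⟨?_, (lintegral_mono_set (hrV.trans inter_subset_left)).trans_lt
            hlt⟩
          rw [lintegral_const, Measure.restrict_apply_univ]
          exact ENNReal.mul_lt_top ENNReal.ofReal_lt_top (isCompact_closedBall z r).measure_lt_top

lemma SubharmonicOn.integrableOn_closedBall (hΩ : IsOpen Ω) (hu : SubharmonicOn u Ω) {c : ℂ} {R : ℝ}
    (hs : Metric.closedBall c R ⊆ Ω) :
    IntegrableOn (fun z => (u z).toReal) (Metric.closedBall c R) :=
  (hu.locallyIntegrableOn_toReal hΩ).integrableOn_compact_subset hs (isCompact_closedBall c R)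

lemma SubharmonicOn.ae_ne_bot (hΩ : IsOpen Ω) (hu : SubharmonicOn u Ω) {c : ℂ} {R : ℝ}
    (hs : Metric.closedBall c R ⊆ Ω) (hne : ∃ z ∈ Metric.closedBall c R, u z ≠ ⊥) :
    ∀ᵐ z ∂(volume.restrict (Metric.closedBall c R)), u z ≠ ⊥ := by
  have hm := measurable_indicator_neg hΩ hu.usc
  have hEq : EqOn (Ω.indicator fun z => (-u z).toENNReal) (fun z => (-u z).toENNReal)
    (Metric.closedBall c R) := fun w hw => by simp [hs hw]
  have hcm := (Metric.isClosed_closedBall (x := c) (ε := R)).measurableSet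
  have h1 := ae_lt_top' (hm.aemeasurable.congr (ae_restrict_of_forall_mem hcm hEq))
    (hu.lintegral_closedBall_neg_lt_top hΩ hs hne).ne
  filter_upwards [h1] with z hz h
  simp [h] at hz

lemma SubharmonicOn.circleMean_ne_bot (hΩ : IsOpen Ω) (hu : SubharmonicOn u Ω) {c : ℂ} {R r : ℝ}
    (hs : Metric.closedBall c R ⊆ Ω) (hne : ∃ z ∈ Metric.closedBall c R, u z ≠ ⊥)
    (hr0 : 0 < r) (hr : r ≤ R) : circleMean u c r ≠ ⊥ := by
  have h1 : ∫⁻ t in Ioc 0 R, ENNReal.ofReal t *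
      ∫⁻ θ in Ioc 0 (2 * Real.pi), (-u (circleMap c t θ)).toENNReal ≠ ⊤ := by
    rw [← hu.lintegral_closedBall_neg_polar hΩ hs]
    exact (hu.lintegral_closedBall_neg_lt_top hΩ hs hne).ne
  -- If the negative part were non-integrable on every circle of radius at most r, its area integral
  -- would be infinite. One good radius suffices, since means increase with the radius.
  obtain ⟨t, ht, htf⟩ : ∃ t ∈ Ioc 0 r,
      ∫⁻ θ in Ioc 0 (2 * Real.pi), (-u (circleMap c t θ)).toENNReal ≠ ⊤ := by
    by_contra! hcon
    have h2 : ∫⁻ t in Ioc 0 r, ENNReal.ofReal t *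
        ∫⁻ θ in Ioc 0 (2 * Real.pi), (-u (circleMap c t θ)).toENNReal = ⊤ := by
      rw [setLIntegral_congr_fun (g := fun _ => ⊤) measurableSet_Ioc fun t ht => by
        simp only [hcon t ht]
        exact ENNReal.mul_top (by simpa using ht.1)]
      simp [ENNReal.top_mul, hr0]
    have h3 := lintegral_mono_set (μ := volume) (f := fun t => ENNReal.ofReal t *
        ∫⁻ θ in Ioc 0 (2 * Real.pi), (-u (circleMap c t θ)).toENNReal)
        (show Ioc 0 r ⊆ Ioc 0 R from fun x hx => ⟨hx.1, hx.2.trans hr⟩)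
    rw [h2, top_le_iff] at h3
    exact h1 h3
  have h4 : circleMean u c t ≠ ⊥ := by
    have h2 : (ENNReal.ofReal (2 * Real.pi)) ≠ 0 := by simpa using Real.pi_pos
    unfold circleMean
    rw [sub_eq_add_neg, Ne, EReal.add_eq_bot_iff, not_or]
    refine ⟨EReal.coe_ennreal_ne_bot _, ?_⟩
    rw [EReal.neg_eq_bot_iff, EReal.coe_ennreal_eq_top_iff]
    exact ENNReal.div_ne_top htf h2
  have h5 := hu.circleMean_le_circleMean ((Metric.closedBall_subset_closedBall hr).trans hs)
    ht.1.le ht.2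
  exact fun h => h4 (le_bot_iff.1 (h ▸ h5))

/-- On a circle over which the mean of `f` is finite, `f` is almost everywhere finite and integrable,
and the mean is the usual average. -/
lemma circleMean_eq_coe_circleAverage {f : ℂ → EReal} {c : ℂ} {r M : ℝ} (hr : 0 ≤ r)
    (hf : Measurable fun θ => f (circleMap c r θ)) (hM : ∀ z ∈ Metric.sphere c r, f z ≤ M)
    (hb : circleMean f c r ≠ ⊥) :
    CircleIntegrable (fun z => (f z).toReal) c r ∧
      (∀ᵐ θ ∂(volume.restrict (Ioc 0 (2 * Real.pi))), f (circleMap c r θ) ≠ ⊥) ∧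
      circleMean f c r = ((Real.circleAverage (fun z => (f z).toReal) c r : ℝ) : EReal) := by
  wlog hM0 : 0 ≤ M generalizing M
  · exact this (M := max M 0) (fun z hz => (hM z hz).trans
      (EReal.coe_le_coe_iff.2 (le_max_left _ _))) (le_max_right _ _)
  obtain ⟨a, ha⟩ : ∃ a : ℝ, (a : EReal) ≤ circleMean f c r := by
    obtain ⟨a, _, ha⟩ := EReal.lt_iff_exists_real_btwn.1 (bot_lt_iff_ne_bot.2 hb)
    exact ⟨a, ha.le⟩
  have hN := (lintegral_neg_circle_le hr hM0 hM ha).trans_lt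
    (ENNReal.mul_lt_top ENNReal.ofReal_lt_top ENNReal.ofReal_lt_top)
  have hneg : Measurable fun θ => (-f (circleMap c r θ)).toENNReal :=
    ((continuous_neg (G := EReal)).measurable.comp hf).ereal_toENNReal
  have hae : ∀ᵐ θ ∂(volume.restrict (Ioc 0 (2 * Real.pi))), f (circleMap c r θ) ≠ ⊥ := by
    filter_upwards [ae_lt_top hneg hN.ne] with θ hθ h
    simp [h] at hθ
  have hint : IntegrableOn (fun θ => (f (circleMap c r θ)).toReal) (Ioc 0 (2 * Real.pi)) := by
    refine ⟨hf.ereal_toReal.aestronglyMeasurable, ?_⟩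
    refine (lintegral_mono fun θ => enorm_toReal_le
      (hM _ (circleMap_mem_sphere c hr θ))).trans_lt ?_
    rw [lintegral_add_left measurable_const]
    refine ENNReal.add_lt_top.2 ⟨?_, hN⟩
    simp [ENNReal.mul_lt_top_iff]
  have hci : CircleIntegrable (fun z => (f z).toReal) c r :=
    (intervalIntegrable_iff_integrableOn_Ioc_of_le Real.two_pi_pos.le).2 hint
  refine ⟨hci, hae, ?_⟩
  rw [← circleMean_coe hci]
  refine circleMean_congr_ae ?_
  filter_upwards [hae] with θ hθ
  refine (EReal.coe_toReal (ne_of_lt ?_) hθ).symm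
  exact (hM _ (circleMap_mem_sphere c hr θ)).trans_lt (EReal.coe_lt_top _)

end DeltaSubharmonic

/-! ### Laplacians of radial functions -/

namespace DeltaSubharmonic

variable {u : ℂ → EReal} {Ω : Set ℂ}

lemma hasDerivAt_line (z e : ℂ) (s : ℝ) : HasDerivAt (fun s : ℝ => z + s • e) e s := by
  simpa using ((hasDerivAt_id s).smul_const e).const_add z

lemma fderiv_fderiv_apply_eq_deriv {f : ℂ → ℝ} (hf : ContDiff ℝ 2 f) (z e : ℂ) :
    HasDerivAt (fun s : ℝ => fderiv ℝ f (z + s • e) e) (fderiv ℝ (fderiv ℝ f) z e e) 0 := by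
  have h1 : ContDiff ℝ 1 (fderiv ℝ f) := hf.fderiv_right (by norm_num)
  have h2 : HasFDerivAt (fderiv ℝ f) (fderiv ℝ (fderiv ℝ f) z) (z + (0 : ℝ) • e) := by
    simpa using (h1.differentiable (by norm_num) z).hasFDerivAt
  have h3 := h2.comp_hasDerivAt (0 : ℝ) (hasDerivAt_line z e 0)
  simpa using h3.clm_apply (hasDerivAt_const (0 : ℝ) e)

lemma laplacian_eq_fderiv (f : ℂ → ℝ) (z : ℂ) :
    Laplacian.laplacian f z = fderiv ℝ (fderiv ℝ f) z 1 1 +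
      fderiv ℝ (fderiv ℝ f) z Complex.I Complex.I := by
  rw [InnerProductSpace.laplacian_eq_iteratedFDeriv_complexPlane]
  simp [iteratedFDeriv_two_apply]

lemma laplacian_comp_norm_sub_sq {L : ℝ → ℝ} (hL : ContDiff ℝ 2 L) (c z : ℂ) :
    Laplacian.laplacian (fun z => L (‖z - c‖ ^ 2)) z =
      4 * (‖z - c‖ ^ 2 * deriv (deriv L) (‖z - c‖ ^ 2) + deriv L (‖z - c‖ ^ 2)) := by
  have hq : ContDiff ℝ 2 fun z : ℂ => ‖z - c‖ ^ 2 := (contDiff_id.sub contDiff_const).norm_sq ℝ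
  have hf : ContDiff ℝ 2 fun z : ℂ => L (‖z - c‖ ^ 2) := hL.comp hq
  have hL1 : ContDiff ℝ 1 (deriv L) := by
    have := (contDiff_succ_iff_deriv (n := 1) (f := L)).1 (by rw [one_add_one_eq_two]; exact hL)
    exact this.2.2
  have hqd : ∀ w e : ℂ, ∀ s : ℝ, HasDerivAt (fun s : ℝ => ‖w + s • e - c‖ ^ 2)
      (2 * inner ℝ (w + s • e - c) e) s := by
    intro w e s
    have := ((hasDerivAt_line w e s).sub_const c).norm_sq
    simpa using this
  have hfd : ∀ w e : ℂ, fderiv ℝ (fun z : ℂ => L (‖z - c‖ ^ 2)) w e =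
      deriv L (‖w - c‖ ^ 2) * (2 * inner ℝ (w - c) e) := by
    intro w e
    have h1 : HasFDerivAt (fun z : ℂ => L (‖z - c‖ ^ 2))
        (fderiv ℝ (fun z : ℂ => L (‖z - c‖ ^ 2)) w) (w + (0 : ℝ) • e) := by
      simpa using (hf.differentiable (by norm_num) w).hasFDerivAt
    have h2 := h1.comp_hasDerivAt (0 : ℝ) (hasDerivAt_line w e 0)
    have h3 := ((hL.differentiable (by norm_num)) (‖w + (0 : ℝ) • e - c‖ ^ 2)).hasDerivAt.comp
      (0 : ℝ) (hqd w e 0)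
    have := h2.unique h3
    simpa using this
  have key : ∀ e : ℂ, fderiv ℝ (fderiv ℝ (fun z : ℂ => L (‖z - c‖ ^ 2))) z e e =
      deriv (deriv L) (‖z - c‖ ^ 2) * (2 * inner ℝ (z - c) e) * (2 * inner ℝ (z - c) e) +
        deriv L (‖z - c‖ ^ 2) * (2 * inner ℝ e e) := by
    intro e
    have h1 := fderiv_fderiv_apply_eq_deriv hf z e
    simp only [hfd] at h1
    have h3 := ((hL1.differentiable (by norm_num)) (‖z + (0 : ℝ) • e - c‖ ^ 2)).hasDerivAt.comp
      (0 : ℝ) (hqd z e 0)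
    have h4 : HasDerivAt (fun s : ℝ => 2 * inner ℝ (z + s • e - c) e) (2 * inner ℝ e e) 0 := by
      have := (((hasDerivAt_line z e 0).sub_const c).inner ℝ (hasDerivAt_const (0 : ℝ) e)).const_mul 2
      simpa using this
    have := h1.unique (h3.mul h4)
    simpa using this
  rw [laplacian_eq_fderiv, key, key]
  simp only [Complex.inner, ← Complex.normSq_eq_norm_sq, Complex.normSq_apply]
  simp
  ring

/-- A smooth function that increases from `0` to `1` on `[a, b]`. -/
noncomputable def smoothStep (a b q : ℝ) : ℝ := Real.smoothTransition ((q - a) / (b - a))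

/-! ### Smooth steps and their derivatives. -/

section smoothStep

variable {a b q : ℝ}

lemma contDiff_smoothStep {n : ℕ∞} : ContDiff ℝ n (smoothStep a b) :=
  Real.smoothTransition.contDiff.comp ((contDiff_id.sub contDiff_const).div_const _)

lemma smoothStep_of_le (hab : a < b) (h : q ≤ a) : smoothStep a b q = 0 :=
  Real.smoothTransition.zero_of_nonpos (div_nonpos_of_nonpos_of_nonneg (by linarith) (by linarith))

lemma smoothStep_of_ge (hab : a < b) (h : b ≤ q) : smoothStep a b q = 1 :=
  Real.smoothTransition.one_of_one_le (by rw [le_div_iff₀ (by linarith)]; linarith)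

lemma monotone_smoothStep (hab : a < b) : Monotone (smoothStep a b) := fun x y hxy =>
  Real.smoothTransition.monotone (by
    have : 0 < b - a := by linarith
    gcongr)

lemma smoothStep_nonneg : 0 ≤ smoothStep a b q := Real.smoothTransition.nonneg _

lemma smoothStep_le_one : smoothStep a b q ≤ 1 := Real.smoothTransition.le_one _

lemma deriv_smoothStep_nonneg (hab : a < b) : 0 ≤ deriv (smoothStep a b) q :=
  (monotone_smoothStep hab).deriv_nonneg

lemma deriv_smoothStep_eq_zero (hab : a < b) (h : q ∉ Icc a b) : deriv (smoothStep a b) q = 0 := by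
  rcases lt_or_ge q a with h1 | h1
  · have : smoothStep a b =ᶠ[𝓝 q] fun _ => 0 := by
      filter_upwards [Iio_mem_nhds h1] with x hx using smoothStep_of_le hab (le_of_lt hx)
    rw [this.deriv_eq, deriv_const]
  · have h2 : b < q := by
      by_contra h2; exact h ⟨h1, not_lt.1 h2⟩
    have : smoothStep a b =ᶠ[𝓝 q] fun _ => 1 := by
      filter_upwards [Ioi_mem_nhds h2] with x hx using smoothStep_of_ge hab (le_of_lt hx)
    rw [this.deriv_eq, deriv_const]

lemma continuous_deriv_smoothStep : Continuous (deriv (smoothStep a b)) :=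
  (contDiff_smoothStep (n := 1)).continuous_deriv le_rfl

lemma hasDerivAt_smoothStep : HasDerivAt (smoothStep a b) (deriv (smoothStep a b) q) q :=
  ((contDiff_smoothStep (n := 1)).differentiable (by norm_num) q).hasDerivAt

end smoothStep

/-! ### Radial test functions of logarithmic type. -/

section radial

variable {η : ℝ → ℝ} {a b : ℝ}

/-- The primitive `q ↦ ∫_q^b η(p) / (2p) dp`. -/
noncomputable def radialPrimitive (η : ℝ → ℝ) (b q : ℝ) : ℝ := ∫ p in q..b, η p / (2 * p)

lemma contDiff_div_two_mul (hη : ContDiff ℝ ∞ η) (ha : 0 < a) (h0 : ∀ q ≤ a, η q = 0) :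
    ContDiff ℝ ∞ fun p => η p / (2 * p) := by
  refine contDiff_iff_contDiffAt.2 fun p => ?_
  rcases lt_or_ge p a with h | h
  · have : (fun p => η p / (2 * p)) =ᶠ[𝓝 p] fun _ => 0 := by
      filter_upwards [Iio_mem_nhds h] with x hx
      rw [h0 x (le_of_lt hx), zero_div]
    exact contDiffAt_const.congr_of_eventuallyEq this
  · exact hη.contDiffAt.div (contDiffAt_const.mul contDiffAt_id) (by
      have : 0 < p := ha.trans_le h
      positivity)

lemma hasDerivAt_radialPrimitive (hη : ContDiff ℝ ∞ η) (ha : 0 < a) (h0 : ∀ q ≤ a, η q = 0) (q : ℝ) :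
    HasDerivAt (radialPrimitive η b) (-(η q / (2 * q))) q := by
  have hc := (contDiff_div_two_mul hη ha h0).continuous
  exact intervalIntegral.integral_hasDerivAt_left (hc.intervalIntegrable _ _)
    hc.stronglyMeasurable.stronglyMeasurableAtFilter hc.continuousAt

lemma deriv_radialPrimitive (hη : ContDiff ℝ ∞ η) (ha : 0 < a) (h0 : ∀ q ≤ a, η q = 0) :
    deriv (radialPrimitive η b) = fun q => -(η q / (2 * q)) :=
  funext fun q => (hasDerivAt_radialPrimitive hη ha h0 q).deriv

lemma contDiff_radialPrimitive (hη : ContDiff ℝ ∞ η) (ha : 0 < a) (h0 : ∀ q ≤ a, η q = 0) :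
    ContDiff ℝ ∞ (radialPrimitive η b) := by
  rw [contDiff_infty_iff_deriv, deriv_radialPrimitive hη ha h0]
  exact ⟨fun q => (hasDerivAt_radialPrimitive hη ha h0 q).differentiableAt,
    (contDiff_div_two_mul hη ha h0).neg⟩

lemma radialPrimitive_of_ge (hb : ∀ q, b ≤ q → η q = 0) {q : ℝ} (hq : b ≤ q) :
    radialPrimitive η b q = 0 := by
  unfold radialPrimitive
  rw [intervalIntegral.integral_symm, neg_eq_zero]
  refine intervalIntegral.integral_zero_ae (Eventually.of_forall fun p hp => ?_)
  rw [uIoc_of_le hq] at hp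
  rw [hb p hp.1.le, zero_div]

/-- In the variable q = ‖z - c‖² the Laplacian of L(q) is 4(qL')', and here qL' = -η/2: the
logarithmic singularity cancels and only η' survives. -/
lemma laplacian_radialPrimitive (hη : ContDiff ℝ ∞ η) (ha : 0 < a) (h0 : ∀ q ≤ a, η q = 0)
    (c z : ℂ) : Laplacian.laplacian (fun z => radialPrimitive η b (‖z - c‖ ^ 2)) z =
      -2 * deriv η (‖z - c‖ ^ 2) := by
  have hL := contDiff_radialPrimitive (b := b) hη ha h0
  rw [laplacian_comp_norm_sub_sq (contDiff_infty.1 hL 2),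
    deriv_radialPrimitive hη ha h0]
  set q := ‖z - c‖ ^ 2
  rcases lt_or_ge q a with h | h
  · have h1 : (fun p => -(η p / (2 * p))) =ᶠ[𝓝 q] fun _ => 0 := by
      filter_upwards [Iio_mem_nhds h] with x hx
      rw [h0 x (le_of_lt hx), zero_div, neg_zero]
    have h2 : η =ᶠ[𝓝 q] fun _ => 0 := by
      filter_upwards [Iio_mem_nhds h] with x hx using h0 x (le_of_lt hx)
    rw [h1.deriv_eq, h2.deriv_eq]
    simp [h0 q h.le]
  · have hq : 0 < q := ha.trans_le h
    have hd : HasDerivAt (fun p => -(η p / (2 * p)))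
        (-((deriv η q * (2 * q) - η q * 2) / (2 * q) ^ 2)) q := by
      have h1 := ((hη.differentiable (by simp) q).hasDerivAt.div
        (((hasDerivAt_id q).const_mul 2)) (by simpa using hq.ne')).neg
      refine HasDerivAt.congr_deriv h1 ?_
      simp
    rw [hd.deriv]
    field_simp
    ring

lemma radialPrimitive_sq (hη : ContDiff ℝ ∞ η) (ha : 0 < a) (h0 : ∀ q ≤ a, η q = 0) (d R : ℝ) :
    radialPrimitive η (R ^ 2) (d ^ 2) = ∫ t in d..R, η (t ^ 2) / t := by
  have hc := (contDiff_div_two_mul hη ha h0).continuous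
  have := intervalIntegral.integral_comp_mul_deriv (a := d) (b := R) (f := fun t => t ^ 2)
    (f' := fun t => 2 * t) (g := fun p => η p / (2 * p))
    (fun t _ => by simpa using hasDerivAt_pow 2 t) (by fun_prop) hc
  unfold radialPrimitive
  rw [← this]
  refine intervalIntegral.integral_congr fun t ht => ?_
  simp only [Function.comp_apply]
  rcases eq_or_ne t 0 with rfl | h
  · simp
  · field_simp

end radial

end DeltaSubharmonic

/-! ### Jensen-type estimates for the Riesz measure -/

namespace DeltaSubharmonic

variable {u : ℂ → EReal} {Ω : Set ℂ}

lemma integral_polar {f : ℂ → ℝ} (hm : Measurable f) (hi : Integrable f) (c : ℂ) :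
    IntegrableOn (fun t => t * Real.circleAverage f c t) (Ioi 0) ∧
      ∫ z, f z = 2 * Real.pi * ∫ t in Ioi (0 : ℝ), t * Real.circleAverage f c t := by
  have hgi : Integrable fun z => f (c + z) := hi.comp_add_left c
  have hgm : Measurable fun z => f (c + z) := hm.comp (measurable_const_add c)
  have hprod : (volume : Measure (ℝ × ℝ)).restrict polarCoord.target =
      (volume.restrict (Ioi (0 : ℝ))).prod (volume.restrict (Ioo (-Real.pi) Real.pi)) := by
    rw [polarCoord_target, Measure.volume_eq_prod, Measure.prod_restrict]
  have hsymm : Measurable fun p : ℝ × ℝ => Complex.polarCoord.symm p := by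
    simp only [Complex.polarCoord_symm_apply]
    exact Continuous.measurable (by fun_prop)
  have hpol : Integrable (fun p : ℝ × ℝ => p.1 • f (c + Complex.polarCoord.symm p))
      (volume.restrict polarCoord.target) := by
    refine ⟨(measurable_fst.smul (hgm.comp hsymm)).aestronglyMeasurable, ?_⟩
    have h1 := hgi.2
    rw [hasFiniteIntegral_iff_enorm, ← Complex.lintegral_comp_polarCoord_symm] at h1
    rw [hasFiniteIntegral_iff_enorm]
    refine lt_of_le_of_lt (setLIntegral_mono' polarCoord.open_target.measurableSet fun p hp => ?_) h1
    rw [enorm_smul, Real.enorm_eq_ofReal (le_of_lt (show (0 : ℝ) < p.1 from hp.1)), smul_eq_mul]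
  have hinner : ∀ t : ℝ, ∫ θ in Ioo (-Real.pi) Real.pi, t • f (c + Complex.polarCoord.symm (t, θ)) =
      2 * Real.pi * (t * Real.circleAverage f c t) := by
    intro t
    rw [integral_smul, smul_eq_mul, Real.circleAverage_def, smul_eq_mul]
    have h1 : ∫ θ in Ioo (-Real.pi) Real.pi, f (c + Complex.polarCoord.symm (t, θ)) =
        ∫ θ in (0 : ℝ)..2 * Real.pi, f (circleMap c t θ) := by
      have hper : Function.Periodic (fun θ => f (circleMap c t θ)) (2 * Real.pi) := fun θ => by
        simp only [periodic_circleMap c t θ]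
      have h2 := hper.intervalIntegral_add_eq 0 (-Real.pi)
      rw [zero_add] at h2
      rw [h2, intervalIntegral.integral_of_le (by linarith [Real.pi_pos]),
        ← integral_Ioc_eq_integral_Ioo, show -Real.pi + 2 * Real.pi = Real.pi by ring]
      refine integral_congr_ae (Eventually.of_forall fun θ => ?_)
      simp only [Complex.polarCoord_symm_apply, circleMap, Complex.exp_mul_I, Complex.ofReal_cos,
        Complex.ofReal_sin]
    rw [h1]
    have := Real.pi_pos.ne'
    field_simp
  have h2π : 2 * Real.pi ≠ 0 := Real.two_pi_pos.ne'
  constructor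
  · have h1 := (hprod ▸ hpol).integral_prod_left
    simp only [hinner] at h1
    exact (integrable_const_mul_iff (isUnit_iff_ne_zero.2 h2π) _).1 h1
  · rw [← integral_add_left_eq_self f c, ← Complex.integral_comp_polarCoord_symm, hprod,
      integral_prod _ (hprod ▸ hpol)]
    simp only [hinner]
    rw [integral_const_mul]

/-- The integrand is the derivative of the step composed with t², hence a probability density
concentrated on [a, b]. -/
lemma integral_two_mul_deriv_smoothStep {a b : ℝ} (ha : 0 < a) (hab : a < b) :
    IntegrableOn (fun t => t * (2 * deriv (smoothStep (a ^ 2) (b ^ 2)) (t ^ 2))) (Ioi 0) ∧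
      ∫ t in Ioi (0 : ℝ), t * (2 * deriv (smoothStep (a ^ 2) (b ^ 2)) (t ^ 2)) = 1 := by
  have hab2 : a ^ 2 < b ^ 2 := by gcongr
  have hb : 0 < b := ha.trans hab
  have hc : Continuous fun t => t * (2 * deriv (smoothStep (a ^ 2) (b ^ 2)) (t ^ 2)) := by
    have := continuous_deriv_smoothStep (a := a ^ 2) (b := b ^ 2)
    fun_prop
  have hz : ∀ t ∈ Ioi (0 : ℝ) \ Ioc 0 b,
      t * (2 * deriv (smoothStep (a ^ 2) (b ^ 2)) (t ^ 2)) = 0 := by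
    rintro t ⟨ht0, ht⟩
    rw [mem_Ioi] at ht0
    have hbt : b < t := by
      by_contra h; exact ht ⟨ht0, not_lt.1 h⟩
    rw [deriv_smoothStep_eq_zero hab2, mul_zero, mul_zero]
    intro h
    have : b ^ 2 < t ^ 2 := by gcongr
    exact absurd h.2 (not_le.2 this)
  constructor
  · exact (hc.integrableOn_Ioc (a := 0) (b := b)).of_forall_sdiff_eq_zero measurableSet_Ioi hz
  · rw [setIntegral_eq_of_subset_of_forall_sdiff_eq_zero measurableSet_Ioi
      (fun t ht => ht.1 : Ioc 0 b ⊆ Ioi 0) hz, ← intervalIntegral.integral_of_le hb.le,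
      intervalIntegral.integral_eq_sub_of_hasDerivAt (f := fun t => smoothStep (a ^ 2) (b ^ 2) (t ^ 2))
      (fun t _ => ?_) (hc.intervalIntegrable _ _)]
    · rw [smoothStep_of_ge hab2 le_rfl, smoothStep_of_le hab2 (by rw [zero_pow two_ne_zero]; positivity), sub_zero]
    · have h2 : HasDerivAt (fun t : ℝ => t ^ 2) (2 * t) t := by simpa using hasDerivAt_pow 2 t
      have := (hasDerivAt_smoothStep (a := a ^ 2) (b := b ^ 2) (q := t ^ 2)).comp t h2
      refine HasDerivAt.congr_deriv this ?_
      ring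

/-- In polar coordinates the integral is 2π times the average of the circle means of U against the
density of `integral_two_mul_deriv_smoothStep`, which sees only radii in [a, b]. -/
lemma integral_mul_deriv_smoothStep_mem {U : ℂ → ℝ} (hU : Measurable U) {c : ℂ} {a b m M : ℝ}
    (ha : 0 < a) (hab : a < b) (hUi : IntegrableOn U (Metric.closedBall c b))
    (hm : ∀ t ∈ Icc a b, m ≤ Real.circleAverage U c t)
    (hM : ∀ t ∈ Icc a b, Real.circleAverage U c t ≤ M) :
    Integrable (fun z => U z * (2 * deriv (smoothStep (a ^ 2) (b ^ 2)) (‖z - c‖ ^ 2))) ∧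
    2 * Real.pi * m ≤ ∫ z, U z * (2 * deriv (smoothStep (a ^ 2) (b ^ 2)) (‖z - c‖ ^ 2)) ∧
    ∫ z, U z * (2 * deriv (smoothStep (a ^ 2) (b ^ 2)) (‖z - c‖ ^ 2)) ≤ 2 * Real.pi * M := by
  have hab2 : a ^ 2 < b ^ 2 := by gcongr
  have hb : 0 < b := ha.trans hab
  set σ' := deriv (smoothStep (a ^ 2) (b ^ 2)) with hσ'
  have hσc : Continuous σ' := continuous_deriv_smoothStep
  have hcont : Continuous fun z : ℂ => 2 * σ' (‖z - c‖ ^ 2) := by fun_prop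
  have hmeas : Measurable fun z => U z * (2 * σ' (‖z - c‖ ^ 2)) := hU.mul hcont.measurable
  have hint : Integrable fun z => U z * (2 * σ' (‖z - c‖ ^ 2)) := by
    rw [← integrableOn_iff_integrable_of_support_subset (s := Metric.closedBall c b)]
    · exact hUi.mul_continuousOn hcont.continuousOn (isCompact_closedBall c b)
    · intro z hz
      rw [mem_closedBall_iff_norm]
      by_contra h
      refine hz ?_
      have h' : b ^ 2 < ‖z - c‖ ^ 2 := by
        have := not_le.1 h
        gcongr
      simp only [hσ']
      rw [deriv_smoothStep_eq_zero hab2 (fun h => absurd h.2 (not_le.2 h')), mul_zero, mul_zero]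
  have hav : ∀ t : ℝ, 0 < t → Real.circleAverage (fun z => U z * (2 * σ' (‖z - c‖ ^ 2))) c t =
      Real.circleAverage U c t * (2 * σ' (t ^ 2)) := by
    intro t ht
    rw [Real.circleAverage_congr_sphere (f₂ := fun z => (2 * σ' (t ^ 2)) • U z), Real.circleAverage_fun_smul,
      smul_eq_mul, mul_comm]
    intro z hz
    rw [abs_of_pos ht, mem_sphere_iff_norm] at hz
    simp only [hz, smul_eq_mul]
    ring
  obtain ⟨hi1, hi2⟩ := integral_polar hmeas hint c
  obtain ⟨hs1, hs2⟩ := integral_two_mul_deriv_smoothStep ha hab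
  rw [← hσ'] at hs1 hs2
  have hcases : ∀ t : ℝ, 0 < t → t ∈ Icc a b ∨ σ' (t ^ 2) = 0 := by
    intro t ht
    by_cases h : t ∈ Icc a b
    · exact Or.inl h
    · refine Or.inr (deriv_smoothStep_eq_zero hab2 fun h' => h ⟨?_, ?_⟩)
      · exact le_of_sq_le_sq h'.1 ht.le
      · exact le_of_sq_le_sq h'.2 hb.le
  have hσ0 : ∀ q, 0 ≤ σ' q := fun q => deriv_smoothStep_nonneg hab2
  refine ⟨hint, ?_, ?_⟩
  · rw [hi2]
    refine mul_le_mul_of_nonneg_left ?_ Real.two_pi_pos.le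
    calc m = ∫ t in Ioi (0 : ℝ), m * (t * (2 * σ' (t ^ 2))) := by
          rw [integral_const_mul, hs2, mul_one]
      _ ≤ _ := by
          refine setIntegral_mono_on (hs1.const_mul m) hi1 measurableSet_Ioi fun t ht => ?_
          rw [hav t ht]
          rcases hcases t ht with h | h
          · have h1 : 0 ≤ t * (2 * σ' (t ^ 2)) :=
              mul_nonneg (le_of_lt ht) (mul_nonneg zero_le_two (hσ0 _))
            nlinarith [hm t h]
          · simp [h]
  · rw [hi2]
    refine mul_le_mul_of_nonneg_left ?_ Real.two_pi_pos.le
    calc _ ≤ ∫ t in Ioi (0 : ℝ), M * (t * (2 * σ' (t ^ 2))) := by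
          refine setIntegral_mono_on hi1 (hs1.const_mul M) measurableSet_Ioi fun t ht => ?_
          rw [hav t ht]
          rcases hcases t ht with h | h
          · have h1 : 0 ≤ t * (2 * σ' (t ^ 2)) :=
              mul_nonneg (le_of_lt ht) (mul_nonneg zero_le_two (hσ0 _))
            nlinarith [hM t h]
          · simp [h]
      _ = M := by rw [integral_const_mul, hs2, mul_one]

/-- Tonelli's theorem, with the measure of the disc written as the integral of the condition dist z
c ≤ t. -/
lemma setLIntegral_mul_measure_closedBall (μ : Measure ℂ) [SFinite μ] (c : ℂ) (S : Set ℝ)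
    {h : ℝ → ℝ≥0∞} (hh : Measurable h) :
    ∫⁻ t in S, h t * μ (Metric.closedBall c t) =
      ∫⁻ z, (∫⁻ t in S, if dist z c ≤ t then h t else 0) ∂μ := by
  have hm : Measurable fun p : ℂ × ℝ => if dist p.1 c ≤ p.2 then h p.2 else 0 :=
    Measurable.ite (measurableSet_le (measurable_fst.dist measurable_const) measurable_snd)
      (hh.comp measurable_snd) measurable_const
  rw [lintegral_lintegral_swap (f := fun z t => if dist z c ≤ t then h t else 0) hm.aemeasurable]
  refine lintegral_congr fun t => ?_
  have : (fun z => if dist z c ≤ t then h t else 0) =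
      (Metric.closedBall c t).indicator fun _ => h t := by
    ext z; simp [indicator, Metric.mem_closedBall]
  rw [this, lintegral_indicator Metric.isClosed_closedBall.measurableSet, lintegral_const,
    Measure.restrict_apply_univ]

/-- The integrated counting function `∫_a^b μ({|z - c| ≤ t}) / t dt` centred at `c`. -/
noncomputable def centeredCounting (μ : Measure ℂ) (c : ℂ) (a b : ℝ) : ℝ≥0∞ :=
  ∫⁻ t in Ioc a b, μ (Metric.closedBall c t) / ENNReal.ofReal t

lemma ofReal_radialPrimitive {η : ℝ → ℝ} {a R : ℝ} (hη : ContDiff ℝ ∞ η) (ha : 0 < a)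
    (h0 : ∀ q ≤ a, η q = 0) (hR : ∀ q, R ^ 2 ≤ q → η q = 0) (hpos : ∀ q, 0 ≤ η q) (hR0 : 0 < R)
    {d : ℝ} (hd : 0 ≤ d) :
    ENNReal.ofReal (radialPrimitive η (R ^ 2) (d ^ 2)) =
      ∫⁻ t in Ioc 0 R, if d ≤ t then ENNReal.ofReal (η (t ^ 2) / t) else 0 := by
  have hind : ∀ t, (if d ≤ t then ENNReal.ofReal (η (t ^ 2) / t) else 0) =
      (Ici d).indicator (fun t => ENNReal.ofReal (η (t ^ 2) / t)) t := by
    intro t; simp [indicator]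
  simp only [hind]
  rw [setLIntegral_indicator measurableSet_Ici]
  rcases lt_or_ge R d with h | h
  · rw [radialPrimitive_of_ge hR (by gcongr), ENNReal.ofReal_zero]
    have : Ici d ∩ Ioc 0 R = ∅ := by
      ext t; simp only [mem_inter_iff, mem_Ici, mem_Ioc, mem_empty_iff_false, iff_false]
      rintro ⟨h1, -, h2⟩; linarith
    simp [this]
  · have hae : Ioc d R =ᵐ[volume] (Ici d ∩ Ioc 0 R : Set ℝ) := by
      have h1 : (Icc d R : Set ℝ) ≤ᵐ[volume] Ioc d R := Ioc_ae_eq_Icc.symm.le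
      refine Filter.EventuallyLE.antisymm (LE.le.eventuallyLE fun t ht =>
        ⟨ht.1.le, hd.trans_lt ht.1, ht.2⟩) ?_
      exact (LE.le.eventuallyLE (fun t ht => ⟨ht.1, ht.2.2⟩ :
        Ici d ∩ Ioc 0 R ⊆ Icc d R)).trans h1
    rw [← setLIntegral_congr hae, radialPrimitive_sq hη ha h0, intervalIntegral.integral_of_le h,
      ofReal_integral_eq_lintegral_ofReal]
    · have hc : Continuous fun t => η (t ^ 2) / t := by
        have h1 := (contDiff_div_two_mul hη ha h0).continuous
        have h2 : (fun t => η (t ^ 2) / t) = fun t => 2 * t * (η (t ^ 2) / (2 * t ^ 2)) := by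
          ext t
          rcases eq_or_ne t 0 with rfl | ht
          · simp
          · field_simp
        rw [h2]
        exact (by fun_prop : Continuous fun t : ℝ => 2 * t).mul (h1.comp (by fun_prop))
      exact hc.integrableOn_Ioc
    · exact (ae_restrict_mem measurableSet_Ioc).mono fun t ht =>
        div_nonneg (hpos _) (hd.trans ht.1.le)

lemma SubharmonicOn.circleMean_eq (hΩ : IsOpen Ω) (hu : SubharmonicOn u Ω) {c : ℂ} {R r : ℝ}
    (hs : Metric.closedBall c R ⊆ Ω) (hne : ∃ z ∈ Metric.closedBall c R, u z ≠ ⊥)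
    (hr0 : 0 < r) (hr : r ≤ R) :
    CircleIntegrable (fun z => (u z).toReal) c r ∧
      (∀ᵐ θ ∂(volume.restrict (Ioc 0 (2 * Real.pi))), u (circleMap c r θ) ≠ ⊥) ∧
      circleMean u c r = ((Real.circleAverage (fun z => (u z).toReal) c r : ℝ) : EReal) := by
  have hrs : Metric.sphere c r ⊆ Ω :=
    (Metric.sphere_subset_closedBall.trans (Metric.closedBall_subset_closedBall hr)).trans hs
  obtain ⟨M, _, hM⟩ := upperSemicontinuousOn_exists_coe_le (isCompact_sphere c r)
      (hu.usc.mono hrs) fun z hz => hu.lt_top z (hrs hz)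
  exact circleMean_eq_coe_circleAverage hr0.le (hu.measurable_circle hΩ hr0.le hrs) hM
    (hu.circleMean_ne_bot hΩ hs hne hr0 hr)

lemma SubharmonicOn.circleAverage_mono (hΩ : IsOpen Ω) (hu : SubharmonicOn u Ω) {c : ℂ} {R r t : ℝ}
    (hs : Metric.closedBall c R ⊆ Ω) (hne : ∃ z ∈ Metric.closedBall c R, u z ≠ ⊥)
    (hr0 : 0 < r) (hrt : r ≤ t) (ht : t ≤ R) :
    Real.circleAverage (fun z => (u z).toReal) c r ≤ Real.circleAverage (fun z => (u z).toReal) c t := by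
  rw [← EReal.coe_le_coe_iff, ← (hu.circleMean_eq hΩ hs hne hr0 (hrt.trans ht)).2.2,
    ← (hu.circleMean_eq hΩ hs hne (hr0.trans_le hrt) ht).2.2]
  exact hu.circleMean_le_circleMean ((Metric.closedBall_subset_closedBall ht).trans hs) hr0.le hrt

/-- Two-sided estimate behind the Poisson–Jensen formula for circle means. -/
lemma IsRieszMeasure.counting_estimates (hΩ : IsOpen Ω) (hu : SubharmonicOn u Ω) {μ : Measure ℂ}
    (hμ : IsRieszMeasure u Ω μ) {c : ℂ} {r r' R R' : ℝ} (hr : 0 < r) (hrr : r < r') (hrR : r' ≤ R)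
    (hRR : R < R') (hs : Metric.closedBall c R' ⊆ Ω)
    (hne : ∃ z ∈ Metric.closedBall c R', u z ≠ ⊥) :
    centeredCounting μ c r' R ≤ ENNReal.ofReal (Real.circleAverage (fun z => (u z).toReal) c R' -
      Real.circleAverage (fun z => (u z).toReal) c r) ∧
    ENNReal.ofReal (Real.circleAverage (fun z => (u z).toReal) c R -
      Real.circleAverage (fun z => (u z).toReal) c r') ≤ centeredCounting μ c r R' := by
  have hr' : 0 < r' := hr.trans hrr
  have hR : 0 < R := hr'.trans_le hrR
  have hR' : 0 < R' := hR.trans hRR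
  have e1 : r ^ 2 < r' ^ 2 := by gcongr
  have e2 : r' ^ 2 ≤ R ^ 2 := by gcongr
  have e3 : R ^ 2 < R' ^ 2 := by gcongr
  have hr2 : 0 < r ^ 2 := by positivity
  set σ₁ := smoothStep (r ^ 2) (r' ^ 2) with hσ₁
  set σ₂ := smoothStep (R ^ 2) (R' ^ 2) with hσ₂
  -- As a function of the radius, η rises on [r, r'] and falls on [R, R'], so it lies between the
  -- indicators of [r', R] and [r, R'].
  set η : ℝ → ℝ := fun q => σ₁ q - σ₂ q with hη
  have hηc : ContDiff ℝ ∞ η := contDiff_smoothStep.sub contDiff_smoothStep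
  have hη0 : ∀ q ≤ r ^ 2, η q = 0 := fun q hq => by
    simp only [hη, hσ₁, hσ₂]
    rw [smoothStep_of_le e1 hq, smoothStep_of_le e3 (by linarith), sub_zero]
  have hη1 : ∀ q, R' ^ 2 ≤ q → η q = 0 := fun q hq => by
    simp only [hη, hσ₁, hσ₂]
    rw [smoothStep_of_ge e1 (by linarith), smoothStep_of_ge e3 (by linarith), sub_self]
  have hηm : ∀ q, r' ^ 2 ≤ q → q ≤ R ^ 2 → η q = 1 := fun q hq hq' => by
    simp only [hη, hσ₁, hσ₂]
    rw [smoothStep_of_ge e1 hq, smoothStep_of_le e3 hq', sub_zero]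
  have hηpos : ∀ q, 0 ≤ η q := fun q => by
    rcases le_total q (R ^ 2) with h | h
    · simp only [hη, hσ₁, hσ₂]
      rw [smoothStep_of_le e3 h, sub_zero]; exact smoothStep_nonneg
    · simp only [hη, hσ₁, hσ₂]
      rw [smoothStep_of_ge e1 (e2.trans h), sub_nonneg]; exact smoothStep_le_one
  have hηle : ∀ q, η q ≤ 1 := fun q => by
    have h1 := smoothStep_le_one (a := r ^ 2) (b := r' ^ 2) (q := q)
    have h2 := smoothStep_nonneg (a := R ^ 2) (b := R' ^ 2) (q := q)
    simp only [hη, hσ₁, hσ₂]; linarith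
  set φ : ℂ → ℝ := fun z => radialPrimitive η (R' ^ 2) (‖z - c‖ ^ 2) with hφ
  have hφc : ContDiff ℝ ∞ φ :=
    (contDiff_radialPrimitive hηc hr2 hη0).comp ((contDiff_id.sub contDiff_const).norm_sq ℝ)
  have hφsupp : Function.support φ ⊆ Metric.closedBall c R' := by
    intro z hz
    rw [mem_closedBall_iff_norm]
    by_contra h
    refine hz (radialPrimitive_of_ge hη1 ?_)
    have := not_le.1 h
    gcongr
  have hφts : tsupport φ ⊆ Metric.closedBall c R' :=
    closure_minimal hφsupp Metric.isClosed_closedBall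
  have hφcs : HasCompactSupport φ :=
    HasCompactSupport.of_support_subset_isCompact (isCompact_closedBall c R') hφsupp
  have hJ := hμ.integral_eq φ hφc hφcs (hφts.trans hs)
  -- the right-hand side
  set U : ℂ → ℝ := fun z => ((Ω.indicator u) z).toReal with hU
  have hUm : Measurable U := (measurable_indicator_of_usc hΩ hu.usc).ereal_toReal
  have hUeq : ∀ z ∈ Ω, U z = (u z).toReal := fun z hz => by simp [hU, hz]
  have hUi : ∀ t ≤ R', IntegrableOn U (Metric.closedBall c t) := fun t ht =>
    (hu.integrableOn_closedBall hΩ ((Metric.closedBall_subset_closedBall ht).trans hs)).congr_fun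
      (fun z hz => (hUeq z (hs (Metric.closedBall_subset_closedBall ht hz))).symm)
      Metric.isClosed_closedBall.measurableSet
  have hUav : ∀ t, 0 < t → t ≤ R' → Real.circleAverage U c t =
      Real.circleAverage (fun z => (u z).toReal) c t := fun t ht0 ht => by
    refine Real.circleAverage_congr_sphere fun z hz => hUeq z (hs ?_)
    rw [abs_of_pos ht0] at hz
    exact Metric.closedBall_subset_closedBall ht (Metric.sphere_subset_closedBall hz)
  set A := fun t => Real.circleAverage (fun z => (u z).toReal) c t with hA
  have hAm : ∀ s t, 0 < s → s ≤ t → t ≤ R' → A s ≤ A t := fun s t h1 h2 h3 =>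
    hu.circleAverage_mono hΩ hs hne h1 h2 h3
  obtain ⟨i1, l1, g1⟩ := integral_mul_deriv_smoothStep_mem hUm hr hrr (hUi r' (hrR.trans hRR.le))
    (m := A r) (M := A r')
    (fun t ht => by
      rw [hUav t (hr.trans_le ht.1) (by linarith [ht.2])]
      exact hAm _ _ hr ht.1 (by linarith [ht.2]))
    (fun t ht => by
      rw [hUav t (hr.trans_le ht.1) (by linarith [ht.2])]
      exact hAm _ _ (hr.trans_le ht.1) ht.2 (by linarith [ht.2]))
  obtain ⟨i2, l2, g2⟩ := integral_mul_deriv_smoothStep_mem hUm hR hRR (hUi R' le_rfl)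
    (m := A R) (M := A R')
    (fun t ht => by
      rw [hUav t (hR.trans_le ht.1) (by linarith [ht.2])]
      exact hAm _ _ hR ht.1 (by linarith [ht.2]))
    (fun t ht => by
      rw [hUav t (hR.trans_le ht.1) (by linarith [ht.2])]
      exact hAm _ _ (hR.trans_le ht.1) ht.2 (by linarith [ht.2]))
  have hrhs : ∫ z, (u z).toReal * Laplacian.laplacian φ z =
      (∫ z, U z * (2 * deriv σ₂ (‖z - c‖ ^ 2))) - ∫ z, U z * (2 * deriv σ₁ (‖z - c‖ ^ 2)) := by
    rw [← integral_sub i2 i1]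
    refine integral_congr_ae (Eventually.of_forall fun z => ?_)
    simp only [hφ]
    rw [laplacian_radialPrimitive hηc hr2 hη0]
    have hdη : deriv η (‖z - c‖ ^ 2) = deriv σ₁ (‖z - c‖ ^ 2) - deriv σ₂ (‖z - c‖ ^ 2) :=
      (hasDerivAt_smoothStep.sub hasDerivAt_smoothStep).deriv
    rw [hdη]
    -- Off Ω the functions U and u may differ, but there ‖z - c‖ > R' and both step derivatives
    -- vanish.
    by_cases hz : z ∈ Ω
    · rw [hUeq z hz]; ring
    · have h1 : R' ^ 2 < ‖z - c‖ ^ 2 := by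
        have : R' < ‖z - c‖ := by
          by_contra h
          exact hz (hs (mem_closedBall_iff_norm.2 (not_lt.1 h)))
        gcongr
      rw [hσ₁, hσ₂, deriv_smoothStep_eq_zero e1 (fun h => by linarith [h.2]),
        deriv_smoothStep_eq_zero e3 (fun h => by linarith [h.2])]
      ring
  -- The integral is a weighted mean of A over [R, R'] minus one over [r, r']; monotonicity of A
  -- bounds both from either side.
  have hJle : ∫ z, φ z ∂μ ≤ A R' - A r := by
    rw [hJ, hrhs]
    have h2π := Real.two_pi_pos
    rw [one_div, inv_mul_le_iff₀ h2π]
    linarith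
  have hJge : A R - A r' ≤ ∫ z, φ z ∂μ := by
    rw [hJ, hrhs]
    have h2π := Real.two_pi_pos
    rw [one_div, le_inv_mul_iff₀ h2π]
    linarith
  -- the left-hand side
  set ν := μ.restrict (Metric.closedBall c R') with hν
  have : IsFiniteMeasure ν :=
    ⟨by rw [hν, Measure.restrict_apply_univ]; exact hμ.lt_top_of_isCompact _ (isCompact_closedBall c R') hs⟩
  have hφpos : ∀ z, 0 ≤ φ z := by
    intro z
    rcases le_total ‖z - c‖ R' with h | h
    · simp only [hφ]
      rw [radialPrimitive_sq hηc hr2 hη0]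
      refine intervalIntegral.integral_nonneg h fun t ht => div_nonneg (hηpos _)
        ((norm_nonneg _).trans ht.1)
    · exact (radialPrimitive_of_ge hη1 (by gcongr)).ge
  have hηmeas : Measurable fun t => ENNReal.ofReal (η (t ^ 2) / t) := by
    have := hηc.continuous
    exact ENNReal.measurable_ofReal.comp ((this.comp (continuous_pow 2)).measurable.div measurable_id)
  -- Since φ(z) is the integral of η(t²)/t over radii t ≥ ‖z - c‖, integrating it against μ gives
  -- the counting integral weighted by η.
  have hlhs : ENNReal.ofReal (∫ z, φ z ∂μ) =
      ∫⁻ t in Ioc 0 R', ENNReal.ofReal (η (t ^ 2) / t) * μ (Metric.closedBall c t) := by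
    rw [← setIntegral_eq_integral_of_forall_compl_eq_zero (s := Metric.closedBall c R')
      (fun z hz => by_contra fun h => hz (hφsupp h)), ← hν,
      ofReal_integral_eq_lintegral_ofReal (hφc.continuous.integrable_of_hasCompactSupport hφcs)
      (Eventually.of_forall hφpos)]
    have h1 : ∫⁻ t in Ioc 0 R', ENNReal.ofReal (η (t ^ 2) / t) * μ (Metric.closedBall c t) =
        ∫⁻ t in Ioc 0 R', ENNReal.ofReal (η (t ^ 2) / t) * ν (Metric.closedBall c t) := by
      refine setLIntegral_congr_fun measurableSet_Ioc fun t ht => ?_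
      simp only [hν]
      rw [Measure.restrict_apply Metric.isClosed_closedBall.measurableSet,
        inter_eq_left.2 (Metric.closedBall_subset_closedBall ht.2)]
    rw [h1, setLIntegral_mul_measure_closedBall ν c _ hηmeas]
    refine lintegral_congr fun z => ?_
    rw [dist_eq_norm]
    exact ofReal_radialPrimitive hηc hr2 hη0 hη1 hηpos hR' (norm_nonneg _)
  constructor
  · refine le_trans ?_ (ENNReal.ofReal_le_ofReal hJle)
    rw [hlhs]
    unfold centeredCounting
    refine le_trans ?_ (lintegral_mono_set (show Ioc r' R ⊆ Ioc 0 R' from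
      fun t ht => ⟨hr'.trans ht.1, ht.2.trans hRR.le⟩))
    refine setLIntegral_mono' measurableSet_Ioc fun t ht => ?_
    have ht0 : 0 < t := hr'.trans ht.1
    rw [hηm (t ^ 2) (by have := ht.1; gcongr) (by have := ht.2; gcongr), one_div,
      ENNReal.ofReal_inv_of_pos ht0, ENNReal.div_eq_inv_mul]
  · refine (ENNReal.ofReal_le_ofReal hJge).trans ?_
    rw [hlhs]
    unfold centeredCounting
    rw [← lintegral_indicator measurableSet_Ioc, ← lintegral_indicator measurableSet_Ioc]
    refine lintegral_mono fun t => ?_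
    by_cases ht : t ∈ Ioc r R'
    · have ht0 : 0 < t := hr.trans ht.1
      rw [indicator_of_mem (show t ∈ Ioc 0 R' from ⟨ht0, ht.2⟩), indicator_of_mem ht,
        ENNReal.div_eq_inv_mul, ← ENNReal.ofReal_inv_of_pos ht0, ← one_div]
      have := hηle (t ^ 2)
      gcongr
    · rw [indicator_of_notMem ht]
      refine le_of_eq (indicator_apply_eq_zero.2 fun h => ?_)
      have htr : t ≤ r := by
        by_contra h'; exact ht ⟨not_le.1 h', h.2⟩
      have := h.1
      rw [hη0 (t ^ 2) (by gcongr)]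
      simp

end DeltaSubharmonic

/-! ### Jensen's formula and comparison of measures through their counting functions -/

namespace DeltaSubharmonic

variable {u : ℂ → EReal} {Ω : Set ℂ}

lemma exists_closedBall_subset (hΩ : IsOpen Ω) {c : ℂ} {R : ℝ} (hR : 0 ≤ R)
    (hs : Metric.closedBall c R ⊆ Ω) : ∃ R' > R, Metric.closedBall c R' ⊆ Ω := by
  obtain ⟨δ, hδ, h⟩ := (isCompact_closedBall c R).exists_cthickening_subset_open hΩ hs
  refine ⟨R + δ, by linarith, ?_⟩
  rwa [cthickening_closedBall hδ.le hR, add_comm] at h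

/-- Continuity from below along the intervals (t, b] increasing to (a, b]; this remains valid at a =
0 and for infinite limits. -/
lemma tendsto_centeredCounting_left (μ : Measure ℂ) (c : ℂ) (a b : ℝ) :
    Tendsto (fun t => centeredCounting μ c t b) (𝓝[>] a) (𝓝 (centeredCounting μ c a b)) := by
  set ν := (volume.restrict (Iic b)).withDensity
    fun t => μ (Metric.closedBall c t) / ENNReal.ofReal t with hν
  have key : ∀ t, centeredCounting μ c t b = ν (Ioi t) := fun t => by
    rw [hν, withDensity_apply _ measurableSet_Ioi, Measure.restrict_restrict measurableSet_Ioi,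
      Ioi_inter_Iic]
    rfl
  simp only [key]
  have hanti : Antitone fun t => ν (Ioi t) := fun s t hst => measure_mono (Ioi_subset_Ioi hst)
  have h1 := hanti.tendsto_nhdsGT a
  have h2 : sSup ((fun t => ν (Ioi t)) '' Ioi a) = ν (Ioi a) := by
    refine le_antisymm (sSup_le ?_) ?_
    · rintro _ ⟨t, ht, rfl⟩
      exact measure_mono (Ioi_subset_Ioi (le_of_lt ht))
    · obtain ⟨s, hs1, hs2, hs3⟩ := exists_seq_strictAnti_tendsto a
      have h3 : Ioi a = ⋃ n, Ioi (s n) := by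
        ext x
        rw [mem_iUnion]
        exact ⟨fun hx => (hs3.eventually_lt_const hx).exists, fun ⟨n, hn⟩ => (hs2 n).trans hn⟩
      have h4 : Monotone fun n => Ioi (s n) := fun n m hnm => Ioi_subset_Ioi (hs1.antitone hnm)
      rw [congrArg ν h3, h4.measure_iUnion]
      exact iSup_le fun n => le_sSup ⟨s n, hs2 n, rfl⟩
  rwa [h2] at h1

lemma centeredCounting_add (μ : Measure ℂ) (c : ℂ) {a b d : ℝ} (hab : a ≤ b) (hbd : b ≤ d) :
    centeredCounting μ c a d = centeredCounting μ c a b + centeredCounting μ c b d := by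
  unfold centeredCounting
  rw [← Ioc_union_Ioc_eq_Ioc hab hbd, lintegral_union measurableSet_Ioc
    (Ioc_disjoint_Ioc_of_le le_rfl)]

lemma centeredCounting_le (μ : Measure ℂ) (c : ℂ) {a b : ℝ} :
    centeredCounting μ c a b ≤
      μ (Metric.closedBall c b) / ENNReal.ofReal a * ENNReal.ofReal (b - a) := by
  unfold centeredCounting
  calc _ ≤ ∫⁻ _ in Ioc a b, μ (Metric.closedBall c b) / ENNReal.ofReal a := by
        refine setLIntegral_mono' measurableSet_Ioc fun t ht => ?_
        have := ht.1.le
        have := Metric.closedBall_subset_closedBall (x := c) ht.2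
        gcongr
    _ = _ := by simp

lemma SubharmonicOn.tendsto_circleAverage (hΩ : IsOpen Ω) (hu : SubharmonicOn u Ω) {c : ℂ} {R r : ℝ}
    (hs : Metric.closedBall c R ⊆ Ω) (hne : ∃ z ∈ Metric.closedBall c R, u z ≠ ⊥)
    (hr0 : 0 ≤ r) (hr : r < R) (hc : r = 0 → u c ≠ ⊥) :
    Tendsto (fun t => Real.circleAverage (fun z => (u z).toReal) c t) (𝓝[>] r)
      (𝓝 (Real.circleAverage (fun z => (u z).toReal) c r)) := by
  have h1 := hu.tendsto_circleMean hs hr0 hr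
  have h2 : circleMean u c r = ((Real.circleAverage (fun z => (u z).toReal) c r : ℝ) : EReal) := by
    rcases hr0.eq_or_lt with rfl | h
    · rw [circleMean_radius_zero, Real.circleAverage_zero,
        EReal.coe_toReal (hu.lt_top c (hs (Metric.mem_closedBall_self hr.le))).ne (hc rfl)]
    · exact (hu.circleMean_eq hΩ hs hne h hr.le).2.2
  rw [h2] at h1
  refine EReal.tendsto_coe.1 (h1.congr' ?_)
  filter_upwards [Ioo_mem_nhdsGT hr] with t ht
  exact (hu.circleMean_eq hΩ hs hne (hr0.trans_lt ht.1) ht.2.le).2.2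

/-- The Poisson–Jensen formula for circle means; the inner radius may be `0` if `u c` is finite. -/
theorem IsRieszMeasure.centeredCounting_eq (hΩ : IsOpen Ω) (hu : SubharmonicOn u Ω) {μ : Measure ℂ}
    (hμ : IsRieszMeasure u Ω μ) {c : ℂ} {r R : ℝ} (hr : 0 ≤ r) (hrR : r < R)
    (hs : Metric.closedBall c R ⊆ Ω) (hne : ∃ z ∈ Metric.closedBall c R, u z ≠ ⊥)
    (hc : r = 0 → u c ≠ ⊥) :
    centeredCounting μ c r R = ENNReal.ofReal (Real.circleAverage (fun z => (u z).toReal) c R -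
      Real.circleAverage (fun z => (u z).toReal) c r) := by
  have hR : 0 < R := hr.trans_lt hrR
  obtain ⟨R₀, hR₀, hs₀⟩ := exists_closedBall_subset hΩ hR.le hs
  obtain ⟨z₀, hz₀, hz₀'⟩ := hne
  have hne' : ∀ t, R ≤ t → ∃ z ∈ Metric.closedBall c t, u z ≠ ⊥ := fun t ht =>
    ⟨z₀, Metric.closedBall_subset_closedBall ht hz₀, hz₀'⟩
  set A := fun t => Real.circleAverage (fun z => (u z).toReal) c t with hA
  have hAr : ∀ r, 0 ≤ r → r < R₀ → (r = 0 → u c ≠ ⊥) → Tendsto A (𝓝[>] r) (𝓝 (A r)) :=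
    fun r h0 h1 h2 => hu.tendsto_circleAverage hΩ hs₀ (hne' _ hR₀.le) h0 h1 h2
  have main : ∀ r, 0 < r → r < R → centeredCounting μ c r R = ENNReal.ofReal (A R - A r) := by
    intro r hr hrR
    have est : ∀ r' R', r < r' → r' ≤ R → R < R' → R' < R₀ →
        centeredCounting μ c r' R ≤ ENNReal.ofReal (A R' - A r) ∧
        ENNReal.ofReal (A R - A r') ≤ centeredCounting μ c r R' := fun r' R' h1 h2 h3 h4 =>
      hμ.counting_estimates hΩ hu hr h1 h2 h3 ((Metric.closedBall_subset_closedBall h4.le).trans hs₀)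
        (hne' _ h3.le)
    have hIr : ∀ᶠ r' in 𝓝[>] r, r < r' ∧ r' ≤ R := by
      filter_upwards [Ioo_mem_nhdsGT hrR] with x hx using ⟨hx.1, hx.2.le⟩
    have hIR : ∀ᶠ R' in 𝓝[>] R, R < R' ∧ R' < R₀ := Ioo_mem_nhdsGT hR₀
    have hAR := hAr R hR.le hR₀ (fun h => absurd h hR.ne')
    have hArr := hAr r hr.le (hrR.trans hR₀) (fun h => absurd h hr.ne')
    refine le_antisymm ?_ ?_
    -- Upper bound: for fixed r' let R' decrease to R, using right-continuity of the means, and then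
    -- let r' decrease to r.
    · refine le_of_tendsto (tendsto_centeredCounting_left μ c r R) (hIr.mono fun r' hr' => ?_)
      have h1 : Tendsto (fun R' => ENNReal.ofReal (A R' - A r)) (𝓝[>] R)
          (𝓝 (ENNReal.ofReal (A R - A r))) :=
        (ENNReal.continuous_ofReal.tendsto _).comp (hAR.sub_const _)
      exact ge_of_tendsto h1 (hIR.mono fun R' hR' => (est r' R' hr'.1 hr'.2 hR'.1 hR'.2).1)
    -- Lower bound: the excess radii (R, R'] contribute at most K(R' - R), which vanishes in the
    -- limit.
    · set K := μ (Metric.closedBall c R₀) / ENNReal.ofReal R with hK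
      have hKt : K ≠ ⊤ := ENNReal.div_ne_top
        (hμ.lt_top_of_isCompact _ (isCompact_closedBall c R₀) hs₀).ne (by simpa using hR)
      have h1 : Tendsto (fun r' => ENNReal.ofReal (A R - A r')) (𝓝[>] r)
          (𝓝 (ENNReal.ofReal (A R - A r))) :=
        (ENNReal.continuous_ofReal.tendsto _).comp (hArr.const_sub _)
      have h2 : Tendsto (fun R' => centeredCounting μ c r R + K * ENNReal.ofReal (R' - R)) (𝓝[>] R)
          (𝓝 (centeredCounting μ c r R + K * ENNReal.ofReal (R - R))) := by
        have h3 : Tendsto (fun R' : ℝ => ENNReal.ofReal (R' - R)) (𝓝[>] R)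
            (𝓝 (ENNReal.ofReal (R - R))) :=
          ((ENNReal.continuous_ofReal.comp (continuous_sub_right R)).tendsto R).mono_left
            nhdsWithin_le_nhds
        exact (ENNReal.Tendsto.const_mul h3 (Or.inr hKt)).const_add _
      rw [sub_self, ENNReal.ofReal_zero, mul_zero, add_zero] at h2
      refine le_of_tendsto h1 (hIr.mono fun r' hr' => ge_of_tendsto h2 (hIR.mono fun R' hR' => ?_))
      refine (est r' R' hr'.1 hr'.2 hR'.1 hR'.2).2.trans ?_
      rw [centeredCounting_add μ c hrR.le hR'.1.le]
      gcongr
      refine (centeredCounting_le μ c).trans ?_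
      exact mul_le_mul_left (ENNReal.div_le_div_right
        (measure_mono (Metric.closedBall_subset_closedBall hR'.2.le)) _) _
  rcases hr.eq_or_lt with rfl | hr
  · refine tendsto_nhds_unique (tendsto_centeredCounting_left μ c 0 R) ?_
    have h1 : Tendsto (fun r' => ENNReal.ofReal (A R - A r')) (𝓝[>] 0)
        (𝓝 (ENNReal.ofReal (A R - A 0))) :=
      (ENNReal.continuous_ofReal.tendsto _).comp
        ((hAr 0 le_rfl (hR.trans hR₀) hc).const_sub _)
    refine h1.congr' ?_
    filter_upwards [Ioo_mem_nhdsGT hR] with t ht using (main t ht.1 ht.2).symm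
  · exact main r hr hrR

/-- The logarithmic kernel `d ↦ ∫_0^r 1_{d ≤ t} dt / t`. -/
noncomputable def logKernel (r d : ℝ) : ℝ≥0∞ :=
  ∫⁻ t in Ioc 0 r, if d ≤ t then (ENNReal.ofReal t)⁻¹ else 0

lemma measurable_logKernel (r : ℝ) : Measurable (logKernel r) := by
  refine Measurable.lintegral_prod_right' (f := fun p : ℝ × ℝ =>
    if p.1 ≤ p.2 then (ENNReal.ofReal p.2)⁻¹ else 0) ?_
  exact Measurable.ite (measurableSet_le measurable_fst measurable_snd)
    (ENNReal.measurable_ofReal.comp measurable_snd).inv measurable_const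

lemma centeredCounting_eq_lintegral_logKernel (μ : Measure ℂ) [SFinite μ] (c : ℂ) (r : ℝ) :
    centeredCounting μ c 0 r = ∫⁻ z, logKernel r (dist z c) ∂μ := by
  unfold centeredCounting logKernel
  simp only [ENNReal.div_eq_inv_mul]
  exact setLIntegral_mul_measure_closedBall μ c (Ioc 0 r) (h := fun t => (ENNReal.ofReal t)⁻¹)
    ENNReal.measurable_ofReal.inv

lemma logKernel_of_lt {r d : ℝ} (h : r < d) : logKernel r d = 0 := by
  unfold logKernel
  rw [setLIntegral_congr_fun (g := fun _ => 0) measurableSet_Ioc (fun t ht => if_neg (by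
    have := ht.2; linarith))]
  simp

/-- By translation invariance the kernel has the same area integral about every point, which is what
lets averaging over centres recover the mass of a measure. -/
lemma lintegral_logKernel (r : ℝ) (y : ℂ) :
    ∫⁻ z, logKernel r (dist y z) = centeredCounting volume 0 0 r := by
  rw [centeredCounting_eq_lintegral_logKernel, ← lintegral_add_left_eq_self _ y]
  simp [dist_eq_norm]

/-- The value is πr²/2; being neither 0 nor ∞, it can be cancelled. -/
lemma centeredCounting_volume_ne {r : ℝ} (hr : 0 < r) :
    centeredCounting volume 0 0 r ≠ 0 ∧ centeredCounting volume 0 0 r ≠ ⊤ := by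
  have key : centeredCounting volume 0 0 r = ∫⁻ t in Ioc 0 r, ENNReal.ofReal (Real.pi * t) := by
    unfold centeredCounting
    refine setLIntegral_congr_fun measurableSet_Ioc fun t ht => ?_
    have ht0 : 0 < t := ht.1
    simp only [Complex.volume_closedBall]
    rw [← ENNReal.ofReal_pow ht0.le, show (NNReal.pi : ℝ≥0∞) = ENNReal.ofReal Real.pi from by
      rw [ENNReal.ofReal]; congr 1; ext; simp [Real.pi_pos.le],
      ← ENNReal.ofReal_mul (by positivity), ← ENNReal.ofReal_div_of_pos ht0]
    congr 1
    field_simp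
  rw [key]
  constructor
  · refine (setLIntegral_pos_iff (by fun_prop)).2 ?_ |>.ne'
    have : (Function.support fun t => ENNReal.ofReal (Real.pi * t)) ∩ Ioc 0 r = Ioc 0 r := by
      refine inter_eq_right.2 fun t ht => ?_
      have := ht.1
      simp only [Function.mem_support, ne_eq, ENNReal.ofReal_eq_zero, not_le]
      have := Real.pi_pos
      positivity
    rw [this]; simpa using hr
  · have : Continuous fun t : ℝ => Real.pi * t := by fun_prop
    exact (this.integrableOn_Ioc (a := 0) (b := r)).lintegral_lt_top.ne

/-- A measure whose counting functions about almost all centres are dominated by those of `μ` is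
dominated by `μ` on compact sets. -/
theorem measure_le_of_centeredCounting_le {ν μ : Measure ℂ} [IsFiniteMeasure ν] [IsFiniteMeasure μ]
    {U : Set ℂ} (hU : IsOpen U)
    (h : ∀ᵐ z : ℂ, ∀ r > 0, Metric.closedBall z r ⊆ U →
      centeredCounting ν z 0 r ≤ centeredCounting μ z 0 r) {K : Set ℂ} (hK : IsCompact K)
    (hKU : K ⊆ U) : ν K ≤ μ K := by
  have swap : ∀ (m : Measure ℂ) [IsFiniteMeasure m] (S : Set ℂ) (r : ℝ),
      ∫⁻ z in S, centeredCounting m z 0 r = ∫⁻ y, (∫⁻ z in S, logKernel r (dist y z)) ∂m := by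
    intro m _ S r
    simp only [centeredCounting_eq_lintegral_logKernel]
    refine lintegral_lintegral_swap (f := fun z y => logKernel r (dist y z)) ?_
    exact ((measurable_logKernel r).comp (measurable_snd.dist measurable_fst)).aemeasurable
  obtain ⟨δ₀, hδ₀, hδU⟩ := hK.exists_cthickening_subset_open hU hKU
  -- Integrate the counting functions of radius δ over centres in the δ-neighbourhood S of K. Points
  -- of K are counted in full for ν, while points farther than 2δ from K are not counted for μ. The
  -- common kernel mass cancels, and then δ → 0.
  have main : ∀ δ, 0 < δ → 2 * δ ≤ δ₀ → ν K ≤ μ (Metric.cthickening (2 * δ) K) := by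
    intro δ hδ hδδ
    obtain ⟨hI0, hIt⟩ := centeredCounting_volume_ne hδ
    set S := Metric.cthickening δ K with hS
    have hSm : MeasurableSet S := Metric.isClosed_cthickening.measurableSet
    have hlow : ν K * centeredCounting volume 0 0 δ ≤ ∫⁻ z in S, centeredCounting ν z 0 δ := by
      rw [swap, mul_comm]
      refine le_trans ?_ (setLIntegral_le_lintegral K _)
      rw [← setLIntegral_const]
      refine setLIntegral_mono' hK.isClosed.measurableSet fun y hy => ?_
      rw [← lintegral_logKernel δ y, ← lintegral_indicator hSm]
      refine lintegral_mono fun z => ?_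
      by_cases hz : z ∈ S
      · rw [indicator_of_mem hz]
      · rw [logKernel_of_lt]
        · exact zero_le
        · by_contra hd
          refine hz (Metric.mem_cthickening_of_dist_le z y δ K hy ?_)
          rw [dist_comm]; exact not_lt.1 hd
    have hup : ∫⁻ z in S, centeredCounting μ z 0 δ ≤
        μ (Metric.cthickening (2 * δ) K) * centeredCounting volume 0 0 δ := by
      rw [swap, mul_comm, ← setLIntegral_const, ← lintegral_indicator
        Metric.isClosed_cthickening.measurableSet]
      refine lintegral_mono fun y => ?_
      by_cases hy : y ∈ Metric.cthickening (2 * δ) K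
      · rw [indicator_of_mem hy, ← lintegral_logKernel δ y]
        exact setLIntegral_le_lintegral _ _
      · rw [setLIntegral_congr_fun (g := fun _ => 0) hSm fun z hz => ?_]
        · simp
        · refine logKernel_of_lt ?_
          by_contra hd
          refine hy ?_
          have h1 : y ∈ Metric.cthickening δ S :=
            Metric.mem_cthickening_of_dist_le y z δ S hz (not_lt.1 hd)
          have h2 := Metric.cthickening_cthickening_subset hδ.le hδ.le K h1
          rwa [two_mul]
    have hmid : ∫⁻ z in S, centeredCounting ν z 0 δ ≤ ∫⁻ z in S, centeredCounting μ z 0 δ := by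
      refine setLIntegral_mono_ae' hSm (h.mono fun z hz hzS => hz δ hδ ?_)
      refine Subset.trans (fun y hy => ?_) hδU
      have h1 : y ∈ Metric.cthickening δ S :=
        Metric.mem_cthickening_of_dist_le y z δ S hzS hy
      have h2 := Metric.cthickening_cthickening_subset hδ.le hδ.le K h1
      exact Metric.cthickening_mono (by linarith) K h2
    exact (ENNReal.mul_le_mul_iff_left hI0 hIt).1 (hlow.trans (hmid.trans hup))
  have hlim := tendsto_measure_cthickening_of_isCompact (μ := μ) hK
  refine ge_of_tendsto (hlim.mono_left (nhdsWithin_le_nhds (s := Ioi 0))) ?_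
  filter_upwards [Ioo_mem_nhdsGT hδ₀] with t ht
  have := main (t / 2) (by linarith [ht.1]) (by linarith [ht.2])
  rwa [show 2 * (t / 2) = t by ring] at this

end DeltaSubharmonic

/-! ### Positivity of the distributional Laplacian -/

namespace DeltaSubharmonic

variable {u : ℂ → EReal} {Ω : Set ℂ}

lemma laplacian_eq_zero_of_notMem_tsupport {φ : ℂ → ℝ} {z : ℂ} (hz : z ∉ tsupport φ) :
    Laplacian.laplacian φ z = 0 := by
  have h : φ =ᶠ[𝓝 z] fun _ => 0 := notMem_tsupport_iff_eventuallyEq.1 hz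
  rw [(InnerProductSpace.laplacian_congr_nhds h).self_of_nhds]
  simp

lemma continuous_laplacian {φ : ℂ → ℝ} (hφ : ContDiff ℝ 2 φ) :
    Continuous (Laplacian.laplacian φ) := by
  have h1 : ContDiff ℝ 1 (fderiv ℝ φ) := hφ.fderiv_right (by norm_num)
  have h2 : Continuous (fderiv ℝ (fderiv ℝ φ)) := h1.continuous_fderiv (by norm_num)
  rw [show Laplacian.laplacian φ = fun z => fderiv ℝ (fderiv ℝ φ) z 1 1 +
    fderiv ℝ (fderiv ℝ φ) z Complex.I Complex.I from funext (laplacian_eq_fderiv φ)]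
  fun_prop

/-- Second order Taylor estimate, uniform in the base point and the direction. -/
lemma taylor_two_uniform {φ : ℂ → ℝ} (hφ : ContDiff ℝ 2 φ) (hc : HasCompactSupport φ) {ε : ℝ}
    (hε : 0 < ε) : ∃ δ > 0, ∀ r, 0 < r → r < δ → ∀ z e : ℂ, ‖e‖ = 1 →
      |φ (z + r • e) - (φ z + r * fderiv ℝ φ z e + r ^ 2 / 2 * fderiv ℝ (fderiv ℝ φ) z e e)| ≤
        ε * r ^ 2 := by
  have h1 : ContDiff ℝ 1 (fderiv ℝ φ) := hφ.fderiv_right (by norm_num)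
  have h2 : Continuous (fderiv ℝ (fderiv ℝ φ)) := h1.continuous_fderiv (by norm_num)
  have h3 : HasCompactSupport (fderiv ℝ (fderiv ℝ φ)) := (hc.fderiv ℝ).fderiv ℝ
  have huc : UniformContinuous fun z => fderiv ℝ (fderiv ℝ φ) z :=
    h3.uniformContinuous_of_continuous h2
  obtain ⟨δ, hδ, hu⟩ := (Metric.uniformContinuous_iff (α := ℂ)
    (β := ℂ →L[ℝ] ℂ →L[ℝ] ℝ)).1 huc ε hε
  refine ⟨δ, hδ, fun r hr hrδ z e he => ?_⟩
  set H := fderiv ℝ (fderiv ℝ φ) with hH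
  have d1 : ∀ s : ℝ, HasDerivAt (fun s : ℝ => φ (z + s • e)) (fderiv ℝ φ (z + s • e) e) s := fun s =>
    (hφ.differentiable (by norm_num) _).hasFDerivAt.comp_hasDerivAt s (hasDerivAt_line z e s)
  have d2 : ∀ s : ℝ, HasDerivAt (fun s : ℝ => fderiv ℝ φ (z + s • e) e) (H (z + s • e) e e) s :=
    fun s => by
      have h4 := (h1.differentiable (by norm_num) (z + s • e)).hasFDerivAt.comp_hasDerivAt s
        (hasDerivAt_line z e s)
      simpa using h4.clm_apply (hasDerivAt_const s e)
  have b2 : ∀ s ∈ Icc (0 : ℝ) r, ‖H (z + s • e) e e - H z e e‖ ≤ ε := by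
    intro s hs
    have h5 : dist (z + s • e) z < δ := by
      rw [dist_eq_norm, add_sub_cancel_left, norm_smul, he, mul_one, Real.norm_of_nonneg hs.1]
      exact hs.2.trans_lt hrδ
    have h6 : ‖H (z + s • e) - H z‖ < ε := (dist_eq_norm (H (z + s • e)) (H z)).symm.trans_lt (hu h5)
    have h7 : ‖(H (z + s • e) - H z) e e‖ ≤ ‖H (z + s • e) - H z‖ := by
      refine (ContinuousLinearMap.le_opNorm₂ _ e e).trans ?_
      rw [he, mul_one, mul_one]
    simpa using h7.trans h6.le
  -- The mean value inequality is used twice along the ray: here for the first derivative, with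
  -- error εr, and below for φ itself.
  have k1 : ∀ s ∈ Icc (0 : ℝ) r,
      ‖fderiv ℝ φ (z + s • e) e - fderiv ℝ φ z e - s * H z e e‖ ≤ ε * r := by
    intro s hs
    have := (convex_Icc (0 : ℝ) r).norm_image_sub_le_of_norm_hasDerivWithin_le
      (f := fun s : ℝ => fderiv ℝ φ (z + s • e) e - s * H z e e)
      (f' := fun s => H (z + s • e) e e - H z e e) (C := ε)
      (fun s _ => ((d2 s).sub (by simpa using (hasDerivAt_id s).mul_const (H z e e))).hasDerivWithinAt)
      b2 (left_mem_Icc.2 hr.le) hs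
    simp only [zero_smul, add_zero, zero_mul, sub_zero] at this
    rw [Real.norm_of_nonneg hs.1] at this
    refine le_trans (le_of_eq ?_) (this.trans (by have := hs.2; gcongr))
    congr 1; ring
  have := (convex_Icc (0 : ℝ) r).norm_image_sub_le_of_norm_hasDerivWithin_le
      (f := fun s : ℝ => φ (z + s • e) - s * fderiv ℝ φ z e - s ^ 2 / 2 * H z e e)
      (f' := fun s => fderiv ℝ φ (z + s • e) e - fderiv ℝ φ z e - s * H z e e) (C := ε * r)
      (fun s _ => (((d1 s).sub (by simpa using (hasDerivAt_id s).mul_const (fderiv ℝ φ z e))).sub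
        (by
          have := ((hasDerivAt_pow 2 s).div_const 2).mul_const (H z e e)
          refine this.congr_deriv ?_
          push_cast; ring)).hasDerivWithinAt)
      k1 (left_mem_Icc.2 hr.le) (right_mem_Icc.2 hr.le)
  simp only [zero_smul, add_zero, zero_mul, sub_zero] at this
  rw [Real.norm_of_nonneg hr.le] at this
  refine le_trans (le_of_eq ?_) (this.trans (le_of_eq (by ring)))
  rw [Real.norm_eq_abs]
  congr 1; ring

/-- Averaging the Taylor polynomial over directions kills the linear and mixed terms, while cos² and
sin² average to 1/2, leaving r²/4 times the Laplacian. -/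
lemma circleAverage_sub_laplacian {φ : ℂ → ℝ} (hφ : ContDiff ℝ 2 φ) (hc : HasCompactSupport φ)
    {ε : ℝ} (hε : 0 < ε) : ∃ δ > 0, ∀ r, 0 < r → r < δ → ∀ z : ℂ,
      |Real.circleAverage φ z r - φ z - r ^ 2 / 4 * Laplacian.laplacian φ z| ≤ ε * r ^ 2 := by
  obtain ⟨δ, hδ, h⟩ := taylor_two_uniform hφ hc hε
  refine ⟨δ, hδ, fun r hr hrδ z => ?_⟩
  set e : ℝ → ℂ := fun θ => Complex.exp (θ * Complex.I) with he
  have hee : ∀ θ, e θ = (Real.cos θ) • (1 : ℂ) + (Real.sin θ) • Complex.I := fun θ => by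
    simp [he, Complex.exp_mul_I]
  have hcirc : ∀ θ, circleMap z r θ = z + r • e θ := fun θ => by simp [circleMap, he]
  set D := fderiv ℝ φ z
  set H := fderiv ℝ (fderiv ℝ φ) z
  set T : ℝ → ℝ := fun θ => φ z + r * D (e θ) + r ^ 2 / 2 * H (e θ) (e θ) with hT
  have hT' : ∀ θ, T θ = φ z + (r * D 1) * Real.cos θ + (r * D Complex.I) * Real.sin θ +
      (r ^ 2 / 2 * H 1 1) * Real.cos θ ^ 2 + (r ^ 2 / 2 * H Complex.I Complex.I) * Real.sin θ ^ 2 +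
      (r ^ 2 / 2 * (H 1 Complex.I + H Complex.I 1)) * (Real.sin θ * Real.cos θ) := fun θ => by
    simp only [hT, hee, map_add, map_smul, add_apply,
      smul_apply, smul_eq_mul]
    ring
  have hTint : ∫ θ in (0 : ℝ)..2 * Real.pi, T θ =
      2 * Real.pi * (φ z + r ^ 2 / 4 * Laplacian.laplacian φ z) := by
    simp only [hT']
    have i1 : ∀ a : ℝ, IntervalIntegrable (fun θ => a * Real.cos θ) volume 0 (2 * Real.pi) :=
      fun a => Continuous.intervalIntegrable (by fun_prop) _ _
    have i2 : ∀ a : ℝ, IntervalIntegrable (fun θ => a * Real.sin θ) volume 0 (2 * Real.pi) :=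
      fun a => Continuous.intervalIntegrable (by fun_prop) _ _
    have i3 : ∀ a : ℝ, IntervalIntegrable (fun θ => a * Real.cos θ ^ 2) volume 0 (2 * Real.pi) :=
      fun a => Continuous.intervalIntegrable (by fun_prop) _ _
    have i4 : ∀ a : ℝ, IntervalIntegrable (fun θ => a * Real.sin θ ^ 2) volume 0 (2 * Real.pi) :=
      fun a => Continuous.intervalIntegrable (by fun_prop) _ _
    have i5 : ∀ a : ℝ, IntervalIntegrable (fun θ => a * (Real.sin θ * Real.cos θ)) volume 0
      (2 * Real.pi) := fun a => Continuous.intervalIntegrable (by fun_prop) _ _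
    have i0 : IntervalIntegrable (fun _ : ℝ => φ z) volume 0 (2 * Real.pi) :=
      intervalIntegrable_const
    rw [intervalIntegral.integral_add ((((i0.add (i1 _)).add (i2 _)).add (i3 _)).add (i4 _)) (i5 _),
      intervalIntegral.integral_add (((i0.add (i1 _)).add (i2 _)).add (i3 _)) (i4 _),
      intervalIntegral.integral_add ((i0.add (i1 _)).add (i2 _)) (i3 _),
      intervalIntegral.integral_add (i0.add (i1 _)) (i2 _),
      intervalIntegral.integral_add i0 (i1 _), laplacian_eq_fderiv]
    simp only [intervalIntegral.integral_const_mul, integral_cos, integral_sin, integral_cos_sq,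
      integral_sin_sq, integral_sin_mul_cos₁, intervalIntegral.integral_const]
    simp
    ring
  have h2π := Real.two_pi_pos
  have hdiff : Real.circleAverage φ z r - φ z - r ^ 2 / 4 * Laplacian.laplacian φ z =
      (2 * Real.pi)⁻¹ * ∫ θ in (0 : ℝ)..2 * Real.pi, (φ (circleMap z r θ) - T θ) := by
    rw [intervalIntegral.integral_sub, hTint, Real.circleAverage_def, smul_eq_mul]
    · field_simp
      ring
    · exact (hφ.continuous.comp (continuous_circleMap z r)).intervalIntegrable _ _
    · rw [show T = _ from funext hT']
      exact Continuous.intervalIntegrable (by fun_prop) _ _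
  rw [hdiff, abs_mul, abs_of_pos (inv_pos.2 h2π), inv_mul_le_iff₀ h2π]
  have := intervalIntegral.norm_integral_le_of_norm_le_const (a := (0 : ℝ)) (b := 2 * Real.pi)
    (f := fun θ => φ (circleMap z r θ) - T θ) (C := ε * r ^ 2) (fun θ _ => by
      rw [hcirc, Real.norm_eq_abs]
      exact h r hr hrδ z (e θ) (Complex.norm_exp_ofReal_mul_I θ))
  rw [sub_zero, abs_of_pos h2π, Real.norm_eq_abs] at this
  linarith

/-- Circle averaging is symmetric with respect to the `L²` pairing. -/
lemma integral_mul_circleAverage {φ U : ℂ → ℝ} (hφ : Continuous φ) (hc : HasCompactSupport φ)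
    (hU : Measurable U) (hUi : Integrable U) (r : ℝ) :
    Integrable (fun z => φ z * Real.circleAverage U z r) ∧
    ∫ z, φ z * Real.circleAverage U z r = ∫ z, U z * Real.circleAverage φ z r := by
  obtain ⟨C, hC⟩ := hc.exists_bound_of_continuous hφ
  set ν : Measure ℝ := volume.restrict (Ioc 0 (2 * Real.pi)) with hν
  have hmeas : Measurable fun p : ℂ × ℝ => φ p.1 * U (circleMap p.1 r p.2) := by
    refine (hφ.measurable.comp measurable_fst).mul (hU.comp ?_)
    simp only [circleMap]
    exact Continuous.measurable (by fun_prop)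
  have hsh : ∀ θ, Integrable fun z => U (circleMap z r θ) := fun θ => by
    simp only [circleMap]; exact hUi.comp_add_right _
  have hint : Integrable (fun p : ℂ × ℝ => φ p.1 * U (circleMap p.1 r p.2)) (volume.prod ν) := by
    refine (integrable_prod_iff' hmeas.aestronglyMeasurable).2 ⟨Eventually.of_forall fun θ => ?_, ?_⟩
    · exact (hsh θ).bdd_mul hφ.aestronglyMeasurable (Eventually.of_forall hC)
    · refine Integrable.of_bound (C := C * ∫ z, ‖U z‖)
        hmeas.norm.stronglyMeasurable.integral_prod_left'.aestronglyMeasurable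
        (Eventually.of_forall fun θ => ?_)
      rw [Real.norm_of_nonneg (integral_nonneg fun _ => norm_nonneg _), ← integral_const_mul]
      have h1 : ∫ z, C * ‖U z‖ = ∫ z, C * ‖U (circleMap z r θ)‖ := by
        simp only [circleMap]
        exact (integral_add_right_eq_self (fun z => C * ‖U z‖) _).symm
      rw [h1]
      refine integral_mono_of_nonneg (Eventually.of_forall fun _ => norm_nonneg _)
        ((hsh θ).norm.const_mul C) (Eventually.of_forall fun z => ?_)
      simp only [norm_mul]
      exact mul_le_mul_of_nonneg_right (hC z) (norm_nonneg _)
  have hav : ∀ f : ℂ → ℝ, ∀ z, ∀ r : ℝ, Real.circleAverage f z r =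
      (2 * Real.pi)⁻¹ * ∫ θ, f (circleMap z r θ) ∂ν := fun f z r => by
    rw [Real.circleAverage_def, smul_eq_mul, intervalIntegral.integral_of_le Real.two_pi_pos.le]
  have hlhs : ∀ z, φ z * Real.circleAverage U z r =
      (2 * Real.pi)⁻¹ * ∫ θ, φ z * U (circleMap z r θ) ∂ν := fun z => by
    rw [hav, integral_const_mul]; ring
  simp only [hlhs]
  refine ⟨hint.integral_prod_left.const_mul _, ?_⟩
  rw [integral_const_mul, integral_integral_swap hint]
  -- Translating by r e^{iθ} moves the shift from U to φ with radius -r; circle averages do not see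
  -- the sign of the radius.
  have hshift : ∀ θ, ∫ z, φ z * U (circleMap z r θ) = ∫ z, φ (circleMap z (-r) θ) * U z := by
    intro θ
    rw [← integral_add_right_eq_self (fun z => φ (circleMap z (-r) θ) * U z) (circleMap 0 r θ)]
    refine integral_congr_ae (Eventually.of_forall fun z => ?_)
    simp [circleMap]
  simp only [hshift]
  have hmeas2 : Measurable fun p : ℂ × ℝ => φ (circleMap p.1 (-r) p.2) * U p.1 := by
    refine (hφ.measurable.comp ?_).mul (hU.comp measurable_fst)
    simp only [circleMap]
    exact Continuous.measurable (by fun_prop)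
  have hint2 : Integrable (fun p : ℂ × ℝ => φ (circleMap p.1 (-r) p.2) * U p.1)
      (volume.prod ν) := by
    have hU1 : Integrable (fun p : ℂ × ℝ => U p.1) (volume.prod ν) := by
      simpa using hUi.mul_prod (integrable_const (1 : ℝ) (μ := ν))
    refine hU1.bdd_mul (c := C) ?_ (Eventually.of_forall fun p => hC _)
    refine (hφ.measurable.comp ?_).aestronglyMeasurable
    simp only [circleMap]
    exact Continuous.measurable (by fun_prop)
  rw [← integral_integral_swap hint2, ← integral_const_mul]
  refine integral_congr_ae (Eventually.of_forall fun z => ?_)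
  simp only
  rw [← Real.circleAverage_neg_radius, hav, integral_mul_const]
  ring

/-- Because `EReal.toReal` sends -∞ to 0, the inequality may fail where u(z) = -∞. Such points with
the negative part integrable nearby form a null set; if u is identically -∞ on the whole disc, both
sides are 0. -/
lemma SubharmonicOn.ae_toReal_le_circleAverage (hΩ : IsOpen Ω) (hu : SubharmonicOn u Ω) :
    ∀ᵐ z : ℂ, ∀ r > 0, Metric.closedBall z r ⊆ Ω →
      (u z).toReal ≤ Real.circleAverage (fun w => (u w).toReal) z r := by
  have hnull : volume {z ∈ Ω | u z = ⊥ ∧ ∃ V ∈ 𝓝 z, ∫⁻ w in V, (-u w).toENNReal < ⊤} = 0 := by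
    refine measure_null_of_locally_null _ fun z ⟨hz, hzb, V, hV, hlt⟩ => ?_
    obtain ⟨r, hr, hrV⟩ := Metric.nhds_basis_closedBall.mem_iff.1 (inter_mem hV (hΩ.mem_nhds hz))
    refine ⟨Metric.closedBall z r ∩ {w | u w = ⊥}, ?_, ?_⟩
    · exact mem_of_superset (inter_mem (mem_nhdsWithin_of_mem_nhds (Metric.closedBall_mem_nhds z hr))
        self_mem_nhdsWithin) fun w hw => ⟨hw.1, hw.2.2.1⟩
    · have hrΩ := hrV.trans inter_subset_right
      by_contra hne
      have h1 : ∃ w ∈ Metric.closedBall z r, u w ≠ ⊥ := by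
        by_contra! hall
        have h2 : ∫⁻ w in Metric.closedBall z r, (-u w).toENNReal = ⊤ := by
          rw [setLIntegral_congr_fun (g := fun _ => ⊤) Metric.isClosed_closedBall.measurableSet
            (fun w hw => by simp [hall w hw]), lintegral_const, Measure.restrict_apply_univ]
          exact ENNReal.top_mul (Metric.measure_closedBall_pos volume z hr).ne'
        exact absurd ((lintegral_mono_set (hrV.trans inter_subset_left)).trans_lt hlt)
          (by rw [h2]; simp)
      have h3 := hu.ae_ne_bot hΩ hrΩ h1
      rw [ae_restrict_iff' Metric.isClosed_closedBall.measurableSet] at h3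
      refine hne (measure_mono_null (fun w hw => ?_) h3)
      exact fun h => h hw.1 hw.2
  filter_upwards [measure_eq_zero_iff_ae_notMem.1 hnull] with z hz r hr hrs
  have hzΩ : z ∈ Ω := hrs (Metric.mem_closedBall_self hr.le)
  by_cases hall : ∀ w ∈ Metric.closedBall z r, u w = ⊥
  · rw [hall z (Metric.mem_closedBall_self hr.le), Real.circleAverage_congr_sphere (f₂ := fun _ => 0),
      Real.circleAverage_const]
    · simp
    · intro w hw
      rw [abs_of_pos hr] at hw
      simp [hall w (Metric.sphere_subset_closedBall hw)]
  · push Not at hall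
    have h1 := hu.exists_lintegral_lt_top_of_isPreconnected hΩ (convex_closedBall z r).isPreconnected
      hrs hall z (Metric.mem_closedBall_self hr.le)
    have h2 : u z ≠ ⊥ := fun h => hz ⟨hzΩ, h, h1⟩
    have h3 := hu.circleMean_le_circleMean hrs le_rfl hr.le
    rw [circleMean_radius_zero, (hu.circleMean_eq hΩ hrs hall hr le_rfl).2.2] at h3
    rw [← EReal.coe_le_coe_iff]
    rwa [EReal.coe_toReal (hu.lt_top z hzΩ).ne h2]

lemma SubharmonicOn.integrable_mul_laplacian (hΩ : IsOpen Ω) (hu : SubharmonicOn u Ω) {φ : ℂ → ℝ}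
    (hφ : ContDiff ℝ 2 φ) (hc : HasCompactSupport φ) (hs : tsupport φ ⊆ Ω) :
    Integrable fun z => (u z).toReal * Laplacian.laplacian φ z := by
  rw [← integrableOn_iff_integrable_of_support_subset (s := tsupport φ)]
  · exact ((hu.locallyIntegrableOn_toReal hΩ).integrableOn_compact_subset hs hc).mul_continuousOn
      (continuous_laplacian hφ).continuousOn hc
  · intro z hz
    by_contra h
    exact hz (by simp [laplacian_eq_zero_of_notMem_tsupport h])

/-- The distributional Laplacian of a subharmonic function is positive. -/
theorem SubharmonicOn.integral_mul_laplacian_nonneg (hΩ : IsOpen Ω) (hu : SubharmonicOn u Ω)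
    {φ : ℂ → ℝ} (hφ : ContDiff ℝ 2 φ) (hc : HasCompactSupport φ) (hs : tsupport φ ⊆ Ω)
    (h0 : ∀ z, 0 ≤ φ z) : 0 ≤ ∫ z, (u z).toReal * Laplacian.laplacian φ z := by
  obtain ⟨δ₀, hδ₀, hδΩ⟩ := IsCompact.exists_cthickening_subset_open hc hΩ hs
  set K := Metric.cthickening δ₀ (tsupport φ) with hK
  have hKc : IsCompact K := IsCompact.cthickening hc
  have hKm : MeasurableSet K := hKc.isClosed.measurableSet
  -- Cutting off outside K makes the function globally integrable, and circles of radius at most δ₀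
  -- about points of `tsupport φ` stay inside K.
  set U : ℂ → ℝ := K.indicator fun z => ((Ω.indicator u) z).toReal with hU
  have hUm : Measurable U := (measurable_indicator_of_usc hΩ hu.usc).ereal_toReal.indicator hKm
  have hUeq : ∀ z ∈ K, U z = (u z).toReal := fun z hz => by
    simp [hU, hz, hδΩ hz]
  have hUi : Integrable U := by
    have h1 : IntegrableOn (fun z => (u z).toReal) K :=
      (hu.locallyIntegrableOn_toReal hΩ).integrableOn_compact_subset hδΩ hKc
    have h2 : IntegrableOn U K := h1.congr_fun (fun z hz => (hUeq z hz).symm) hKm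
    refine (integrableOn_iff_integrable_of_support_subset fun z hz => ?_).1 h2
    by_contra h
    exact hz (by simp [hU, h])
  have hsub : tsupport φ ⊆ K := Metric.self_subset_cthickening _
  have hlap : ∀ z, (u z).toReal * Laplacian.laplacian φ z = U z * Laplacian.laplacian φ z := fun z => by
    by_cases hz : z ∈ tsupport φ
    · rw [hUeq z (hsub hz)]
    · simp [laplacian_eq_zero_of_notMem_tsupport hz]
  have hUL : Integrable fun z => U z * Laplacian.laplacian φ z := by
    simp only [← hlap]; exact hu.integrable_mul_laplacian hΩ hφ hc hs
  simp only [hlap]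
  set B := ∫ z, |U z| with hB
  have hB0 : 0 ≤ B := integral_nonneg fun _ => abs_nonneg _
  -- Write A_r for averaging over circles of radius r. By symmetry ∫ U(A_rφ - φ) = ∫ φ(A_rU - U) ≥
  -- 0. Replacing A_rφ - φ by (r²/4)Δφ costs at most εr²B, and division by r²/4 gives 4εB.
  have key : ∀ ε > 0, -(4 * ε * B) ≤ ∫ z, U z * Laplacian.laplacian φ z := by
    intro ε hε
    obtain ⟨δ, hδ, hav⟩ := circleAverage_sub_laplacian hφ hc hε
    set r := min δ δ₀ / 2 with hr
    have hr0 : 0 < r := by positivity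
    have hm0 : 0 < min δ δ₀ := by positivity
    have hrδ : r < δ := by have := min_le_left δ δ₀; linarith
    have hrδ₀ : r ≤ δ₀ := by have := min_le_right δ δ₀; linarith
    obtain ⟨hi, hsym⟩ := integral_mul_circleAverage hφ.continuous hc hUm hUi r
    have hφU : Integrable fun z => φ z * U z := by
      obtain ⟨C, hC⟩ := hc.exists_bound_of_continuous hφ.continuous
      exact hUi.bdd_mul hφ.continuous.aestronglyMeasurable (Eventually.of_forall hC)
    have h1 : 0 ≤ ∫ z, (φ z * Real.circleAverage U z r - φ z * U z) := by
      refine integral_nonneg_of_ae ?_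
      filter_upwards [hu.ae_toReal_le_circleAverage hΩ] with z hz
      by_cases hzs : z ∈ tsupport φ
      · have hball : Metric.closedBall z r ⊆ K := fun w hw =>
          Metric.mem_cthickening_of_dist_le w z δ₀ _ hzs ((Metric.mem_closedBall.1 hw).trans hrδ₀)
        have h2 := hz r hr0 (hball.trans hδΩ)
        have h3 : Real.circleAverage U z r = Real.circleAverage (fun w => (u w).toReal) z r :=
          Real.circleAverage_congr_sphere fun w hw => hUeq w (hball (by
            rw [abs_of_pos hr0] at hw; exact Metric.sphere_subset_closedBall hw))
        simp only [Pi.zero_apply]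
        rw [← mul_sub, h3, hUeq z (hsub hzs)]
        exact mul_nonneg (h0 z) (sub_nonneg.2 h2)
      · simp [image_eq_zero_of_notMem_tsupport hzs]
    rw [integral_sub hi hφU, hsym] at h1
    have hφav : Integrable fun z => U z * Real.circleAverage φ z r := by
      obtain ⟨C, hC⟩ := hc.exists_bound_of_continuous hφ.continuous
      have h2 : Continuous fun z => Real.circleAverage φ z r := by
        simp only [Real.circleAverage_def]
        have h3 := hφ.continuous
        have h4 : Continuous (Function.uncurry fun (z : ℂ) (θ : ℝ) => φ (circleMap z r θ)) := by
          simp only [Function.uncurry_def, circleMap]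
          fun_prop
        exact (intervalIntegral.continuous_parametric_intervalIntegral_of_continuous' h4 0
          (2 * Real.pi)).const_smul (2 * Real.pi)⁻¹
      simp only [mul_comm (U _)]
      refine hUi.bdd_mul (c := C) h2.aestronglyMeasurable (Eventually.of_forall fun z => ?_)
      have h3 := intervalIntegral.norm_integral_le_of_norm_le_const (a := (0 : ℝ))
        (b := 2 * Real.pi) (f := fun θ => φ (circleMap z r θ)) (C := C) fun θ _ => hC _
      rw [sub_zero, abs_of_pos Real.two_pi_pos] at h3
      rw [Real.circleAverage_def, norm_smul, norm_inv, Real.norm_of_nonneg Real.two_pi_pos.le,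
        inv_mul_le_iff₀ Real.two_pi_pos, mul_comm _ C]
      exact h3
    have h4 : ∫ z, U z * (r ^ 2 / 4 * Laplacian.laplacian φ z) ≥
        ∫ z, (U z * Real.circleAverage φ z r - φ z * U z - ε * r ^ 2 * |U z|) := by
      refine integral_mono ((hφav.sub hφU).sub (hUi.abs.const_mul _)) ?_ fun z => ?_
      · have := hUL.const_mul (r ^ 2 / 4)
        refine this.congr (Eventually.of_forall fun z => by simp only; ring)
      · have h5 := hav r hr0 hrδ z
        have h6 : |U z * (Real.circleAverage φ z r - φ z - r ^ 2 / 4 * Laplacian.laplacian φ z)| ≤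
            |U z| * (ε * r ^ 2) := by
          rw [abs_mul]; exact mul_le_mul_of_nonneg_left h5 (abs_nonneg _)
        have h7 := (abs_le.1 h6).2
        simp only
        nlinarith
    have h4' : ∫ z, (U z * Real.circleAverage φ z r - φ z * U z - ε * r ^ 2 * |U z|) =
        (∫ z, U z * Real.circleAverage φ z r) - (∫ z, φ z * U z) - ε * r ^ 2 * B := by
      rw [integral_sub (f := fun z => U z * Real.circleAverage φ z r - φ z * U z)
        (hφav.sub hφU) (hUi.abs.const_mul _), integral_sub hφav hφU, integral_const_mul]
    rw [h4'] at h4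
    have h8 : ∫ z, U z * (r ^ 2 / 4 * Laplacian.laplacian φ z) =
        r ^ 2 / 4 * ∫ z, U z * Laplacian.laplacian φ z := by
      rw [← integral_const_mul]
      exact integral_congr_ae (Eventually.of_forall fun z => by simp only; ring)
    rw [h8] at h4
    have hr2 : 0 < r ^ 2 := by positivity
    have h9 : -(ε * r ^ 2 * B) ≤ r ^ 2 / 4 * ∫ z, U z * Laplacian.laplacian φ z := by linarith
    by_contra hcon
    have := mul_lt_mul_of_pos_left (not_le.1 hcon) (show 0 < r ^ 2 / 4 by positivity)
    nlinarith
  by_contra hneg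
  have hneg := not_le.1 hneg
  set I := ∫ z, U z * Laplacian.laplacian φ z
  -- This ε makes 4εB at most -I/2, so a negative I would satisfy I ≥ I/2; the +1 covers B = 0.
  have := key (-I / (8 * (B + 1))) (div_pos (neg_pos.2 hneg) (by positivity))
  have h1 : 4 * (-I / (8 * (B + 1))) * B ≤ -I / 2 := by
    rw [show 4 * (-I / (8 * (B + 1))) * B = (-I / 2) * (B / (B + 1)) by field_simp; ring]
    have : B / (B + 1) ≤ 1 := (div_le_one (by positivity)).2 (by linarith)
    have h2 : 0 ≤ -I / 2 := by linarith
    nlinarith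
  linarith

end DeltaSubharmonic

/-! ### Existence of the Riesz measure -/

namespace DeltaSubharmonic

variable {u : ℂ → EReal} {Ω : Set ℂ}

open scoped CompactlySupported

lemma exists_smooth_cutoff {K : Set ℂ} (hΩ : IsOpen Ω) (hK : IsCompact K) (hKΩ : K ⊆ Ω) :
    ∃ φ : ℂ → ℝ, ContDiff ℝ ∞ φ ∧ HasCompactSupport φ ∧ tsupport φ ⊆ Ω ∧ (∀ z, 0 ≤ φ z) ∧
      ∀ z ∈ K, φ z = 1 := by
  obtain ⟨δ, hδ, hδΩ⟩ := hK.exists_cthickening_subset_open hΩ hKΩ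
  obtain ⟨f, hf0, hf1, hf⟩ := exists_contMDiffMap_zero_one_of_isClosed (n := (⊤ : ℕ∞))
    (modelWithCornersSelf ℝ ℂ) (Metric.isOpen_thickening (δ := δ) (E := K)).isClosed_compl hK.isClosed
    (disjoint_left.2 fun z hz hzK => hz (Metric.self_subset_thickening hδ K hzK))
  have hsupp : tsupport f ⊆ Metric.cthickening δ K := by
    refine (closure_mono fun z hz => ?_).trans (Metric.closure_thickening_subset_cthickening δ K)
    by_contra h
    exact hz (hf0 h)
  exact ⟨f, contMDiff_iff_contDiff.1 f.contMDiff,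
    hK.cthickening.of_isClosed_subset (isClosed_tsupport _) hsupp, hsupp.trans hδΩ,
    fun z => (hf z).1, fun z hz => hf1 hz⟩

/-- The restriction to `Ω` of a continuous function with compact support in `Ω`. -/
noncomputable def restrictCompactlySupported (φ : ℂ → ℝ) (hφ : Continuous φ) (hc : HasCompactSupport φ)
    (hs : tsupport φ ⊆ Ω) : C_c(Ω, ℝ) where
  toFun z := φ z
  continuous_toFun := hφ.comp continuous_subtype_val
  hasCompactSupport' := by
    have h1 : IsCompact ((↑) ⁻¹' tsupport φ : Set Ω) :=
      Topology.IsInducing.subtypeVal.isCompact_preimage' hc (by simpa using hs)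
    refine h1.of_isClosed_subset (isClosed_tsupport _) (closure_minimal (fun z hz => ?_)
      ((isClosed_tsupport φ).preimage continuous_subtype_val))
    exact subset_tsupport φ hz

/-- The extension by zero of a compactly supported function on `Ω`. -/
noncomputable def extendZero (f : C_c(Ω, ℝ)) : ℂ → ℝ := Function.extend Subtype.val f 0

lemma extendZero_coe (f : C_c(Ω, ℝ)) (z : Ω) : extendZero f z = f z :=
  Subtype.val_injective.extend_apply _ _ _

lemma extendZero_of_notMem (f : C_c(Ω, ℝ)) {z : ℂ} (hz : z ∉ Ω) : extendZero f z = 0 := by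
  rw [extendZero, Function.extend_apply' _ _ _ (by simpa using hz)]; rfl

lemma extendZero_add (f g : C_c(Ω, ℝ)) : extendZero (f + g) = extendZero f + extendZero g := by
  ext z
  by_cases hz : z ∈ Ω
  · lift z to Ω using hz
    simp [extendZero_coe]
  · simp [extendZero_of_notMem _ hz]

lemma extendZero_smul (a : ℝ) (f : C_c(Ω, ℝ)) : extendZero (a • f) = a • extendZero f := by
  ext z
  by_cases hz : z ∈ Ω
  · lift z to Ω using hz
    simp [extendZero_coe]
  · simp [extendZero_of_notMem _ hz]

lemma extendZero_restrictCompactlySupported {φ : ℂ → ℝ} (hφ : Continuous φ)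
    (hc : HasCompactSupport φ) (hs : tsupport φ ⊆ Ω) :
    extendZero (restrictCompactlySupported φ hφ hc hs) = φ := by
  ext z
  by_cases hz : z ∈ Ω
  · lift z to Ω using hz
    rw [extendZero_coe]; rfl
  · rw [extendZero_of_notMem _ hz, image_eq_zero_of_notMem_tsupport fun h => hz (hs h)]

lemma tsupport_extendZero_subset (f : C_c(Ω, ℝ)) :
    tsupport (extendZero f) ⊆ Subtype.val '' tsupport f := by
  refine closure_minimal (fun z hz => ?_)
    (f.hasCompactSupport.isCompact.image continuous_subtype_val).isClosed
  by_cases hzΩ : z ∈ Ω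
  · lift z to Ω using hzΩ
    refine ⟨z, subset_tsupport f ?_, rfl⟩
    rwa [Function.mem_support, extendZero_coe] at hz
  · exact absurd (extendZero_of_notMem f hzΩ) hz

lemma hasCompactSupport_extendZero (f : C_c(Ω, ℝ)) : HasCompactSupport (extendZero f) :=
  (f.hasCompactSupport.isCompact.image continuous_subtype_val).of_isClosed_subset
    (isClosed_tsupport _) (tsupport_extendZero_subset f)

lemma tsupport_extendZero_subset_self (f : C_c(Ω, ℝ)) : tsupport (extendZero f) ⊆ Ω :=
  (tsupport_extendZero_subset f).trans (by simp)

lemma laplacianFunctional_add (hΩ : IsOpen Ω) (hu : SubharmonicOn u Ω) {f g : C_c(Ω, ℝ)}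
    (hf : ContDiff ℝ 2 (extendZero f)) (hg : ContDiff ℝ 2 (extendZero g)) :
    (1 / (2 * Real.pi)) * ∫ z, (u z).toReal * Laplacian.laplacian (extendZero (f + g)) z =
      ((1 / (2 * Real.pi)) * ∫ z, (u z).toReal * Laplacian.laplacian (extendZero f) z) +
      (1 / (2 * Real.pi)) * ∫ z, (u z).toReal * Laplacian.laplacian (extendZero g) z := by
  have h1 := hu.integrable_mul_laplacian hΩ hf (hasCompactSupport_extendZero _)
    (tsupport_extendZero_subset_self _)
  have h2 := hu.integrable_mul_laplacian hΩ hg (hasCompactSupport_extendZero _)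
    (tsupport_extendZero_subset_self _)
  rw [← mul_add, ← integral_add h1 h2, extendZero_add]
  congr 1
  refine integral_congr_ae (Eventually.of_forall fun z => ?_)
  simp only
  rw [ContDiffAt.laplacian_add hf.contDiffAt hg.contDiffAt, mul_add]

lemma laplacianFunctional_smul (a : ℝ) {f : C_c(Ω, ℝ)} (hf : ContDiff ℝ 2 (extendZero f)) :
    (1 / (2 * Real.pi)) * ∫ z, (u z).toReal * Laplacian.laplacian (extendZero (a • f)) z =
      a * ((1 / (2 * Real.pi)) * ∫ z, (u z).toReal * Laplacian.laplacian (extendZero f) z) := by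
  have h : ∀ z, (u z).toReal * Laplacian.laplacian (extendZero (a • f)) z =
      a * ((u z).toReal * Laplacian.laplacian (extendZero f) z) := fun z => by
    have h1 : Laplacian.laplacian (a • extendZero f) z = a • Laplacian.laplacian (extendZero f) z :=
      InnerProductSpace.laplacian_smul a hf.contDiffAt
    rw [extendZero_smul, h1, smul_eq_mul]
    ring
  simp only [h]
  rw [integral_const_mul]
  ring

/-- The smooth functions with compact support in `Ω`. -/
noncomputable def smoothSubmodule (Ω : Set ℂ) : Submodule ℝ C_c(Ω, ℝ) where
  carrier := {f | ContDiff ℝ ∞ (extendZero f)}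
  add_mem' := fun {f g} hf hg => by
    change ContDiff ℝ ∞ (extendZero (f + g))
    rw [extendZero_add]
    exact ContDiff.add hf hg
  zero_mem' := by
    have h : extendZero (0 : C_c(Ω, ℝ)) = 0 := by
      simpa using extendZero_smul 0 (0 : C_c(Ω, ℝ))
    change ContDiff ℝ ∞ (extendZero 0)
    rw [h]
    exact contDiff_const
  smul_mem' := fun a f hf => by
    change ContDiff ℝ ∞ (extendZero (a • f))
    rw [extendZero_smul]
    exact ContDiff.const_smul a hf

lemma mem_smoothSubmodule {f : C_c(Ω, ℝ)} : f ∈ smoothSubmodule Ω ↔ ContDiff ℝ ∞ (extendZero f) :=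
  Iff.rfl

lemma contDiff_two_extendZero {f : C_c(Ω, ℝ)} (hf : f ∈ smoothSubmodule Ω) :
    ContDiff ℝ 2 (extendZero f) :=
  mod_cast contDiff_infty.1 (mem_smoothSubmodule.1 hf) 2

/-- The Laplacian of a subharmonic function as a functional on smooth test functions. -/
noncomputable def laplacianFunctional (hΩ : IsOpen Ω) (hu : SubharmonicOn u Ω) :
    C_c(Ω, ℝ) →ₗ.[ℝ] ℝ where
  domain := smoothSubmodule Ω
  toFun :=
    { toFun := fun f => (1 / (2 * Real.pi)) *
        ∫ z, (u z).toReal * Laplacian.laplacian (extendZero f.1) z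
      map_add' := fun f g => laplacianFunctional_add hΩ hu (contDiff_two_extendZero f.2)
        (contDiff_two_extendZero g.2)
      map_smul' := fun a f => laplacianFunctional_smul (u := u) a (contDiff_two_extendZero f.2) }

/-- Existence of the Riesz measure of a subharmonic function. -/
theorem SubharmonicOn.exists_isRieszMeasure (hΩ : IsOpen Ω) (hu : SubharmonicOn u Ω) :
    ∃ μ, IsRieszMeasure u Ω μ := by
  have := hΩ.locallyCompactSpace
  let s : PointedCone ℝ C_c(Ω, ℝ) :=
    { carrier := {f | 0 ≤ f}
      add_mem' := fun {f g} hf hg z => add_nonneg (hf z) (hg z)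
      zero_mem' := le_refl (0 : C_c(Ω, ℝ))
      smul_mem' := fun a f hf z => mul_nonneg a.2 (hf z) }
  -- M. Riesz extension from smooth to continuous test functions. Positivity on the smooth ones is
  -- the sign of the distributional Laplacian; cofinality holds because C times a smooth cutoff,
  -- with C bounding |f|, makes f nonnegative when added.
  obtain ⟨g, hg, hg0⟩ := riesz_extension s (laplacianFunctional hΩ hu) (fun f hf => by
      have hf2 : ContDiff ℝ 2 (extendZero f.1) := contDiff_two_extendZero f.2
      refine mul_nonneg (by positivity) (hu.integral_mul_laplacian_nonneg hΩ hf2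
        (hasCompactSupport_extendZero _) (tsupport_extendZero_subset_self _) fun z => ?_)
      by_cases hz : z ∈ Ω
      · lift z to Ω using hz
        rw [extendZero_coe]; exact hf z
      · rw [extendZero_of_notMem _ hz]) (fun f => by
      obtain ⟨φ, h1, h2, h3, h4, h5⟩ := exists_smooth_cutoff hΩ
        (f.hasCompactSupport.isCompact.image continuous_subtype_val)
        (show Subtype.val '' tsupport f ⊆ Ω by simp)
      obtain ⟨C, hC⟩ := f.hasCompactSupport.exists_bound_of_continuous f.continuous
      refine ⟨⟨C • restrictCompactlySupported φ h1.continuous h2 h3, ?_⟩, fun z => ?_⟩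
      · change ContDiff ℝ ∞ (extendZero _)
        rw [extendZero_smul, extendZero_restrictCompactlySupported]
        exact h1.const_smul C
      · change 0 ≤ C * φ z + f z
        have hCz := abs_le.1 (hC z)
        have hC0 : 0 ≤ C := (norm_nonneg _).trans (hC z)
        by_cases hz : z ∈ tsupport f
        · rw [h5 z ⟨z, hz, rfl⟩]; linarith
        · rw [image_eq_zero_of_notMem_tsupport hz, add_zero]
          exact mul_nonneg hC0 (h4 z))
  -- Riesz–Markov–Kakutani is applied on the locally compact space Ω, and the measure is pushed
  -- forward to ℂ, so it automatically gives no mass to the complement.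
  let Λ : C_c(Ω, ℝ) →ₚ[ℝ] ℝ := PositiveLinearMap.mk₀ g hg0
  have hemb := MeasurableEmbedding.subtype_coe hΩ.measurableSet
  refine ⟨(RealRMK.rieszMeasure Λ).map Subtype.val, ?_, fun K hK hKΩ => ?_, fun φ hφ hc hs => ?_⟩
  · rw [hemb.map_apply]
    simp
  · rw [hemb.map_apply]
    exact (Topology.IsInducing.subtypeVal.isCompact_preimage' hK (by simpa using hKΩ)).measure_lt_top
  · rw [hemb.integral_map]
    have h1 := RealRMK.integral_rieszMeasure Λ (restrictCompactlySupported φ hφ.continuous hc hs)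
    have h2 := extendZero_restrictCompactlySupported hφ.continuous hc hs
    have h3 := hg ⟨restrictCompactlySupported φ hφ.continuous hc hs, show ContDiff ℝ ∞ (extendZero _)
      by rwa [h2]⟩
    refine h1.trans (h3.trans ?_)
    change _ * ∫ z, (u z).toReal * Laplacian.laplacian (extendZero _) z = _
    rw [h2]

lemma SubharmonicOn.isRieszMeasure (hΩ : IsOpen Ω) (hu : SubharmonicOn u Ω) :
    IsRieszMeasure u Ω (rieszMeasure u Ω) := by
  have h := hu.exists_isRieszMeasure hΩ
  rw [rieszMeasure, dif_pos h]
  exact h.choose_spec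

end DeltaSubharmonic

/-! ### Differences of finite measures and maxima of subharmonic functions -/

namespace DeltaSubharmonic

variable {u v : ℂ → EReal} {Ω : Set ℂ}

/-! ### Truncated subtraction of measures. -/

section FiniteMeasures

variable {α : Type*} [MeasurableSpace α]

/-- On the Hahn set where a ≤ b the subtraction is exact; on its complement b ≤ a already suffices.
-/
lemma measure_le_sub_add (b a : Measure α) [IsFiniteMeasure a] [IsFiniteMeasure b] :
    b ≤ b - a + a := by
  obtain ⟨s, hs, h1, h2⟩ := hahn_decomposition b a
  have hle1 : a.restrict s ≤ b.restrict s := by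
    refine Measure.le_iff.2 fun t ht => ?_
    rw [Measure.restrict_apply ht, Measure.restrict_apply ht]
    exact h1 _ (ht.inter hs) inter_subset_right
  have hle2 : b.restrict sᶜ ≤ a.restrict sᶜ := by
    refine Measure.le_iff.2 fun t ht => ?_
    rw [Measure.restrict_apply ht, Measure.restrict_apply ht]
    exact h2 _ (ht.inter hs.compl) inter_subset_right
  calc b = b.restrict s + b.restrict sᶜ := (Measure.restrict_add_restrict_compl hs).symm
    _ ≤ (b - a).restrict s + a.restrict s + ((b - a).restrict sᶜ + a.restrict sᶜ) := by
        refine add_le_add ?_ (hle2.trans (Measure.le_add_left le_rfl))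
        rw [Measure.restrict_sub_eq_restrict_sub_restrict hs, Measure.sub_add_cancel_of_le hle1]
    _ = (b - a) + a := by
        rw [add_add_add_comm, Measure.restrict_add_restrict_compl hs,
          Measure.restrict_add_restrict_compl hs]

lemma measure_le_of_add_le_add_right {a b c : Measure α} [IsFiniteMeasure c] (h : a + c ≤ b + c) :
    a ≤ b := by
  refine Measure.le_iff.2 fun s _ => ?_
  have := h s
  rw [Measure.add_apply, Measure.add_apply] at this
  exact (ENNReal.add_le_add_iff_right (measure_ne_top c s)).1 this

/-- Since a ≤ τ + a always holds, the same measures τ compete in both infima. No finiteness is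
needed, so Riesz measures of infinite total mass on Ω are covered. -/
lemma sup_sub_eq_sub (a b : Measure α) : (b ⊔ a) - a = b - a := by
  rw [Measure.sub_def, Measure.sub_def]
  congr 1
  ext τ
  change b ⊔ a ≤ τ + a ↔ b ≤ τ + a
  exact ⟨fun h => le_sup_left.trans h, fun h => sup_le h (Measure.le_add_left le_rfl)⟩

/-- The positive and negative parts of `b - a` determine each other. -/
lemma sub_add_eq_sub_add (a b : Measure α) [IsFiniteMeasure a] [IsFiniteMeasure b] :
    b - a + a = a - b + b := by
  have key : ∀ (a b : Measure α) [IsFiniteMeasure a] [IsFiniteMeasure b],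
      b - a + a ≤ a - b + b := fun a b _ _ => by
    have h1 : b - a ≤ (a - b + b) - a := by
      refine Measure.sub_le_of_le_add ?_
      rw [Measure.sub_add_cancel_of_le (measure_le_sub_add a b)]
      exact Measure.le_add_left le_rfl
    calc b - a + a ≤ (a - b + b) - a + a := by gcongr
      _ = a - b + b := Measure.sub_add_cancel_of_le (measure_le_sub_add a b)
  exact le_antisymm (key a b) (key b a)

/-- Cancelling a finite measure shows that both infima have the same competitors τ. This makes the
lower variation independent of the representation. -/
lemma sub_eq_sub_of_add_eq_add {a b c d : Measure α} [IsFiniteMeasure a] [IsFiniteMeasure c]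
    (h : a + d = c + b) : b - a = d - c := by
  rw [Measure.sub_def, Measure.sub_def]
  congr 1
  ext τ
  constructor
  · intro (hτ : b ≤ τ + a)
    change d ≤ τ + c
    refine measure_le_of_add_le_add_right (c := a) ?_
    calc d + a = c + b := by rw [add_comm, h]
      _ ≤ c + (τ + a) := by gcongr
      _ = τ + c + a := by abel
  · intro (hτ : d ≤ τ + c)
    change b ≤ τ + a
    refine measure_le_of_add_le_add_right (c := c) ?_
    calc b + c = a + d := by rw [add_comm, h]
      _ ≤ a + (τ + c) := by gcongr
      _ = τ + a + c := by abel

/-- The common part `b - (b - a)` of two finite measures. -/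
lemma sub_sub_le (a b : Measure α) [IsFiniteMeasure a] [IsFiniteMeasure b] :
    b - (b - a) ≤ a ∧ b - (b - a) ≤ b := by
  refine ⟨Measure.sub_le_of_le_add ?_, Measure.sub_le⟩
  rw [add_comm]; exact measure_le_sub_add b a

end FiniteMeasures

/-! ### Counting functions as functions of the measure. -/

section Counting

lemma measurable_counting (μ : Measure ℂ) (c : ℂ) :
    Measurable fun t => μ (Metric.closedBall c t) / ENNReal.ofReal t :=
  (Monotone.measurable fun _ _ h => measure_mono (Metric.closedBall_subset_closedBall h)).div
    ENNReal.measurable_ofReal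

lemma centeredCounting_add_measure (μ ν : Measure ℂ) (c : ℂ) (a b : ℝ) :
    centeredCounting (μ + ν) c a b = centeredCounting μ c a b + centeredCounting ν c a b := by
  unfold centeredCounting
  rw [← lintegral_add_left (measurable_counting μ c)]
  simp [ENNReal.add_div]

lemma centeredCounting_mono_measure {μ ν : Measure ℂ} (h : μ ≤ ν) (c : ℂ) (a b : ℝ) :
    centeredCounting μ c a b ≤ centeredCounting ν c a b :=
  lintegral_mono fun t => by gcongr

lemma centeredCounting_zero_measure (c : ℂ) (a b : ℝ) : centeredCounting 0 c a b = 0 := by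
  simp [centeredCounting]

/-- The single radius t = b is negligible, so S may be an open disc of radius b. -/
lemma centeredCounting_restrict (μ : Measure ℂ) {c : ℂ} {a b : ℝ} {S : Set ℂ}
    (h : ∀ t < b, Metric.closedBall c t ⊆ S) :
    centeredCounting (μ.restrict S) c a b = centeredCounting μ c a b := by
  unfold centeredCounting
  rw [← restrict_Ioo_eq_restrict_Ioc]
  refine setLIntegral_congr_fun measurableSet_Ioo fun t ht => ?_
  rw [Measure.restrict_eq_self _ (h t ht.2)]

lemma diffCounting_eq (μ : Measure ℂ) {r t : ℝ} : diffCounting μ r t = centeredCounting μ 0 r t := by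
  unfold diffCounting centeredCounting
  rw [restrict_Ioc_eq_restrict_Icc]

end Counting

lemma IsRieszMeasure.isFiniteMeasure_restrict_ball {μ : Measure ℂ} (hμ : IsRieszMeasure u Ω μ)
    {c : ℂ} {R : ℝ} (hs : Metric.closedBall c R ⊆ Ω) :
    IsFiniteMeasure (μ.restrict (Metric.ball c R)) :=
  ⟨by
    rw [Measure.restrict_apply_univ]
    exact (measure_mono Metric.ball_subset_closedBall).trans_lt
      (hμ.lt_top_of_isCompact _ (isCompact_closedBall c R) hs)⟩

/-- A finite measure on an open set is dominated by another one as soon as its centred counting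
functions are, for almost all centres. -/
lemma restrict_le_restrict_of_centeredCounting_le {ν μ : Measure ℂ} {U : Set ℂ} (hU : IsOpen U)
    [IsFiniteMeasure (ν.restrict U)] [IsFiniteMeasure (μ.restrict U)]
    (h : ∀ᵐ z : ℂ, ∀ r > 0, Metric.closedBall z r ⊆ U →
      centeredCounting ν z 0 r ≤ centeredCounting μ z 0 r) : ν.restrict U ≤ μ.restrict U := by
  refine Measure.le_iff.2 fun s hs => ?_
  have h1 : ν.restrict U s = ν.restrict U (s ∩ U) := by
    rw [Measure.restrict_apply hs, Measure.restrict_apply (hs.inter hU.measurableSet), inter_assoc,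
      inter_self]
  rw [h1, (hs.inter hU.measurableSet).measure_eq_iSup_isCompact]
  refine iSup_le fun K => iSup_le fun hKs => iSup_le fun hK => ?_
  refine (measure_le_of_centeredCounting_le hU ?_ hK (hKs.trans inter_subset_right)).trans
    (measure_mono (hKs.trans inter_subset_left))
  filter_upwards [h] with z hz r hr hzr
  have h2 : ∀ t < r, Metric.closedBall z t ⊆ U := fun t ht =>
    (Metric.closedBall_subset_closedBall ht.le).trans hzr
  rw [centeredCounting_restrict ν h2, centeredCounting_restrict μ h2]
  exact hz r hr hzr

lemma SubharmonicOn.max (hu : SubharmonicOn u Ω) (hv : SubharmonicOn v Ω) :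
    SubharmonicOn (fun z => max (u z) (v z)) Ω where
  lt_top z hz := max_lt (hu.lt_top z hz) (hv.lt_top z hz)
  usc := hu.usc.sup hv.usc
  submean w hw := by
    obtain ⟨ρ₁, h1, h1'⟩ := hu.submean w hw
    obtain ⟨ρ₂, h2, h2'⟩ := hv.submean w hw
    refine ⟨min ρ₁ ρ₂, lt_min h1 h2, fun r hr hrρ => max_le ?_ ?_⟩
    · exact (h1' r hr (hrρ.trans_le (min_le_left _ _))).trans
        (circleMean_mono hr.le fun z _ => le_max_left _ _)
    · exact (h2' r hr (hrρ.trans_le (min_le_right _ _))).trans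
        (circleMean_mono hr.le fun z _ => le_max_right _ _)

lemma circleAverage_congr_ae {f g : ℂ → ℝ} {c : ℂ} {r : ℝ}
    (h : ∀ᵐ θ ∂(volume.restrict (Ioc 0 (2 * Real.pi))), f (circleMap c r θ) = g (circleMap c r θ)) :
    Real.circleAverage f c r = Real.circleAverage g c r := by
  rw [Real.circleAverage_def, Real.circleAverage_def,
    intervalIntegral.integral_of_le Real.two_pi_pos.le,
    intervalIntegral.integral_of_le Real.two_pi_pos.le, integral_congr_ae h]

/-- A subharmonic function that is not identically `-∞` on a disc takes finite values on every
smaller disc. -/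
lemma SubharmonicOn.exists_ne_bot_of_closedBall_subset (hΩ : IsOpen Ω) (hu : SubharmonicOn u Ω)
    {c z : ℂ} {R r : ℝ} (hs : Metric.closedBall c R ⊆ Ω)
    (hne : ∃ z ∈ Metric.closedBall c R, u z ≠ ⊥) (hr : 0 < r)
    (hsub : Metric.closedBall z r ⊆ Metric.closedBall c R) :
    ∃ w ∈ Metric.closedBall z r, u w ≠ ⊥ := by
  have h := hu.ae_ne_bot hΩ hs hne
  have h2 := ae_restrict_of_ae_restrict_of_subset hsub h
  by_contra! hall
  have h3 : ∀ᵐ w ∂(volume.restrict (Metric.closedBall z r)), False := by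
    filter_upwards [h2, ae_restrict_mem Metric.isClosed_closedBall.measurableSet] with w hw hwm
    exact hw (hall w hwm)
  rw [ae_iff] at h3
  simp only [not_false_eq_true] at h3
  have h4 : volume (Metric.closedBall z r) = 0 := by
    simpa [ofPred_true] using h3
  exact (Metric.measure_closedBall_pos volume z hr).ne' h4

end DeltaSubharmonic

/-! ### The characteristic as an integrated counting function -/

namespace DeltaSubharmonic

variable {u v u₁ v₁ : ℂ → EReal} {Ω Ω₁ : Set ℂ} {R : ℝ}

/-- Jensen's formula for the Riesz measure. -/
lemma SubharmonicOn.centeredCounting_rieszMeasure (hΩ : IsOpen Ω) (hu : SubharmonicOn u Ω)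
    (hs : Metric.closedBall 0 R ⊆ Ω) (hne : ∃ z ∈ Metric.closedBall (0 : ℂ) R, u z ≠ ⊥) {z : ℂ}
    {r t : ℝ} (hr : 0 ≤ r) (hrt : r < t) (hz : Metric.closedBall z t ⊆ Metric.closedBall 0 R)
    (h0 : r = 0 → u z ≠ ⊥) :
    centeredCounting (rieszMeasure u Ω) z r t =
      ENNReal.ofReal (Real.circleAverage (fun z => (u z).toReal) z t -
        Real.circleAverage (fun z => (u z).toReal) z r) :=
  (hu.isRieszMeasure hΩ).centeredCounting_eq hΩ hu hr hrt (hz.trans hs)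
    (hu.exists_ne_bot_of_closedBall_subset hΩ hs hne (hr.trans_lt hrt) hz) h0

/-- Jensen's formula at the centre `z`, for almost every `z`. -/
lemma SubharmonicOn.ae_centeredCounting_rieszMeasure (hΩ : IsOpen Ω) (hu : SubharmonicOn u Ω)
    (hs : Metric.closedBall 0 R ⊆ Ω) (hne : ∃ z ∈ Metric.closedBall (0 : ℂ) R, u z ≠ ⊥) :
    ∀ᵐ z : ℂ, z ∈ Metric.closedBall 0 R → u z ≠ ⊥ ∧
      ∀ r > 0, Metric.closedBall z r ⊆ Metric.closedBall 0 R →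
      (u z).toReal ≤ Real.circleAverage (fun w => (u w).toReal) z r ∧
      CircleIntegrable (fun w => (u w).toReal) z r ∧
      (∀ᵐ θ ∂(volume.restrict (Ioc 0 (2 * Real.pi))), u (circleMap z r θ) ≠ ⊥) ∧
      centeredCounting (rieszMeasure u Ω) z 0 r =
        ENNReal.ofReal (Real.circleAverage (fun w => (u w).toReal) z r - (u z).toReal) := by
  have h := hu.ae_ne_bot hΩ hs hne
  rw [ae_restrict_iff' Metric.isClosed_closedBall.measurableSet] at h
  filter_upwards [h, hu.ae_toReal_le_circleAverage hΩ] with z hz hz' hzR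
  refine ⟨hz hzR, fun r hr hsub => ⟨hz' r hr (hsub.trans hs), ?_⟩⟩
  have h1 := hu.exists_ne_bot_of_closedBall_subset hΩ hs hne hr hsub
  obtain ⟨h2, h3, -⟩ := hu.circleMean_eq hΩ (hsub.trans hs) h1 hr le_rfl
  refine ⟨h2, h3, ?_⟩
  rw [hu.centeredCounting_rieszMeasure hΩ hs hne le_rfl hr hsub fun _ => hz hzR,
    Real.circleAverage_zero]

lemma toReal_max {x y : EReal} (hx : x ≠ ⊥) (hx' : x ≠ ⊤) (hy : y ≠ ⊥) (hy' : y ≠ ⊤) :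
    (max x y).toReal = max x.toReal y.toReal := by
  lift x to ℝ using ⟨hx', hx⟩
  lift y to ℝ using ⟨hy', hy⟩
  rw [← EReal.coe_strictMono.monotone.map_max]; simp

lemma exists_max_ne_bot {s : Set ℂ} (h : ∃ z ∈ s, u z ≠ ⊥) : ∃ z ∈ s, max (u z) (v z) ≠ ⊥ := by
  obtain ⟨z, hz, h⟩ := h
  exact ⟨z, hz, fun h' => h (max_eq_bot.1 h').1⟩

/-- A common minorant of the Riesz measures of `u` and `v` is a minorant of the Riesz measure of
`max u v`. -/
lemma le_rieszMeasure_max (hΩ : IsOpen Ω) (hs : Metric.closedBall 0 R ⊆ Ω)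
    (hu : SubharmonicOn u Ω) (hv : SubharmonicOn v Ω)
    (hun : ∃ z ∈ Metric.closedBall (0 : ℂ) R, u z ≠ ⊥)
    (hvn : ∃ z ∈ Metric.closedBall (0 : ℂ) R, v z ≠ ⊥) {m : Measure ℂ}
    (hmu : m ≤ (rieszMeasure u Ω).restrict (Metric.ball 0 R))
    (hmv : m ≤ (rieszMeasure v Ω).restrict (Metric.ball 0 R)) :
    m ≤ (rieszMeasure (fun z => max (u z) (v z)) Ω).restrict (Metric.ball 0 R) := by
  have hw := hu.max hv
  have hwn := exists_max_ne_bot (v := v) hun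
  have := (hu.isRieszMeasure hΩ).isFiniteMeasure_restrict_ball hs
  have := (hw.isRieszMeasure hΩ).isFiniteMeasure_restrict_ball hs
  have : IsFiniteMeasure m := isFiniteMeasure_of_le _ hmu
  have hm : m.restrict (Metric.ball 0 R) = m := by
    refine Measure.restrict_eq_self_of_ae_mem (mem_ae_iff.2 (le_antisymm ((hmu _).trans ?_) bot_le))
    exact (Measure.restrict_apply Metric.isOpen_ball.measurableSet.compl).trans_le (by simp)
  rw [← hm]
  refine restrict_le_restrict_of_centeredCounting_le Metric.isOpen_ball ?_
  filter_upwards [hu.ae_centeredCounting_rieszMeasure hΩ hs hun,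
    hv.ae_centeredCounting_rieszMeasure hΩ hs hvn,
    hw.ae_centeredCounting_rieszMeasure hΩ hs hwn] with z h1 h2 h3 r hr hzr
  have hzc := hzr.trans Metric.ball_subset_closedBall
  have hz : z ∈ Metric.closedBall 0 R := hzc (Metric.mem_closedBall_self hr.le)
  obtain ⟨hub, h1⟩ := h1 hz
  obtain ⟨hvb, h2⟩ := h2 hz
  obtain ⟨hwb, h3⟩ := h3 hz
  obtain ⟨-, iu, au, cu⟩ := h1 r hr hzc
  obtain ⟨-, iv, av, cv⟩ := h2 r hr hzc
  obtain ⟨-, iw, aw, cw⟩ := h3 r hr hzc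
  have hsub : ∀ t < r, Metric.closedBall z t ⊆ Metric.ball 0 R := fun t ht =>
    (Metric.closedBall_subset_closedBall ht.le).trans hzr
  have hmono : ∀ {f : ℂ → EReal}, CircleIntegrable (fun w => (f w).toReal) z r →
      (∀ᵐ θ ∂(volume.restrict (Ioc 0 (2 * Real.pi))), f (circleMap z r θ) ≠ ⊥) →
      (∀ w, f w ≤ max (u w) (v w)) → Real.circleAverage (fun w => (f w).toReal) z r ≤
        Real.circleAverage (fun w => (max (u w) (v w)).toReal) z r := fun {f} hi ha hle => by
    rw [← EReal.coe_le_coe_iff, ← circleMean_coe hi, ← circleMean_coe iw]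
    refine circleMean_mono_ae ?_
    filter_upwards [ha, aw] with θ h4 h5
    have h6 : circleMap z r θ ∈ Ω := hs (hzc (circleMap_mem_closedBall z hr.le θ))
    have h7 := hw.lt_top _ h6
    rw [EReal.coe_toReal ((hle _).trans_lt h7).ne h4, EReal.coe_toReal h7.ne h5]
    exact hle _
  rw [cw]
  -- The larger of u and v at z has the same value there as the maximum but smaller circle means, so
  -- its counting function about z, and hence that of m, is dominated.
  rcases le_total (u z) (v z) with h | h
  · refine (centeredCounting_mono_measure hmv z 0 r).trans ?_
    rw [centeredCounting_restrict _ hsub, cv, max_eq_right h]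
    exact ENNReal.ofReal_le_ofReal (sub_le_sub_right (hmono iv av fun w => le_max_right _ _) _)
  · refine (centeredCounting_mono_measure hmu z 0 r).trans ?_
    rw [centeredCounting_restrict _ hsub, cu, max_eq_left h]
    exact ENNReal.ofReal_le_ofReal (sub_le_sub_right (hmono iu au fun w => le_max_left _ _) _)

namespace IsRepresentation

/-- Where u and v are both finite, which is almost everywhere on the circle, (u - v)⁺ = max(u, v) -
v. -/
lemma circleMean_posPart (h : IsRepresentation R Ω u v) {t : ℝ} (ht : 0 < t) (htR : t ≤ R) :
    circleMean (posPart u v) 0 t =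
      ((Real.circleAverage (fun z => (max (u z) (v z)).toReal) 0 t -
        Real.circleAverage (fun z => (v z).toReal) 0 t : ℝ) : EReal) := by
  obtain ⟨iu, au, -⟩ := h.left.circleMean_eq h.isOpen h.subset h.left_ne_bot ht htR
  obtain ⟨iv, av, -⟩ := h.right.circleMean_eq h.isOpen h.subset h.right_ne_bot ht htR
  obtain ⟨iw, aw, -⟩ := (h.left.max h.right).circleMean_eq h.isOpen h.subset
    (exists_max_ne_bot h.left_ne_bot) ht htR
  rw [← Real.circleAverage_sub iw iv, ← circleMean_coe (iw.sub iv)]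
  refine circleMean_congr_ae ?_
  filter_upwards [au, av] with θ h1 h2
  have h3 : circleMap 0 t θ ∈ Ω :=
    h.subset (Metric.closedBall_subset_closedBall htR (circleMap_mem_closedBall 0 ht.le θ))
  have h4 := (h.left.lt_top _ h3).ne
  have h5 := (h.right.lt_top _ h3).ne
  simp only [posPart, Pi.sub_apply]
  rw [toReal_max h1 h4 h2 h5]
  generalize u (circleMap 0 t θ) = x at *
  generalize v (circleMap 0 t θ) = y at *
  lift x to ℝ using ⟨h4, h1⟩
  lift y to ℝ using ⟨h5, h2⟩
  rw [← EReal.coe_sub, ← EReal.coe_zero, ← EReal.coe_strictMono.monotone.map_max]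
  simp only [EReal.toReal_coe, EReal.coe_eq_coe_iff]
  rw [← max_sub_sub_right, sub_self, max_comm]

/-- The lower variation of the Riesz charge of `u - v` on the disc `{|z| < R}`. -/
noncomputable def localLowerVariation (R : ℝ) (Ω : Set ℂ) (u v : ℂ → EReal) : Measure ℂ :=
  (rieszMeasure v Ω).restrict (Metric.ball 0 R) - (rieszMeasure u Ω).restrict (Metric.ball 0 R)

/-- Counting up to radius t ≤ R sees only the open disc, and subtraction commutes with restriction
to it. The open disc is the natural domain: equality of functions on the closed disc gives no
control of Riesz mass on its boundary. -/
lemma diffCounting_lowerVariation {r t : ℝ} (htR : t ≤ R) :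
    diffCounting (lowerVariation Ω u v) r t =
      centeredCounting (localLowerVariation R Ω u v) 0 r t := by
  rw [diffCounting_eq, lowerVariation, sup_sub_eq_sub, localLowerVariation,
    ← Measure.restrict_sub_eq_restrict_sub_restrict Metric.isOpen_ball.measurableSet,
    centeredCounting_restrict]
  exact fun s hs => Metric.closedBall_subset_ball (hs.trans_le htR)

/-- The lower variation is at most the Riesz measure of v, to which Jensen's formula applies; in
particular the counting term is finite. -/
lemma centeredCounting_localLowerVariation_le (h : IsRepresentation R Ω u v) {r t : ℝ} (hr : 0 < r)
    (hrt : r < t) (htR : t ≤ R) : centeredCounting (localLowerVariation R Ω u v) 0 r t ≤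
      ENNReal.ofReal (Real.circleAverage (fun z => (v z).toReal) 0 t -
        Real.circleAverage (fun z => (v z).toReal) 0 r) := by
  rw [← h.right.centeredCounting_rieszMeasure h.isOpen h.subset h.right_ne_bot hr.le hrt
    (Metric.closedBall_subset_closedBall htR) (fun h => absurd h hr.ne')]
  rw [← centeredCounting_restrict (rieszMeasure v Ω) (S := Metric.ball 0 R)
    fun s hs => Metric.closedBall_subset_ball (hs.trans_le htR)]
  exact centeredCounting_mono_measure Measure.sub_le _ _ _

theorem nevanlinnaT_eq (h : IsRepresentation R Ω u v) {r t : ℝ} (hr : 0 < r)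
    (hrt : r < t) (htR : t ≤ R) : nevanlinnaT Ω u v r t =
      ((Real.circleAverage (fun z => (max (u z) (v z)).toReal) 0 t -
        Real.circleAverage (fun z => (v z).toReal) 0 t -
        (Real.circleAverage (fun z => (max (u z) (v z)).toReal) 0 r -
          Real.circleAverage (fun z => (v z).toReal) 0 r) +
        (centeredCounting (localLowerVariation R Ω u v) 0 r t).toReal : ℝ) : EReal) := by
  rw [nevanlinnaT, h.circleMean_posPart (hr.trans hrt) htR,
    h.circleMean_posPart hr (hrt.le.trans htR), diffCounting_lowerVariation htR]
  have h1 := ((h.centeredCounting_localLowerVariation_le hr hrt htR).trans_lt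
    ENNReal.ofReal_lt_top).ne
  rw [EReal.coe_add, EReal.coe_sub (_ - _), EReal.coe_ennreal_toReal h1]

/-- The characteristic is itself an integrated counting function. -/
theorem exists_nevanlinnaT_eq_counting (h : IsRepresentation R Ω u v) :
    ∃ κ : Measure ℂ, IsFiniteMeasure κ ∧ ∀ r t, 0 < r → r < t → t ≤ R →
      nevanlinnaT Ω u v r t = ((centeredCounting κ 0 r t).toReal : EReal) := by
  set B := Metric.ball (0 : ℂ) R
  have hw := h.left.max h.right
  have hwn := exists_max_ne_bot (v := v) h.left_ne_bot
  have := (h.left.isRieszMeasure h.isOpen).isFiniteMeasure_restrict_ball h.subset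
  have := (h.right.isRieszMeasure h.isOpen).isFiniteMeasure_restrict_ball h.subset
  have := (hw.isRieszMeasure h.isOpen).isFiniteMeasure_restrict_ball h.subset
  set a := (rieszMeasure u Ω).restrict B with ha
  set b := (rieszMeasure v Ω).restrict B with hb
  set c := (rieszMeasure (fun z => max (u z) (v z)) Ω).restrict B with hc
  obtain ⟨hla, hlb⟩ := sub_sub_le a b
  -- The minimum of the two Riesz measures: that of v minus its excess over that of u.
  set m := b - (b - a) with hm
  have hmc : m ≤ c := le_rieszMeasure_max h.isOpen h.subset h.left h.right h.left_ne_bot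
    h.right_ne_bot hla hlb
  have hmb : m + (b - a) = b := Measure.sub_add_cancel_of_le Measure.sub_le
  -- The formula κ = c - b + (b - a)⁺ with the outer subtraction of b cleared, so that Jensen's
  -- formula can be applied to b and c by additivity of counting functions.
  have hκ : (c - m) + b = c + (b - a) := by
    conv_lhs => rw [← hmb]
    rw [← add_assoc, Measure.sub_add_cancel_of_le hmc]
  refine ⟨c - m, inferInstance, fun r t hr hrt htR => ?_⟩
  rw [h.nevanlinnaT_eq hr hrt htR, EReal.coe_eq_coe_iff]
  have hN := congrArg (fun μ => centeredCounting μ 0 r t) hκ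
  simp only [centeredCounting_add_measure] at hN
  have hsub : ∀ s < t, Metric.closedBall (0 : ℂ) s ⊆ B := fun s hs =>
    Metric.closedBall_subset_ball (hs.trans_le htR)
  have hfin := ((h.centeredCounting_localLowerVariation_le hr hrt htR).trans_lt
    ENNReal.ofReal_lt_top).ne
  rw [hb, hc, centeredCounting_restrict _ hsub, centeredCounting_restrict _ hsub,
    h.right.centeredCounting_rieszMeasure h.isOpen h.subset h.right_ne_bot hr.le hrt
      (Metric.closedBall_subset_closedBall htR) (fun h => absurd h hr.ne'),
    hw.centeredCounting_rieszMeasure h.isOpen h.subset hwn hr.le hrt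
      (Metric.closedBall_subset_closedBall htR) (fun h => absurd h hr.ne')] at hN
  change _ + _ = _ + centeredCounting (localLowerVariation R Ω u v) 0 r t at hN
  have hv := h.right.circleAverage_mono h.isOpen h.subset h.right_ne_bot hr hrt.le htR
  have hw' := hw.circleAverage_mono h.isOpen h.subset hwn hr hrt.le htR
  have hfin2 : centeredCounting (c - m) 0 r t ≠ ⊤ := by
    intro htop
    rw [htop, top_add] at hN
    exact ENNReal.add_ne_top.2 ⟨ENNReal.ofReal_ne_top, hfin⟩ hN.symm
  have hN2 := congrArg ENNReal.toReal hN
  rw [ENNReal.toReal_add hfin2 ENNReal.ofReal_ne_top, ENNReal.toReal_add ENNReal.ofReal_ne_top hfin,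
    ENNReal.toReal_ofReal (sub_nonneg.2 hv), ENNReal.toReal_ofReal (sub_nonneg.2 hw')] at hN2
  change _ = (centeredCounting (c - m) 0 r t).toReal
  linarith

lemma swap (h : IsRepresentation R Ω u v) : IsRepresentation R Ω v u :=
  ⟨h.isOpen, h.subset, h.right, h.left, h.right_ne_bot, h.left_ne_bot⟩

/-- The maximum is symmetric in u and v, and `sub_add_eq_sub_add` trades the change of lower
variation for the difference of the Riesz measures, whose counting functions are the growths of the
means of v and u. -/
theorem nevanlinnaT_symm (h : IsRepresentation R Ω u v) {r t : ℝ} (hr : 0 < r) (hrt : r < t)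
    (htR : t ≤ R) : nevanlinnaT Ω u v r t = nevanlinnaT Ω v u r t := by
  have := (h.left.isRieszMeasure h.isOpen).isFiniteMeasure_restrict_ball h.subset
  have := (h.right.isRieszMeasure h.isOpen).isFiniteMeasure_restrict_ball h.subset
  rw [h.nevanlinnaT_eq hr hrt htR, h.swap.nevanlinnaT_eq hr hrt htR, EReal.coe_eq_coe_iff]
  simp only [max_comm (v _) (u _)]
  have hN := congrArg (fun μ => centeredCounting μ 0 r t)
    (sub_add_eq_sub_add ((rieszMeasure u Ω).restrict (Metric.ball 0 R))
      ((rieszMeasure v Ω).restrict (Metric.ball 0 R)))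
  simp only [centeredCounting_add_measure] at hN
  have hsub : ∀ s < t, Metric.closedBall (0 : ℂ) s ⊆ Metric.ball 0 R := fun s hs =>
    Metric.closedBall_subset_ball (hs.trans_le htR)
  rw [centeredCounting_restrict _ hsub, centeredCounting_restrict _ hsub,
    h.right.centeredCounting_rieszMeasure h.isOpen h.subset h.right_ne_bot hr.le hrt
      (Metric.closedBall_subset_closedBall htR) (fun h => absurd h hr.ne'),
    h.left.centeredCounting_rieszMeasure h.isOpen h.subset h.left_ne_bot hr.le hrt
      (Metric.closedBall_subset_closedBall htR) (fun h => absurd h hr.ne')] at hN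
  change centeredCounting (localLowerVariation R Ω u v) 0 r t + _ =
    centeredCounting (localLowerVariation R Ω v u) 0 r t + _ at hN
  have hfin := ((h.centeredCounting_localLowerVariation_le hr hrt htR).trans_lt
    ENNReal.ofReal_lt_top).ne
  have hfin' := ((h.swap.centeredCounting_localLowerVariation_le hr hrt htR).trans_lt
    ENNReal.ofReal_lt_top).ne
  have hv := h.right.circleAverage_mono h.isOpen h.subset h.right_ne_bot hr hrt.le htR
  have hu := h.left.circleAverage_mono h.isOpen h.subset h.left_ne_bot hr hrt.le htR
  have hN2 := congrArg ENNReal.toReal hN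
  rw [ENNReal.toReal_add hfin ENNReal.ofReal_ne_top, ENNReal.toReal_add hfin' ENNReal.ofReal_ne_top,
    ENNReal.toReal_ofReal (sub_nonneg.2 hv), ENNReal.toReal_ofReal (sub_nonneg.2 hu)] at hN2
  linarith

end IsRepresentation

end DeltaSubharmonic

/-! ### Independence of the representation and regularity of counting functions -/

namespace DeltaSubharmonic

variable {u v u₁ v₁ : ℂ → EReal} {Ω Ω₁ : Set ℂ} {R : ℝ}

namespace IsRepresentation

/-- At almost every centre all four functions are finite, so the values and circle means of u + v₁
and u₁ + v agree, and Jensen's formula gives equal counting functions. One inequality is enough,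
since the hypotheses are symmetric. -/
lemma rieszMeasure_add_restrict_le (h : IsRepresentation R Ω u v) (h₁ : IsRepresentation R Ω₁ u₁ v₁)
    (heq : ∀ z ∈ Metric.closedBall (0 : ℂ) R, u z + v₁ z = u₁ z + v z) :
    (rieszMeasure u Ω).restrict (Metric.ball 0 R) + (rieszMeasure v₁ Ω₁).restrict (Metric.ball 0 R) ≤
    (rieszMeasure u₁ Ω₁).restrict (Metric.ball 0 R) +
      (rieszMeasure v Ω).restrict (Metric.ball 0 R) := by
  have := (h.left.isRieszMeasure h.isOpen).isFiniteMeasure_restrict_ball h.subset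
  have := (h.right.isRieszMeasure h.isOpen).isFiniteMeasure_restrict_ball h.subset
  have := (h₁.left.isRieszMeasure h₁.isOpen).isFiniteMeasure_restrict_ball h₁.subset
  have := (h₁.right.isRieszMeasure h₁.isOpen).isFiniteMeasure_restrict_ball h₁.subset
  have hf1 : IsFiniteMeasure ((rieszMeasure u Ω + rieszMeasure v₁ Ω₁).restrict
      (Metric.ball 0 R)) := by rw [Measure.restrict_add]; infer_instance
  have hf2 : IsFiniteMeasure ((rieszMeasure u₁ Ω₁ + rieszMeasure v Ω).restrict
      (Metric.ball 0 R)) := by rw [Measure.restrict_add]; infer_instance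
  rw [← Measure.restrict_add, ← Measure.restrict_add]
  refine restrict_le_restrict_of_centeredCounting_le Metric.isOpen_ball ?_
  filter_upwards [h.left.ae_centeredCounting_rieszMeasure h.isOpen h.subset h.left_ne_bot,
    h.right.ae_centeredCounting_rieszMeasure h.isOpen h.subset h.right_ne_bot,
    h₁.left.ae_centeredCounting_rieszMeasure h₁.isOpen h₁.subset h₁.left_ne_bot,
    h₁.right.ae_centeredCounting_rieszMeasure h₁.isOpen h₁.subset h₁.right_ne_bot]
    with z k1 k2 k3 k4 r hr hzr
  have hzc := hzr.trans Metric.ball_subset_closedBall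
  have hz : z ∈ Metric.closedBall 0 R := hzc (Metric.mem_closedBall_self hr.le)
  obtain ⟨b1, k1⟩ := k1 hz
  obtain ⟨b2, k2⟩ := k2 hz
  obtain ⟨b3, k3⟩ := k3 hz
  obtain ⟨b4, k4⟩ := k4 hz
  obtain ⟨l1, i1, a1, c1⟩ := k1 r hr hzc
  obtain ⟨l2, i2, a2, c2⟩ := k2 r hr hzc
  obtain ⟨l3, i3, a3, c3⟩ := k3 r hr hzc
  obtain ⟨l4, i4, a4, c4⟩ := k4 r hr hzc
  have hreal : ∀ w ∈ Metric.closedBall (0 : ℂ) R, u w ≠ ⊥ → v w ≠ ⊥ → u₁ w ≠ ⊥ → v₁ w ≠ ⊥ →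
      (u w).toReal + (v₁ w).toReal = (u₁ w).toReal + (v w).toReal := fun w hw e1 e2 e3 e4 => by
    rw [← EReal.toReal_add (h.left.lt_top _ (h.subset hw)).ne e1
      (h₁.right.lt_top _ (h₁.subset hw)).ne e4, heq w hw,
      EReal.toReal_add (h₁.left.lt_top _ (h₁.subset hw)).ne e3 (h.right.lt_top _ (h.subset hw)).ne e2]
  have hav : Real.circleAverage (fun w => (u w).toReal) z r +
      Real.circleAverage (fun w => (v₁ w).toReal) z r =
      Real.circleAverage (fun w => (u₁ w).toReal) z r +
      Real.circleAverage (fun w => (v w).toReal) z r := by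
    rw [← Real.circleAverage_add i1 i4, ← Real.circleAverage_add i3 i2]
    refine circleAverage_congr_ae ?_
    filter_upwards [a1, a2, a3, a4] with θ e1 e2 e3 e4
    exact hreal _ (hzc (circleMap_mem_closedBall z hr.le θ)) e1 e2 e3 e4
  have hval := hreal z hz b1 b2 b3 b4
  rw [centeredCounting_add_measure, centeredCounting_add_measure, c1, c2, c3, c4,
    ← ENNReal.ofReal_add (sub_nonneg.2 l1) (sub_nonneg.2 l4),
    ← ENNReal.ofReal_add (sub_nonneg.2 l3) (sub_nonneg.2 l2)]
  exact ENNReal.ofReal_le_ofReal (by linarith)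

lemma localLowerVariation_congr (h : IsRepresentation R Ω u v) (h₁ : IsRepresentation R Ω₁ u₁ v₁)
    (heq : ∀ z ∈ Metric.closedBall (0 : ℂ) R, u z + v₁ z = u₁ z + v z) :
    localLowerVariation R Ω u v = localLowerVariation R Ω₁ u₁ v₁ := by
  have := (h.left.isRieszMeasure h.isOpen).isFiniteMeasure_restrict_ball h.subset
  have := (h₁.left.isRieszMeasure h₁.isOpen).isFiniteMeasure_restrict_ball h₁.subset
  exact sub_eq_sub_of_add_eq_add (le_antisymm (h.rieszMeasure_add_restrict_le h₁ heq)
    (h₁.rieszMeasure_add_restrict_le h fun z hz => (heq z hz).symm))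

lemma circleMean_posPart_congr (h : IsRepresentation R Ω u v) (h₁ : IsRepresentation R Ω₁ u₁ v₁)
    (heq : ∀ z ∈ Metric.closedBall (0 : ℂ) R, u z + v₁ z = u₁ z + v z) {t : ℝ} (ht : 0 < t)
    (htR : t ≤ R) : circleMean (posPart u v) 0 t = circleMean (posPart u₁ v₁) 0 t := by
  refine circleMean_congr_ae ?_
  filter_upwards [(h.left.circleMean_eq h.isOpen h.subset h.left_ne_bot ht htR).2.1,
    (h.right.circleMean_eq h.isOpen h.subset h.right_ne_bot ht htR).2.1,
    (h₁.left.circleMean_eq h₁.isOpen h₁.subset h₁.left_ne_bot ht htR).2.1,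
    (h₁.right.circleMean_eq h₁.isOpen h₁.subset h₁.right_ne_bot ht htR).2.1] with θ e1 e2 e3 e4
  have hw : circleMap 0 t θ ∈ Metric.closedBall (0 : ℂ) R :=
    Metric.closedBall_subset_closedBall htR (circleMap_mem_closedBall 0 ht.le θ)
  have f1 := (h.left.lt_top _ (h.subset hw)).ne
  have f2 := (h.right.lt_top _ (h.subset hw)).ne
  have f3 := (h₁.left.lt_top _ (h₁.subset hw)).ne
  have f4 := (h₁.right.lt_top _ (h₁.subset hw)).ne
  have h5 := heq _ hw
  simp only [posPart]
  generalize u (circleMap 0 t θ) = x at *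
  generalize v (circleMap 0 t θ) = y at *
  generalize u₁ (circleMap 0 t θ) = x₁ at *
  generalize v₁ (circleMap 0 t θ) = y₁ at *
  lift x to ℝ using ⟨f1, e1⟩
  lift y to ℝ using ⟨f2, e2⟩
  lift x₁ to ℝ using ⟨f3, e3⟩
  lift y₁ to ℝ using ⟨f4, e4⟩
  rw [← EReal.coe_add, ← EReal.coe_add, EReal.coe_eq_coe_iff] at h5
  rw [← EReal.coe_sub, ← EReal.coe_sub, show x - y = x₁ - y₁ by linarith]

/-- The characteristic does not depend on the representation. -/
theorem nevanlinnaT_congr (h : IsRepresentation R Ω u v) (h₁ : IsRepresentation R Ω₁ u₁ v₁)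
    (heq : ∀ z ∈ Metric.closedBall (0 : ℂ) R, u z + v₁ z = u₁ z + v z) {r t : ℝ} (hr : 0 < r)
    (hrt : r < t) (htR : t ≤ R) : nevanlinnaT Ω u v r t = nevanlinnaT Ω₁ u₁ v₁ r t := by
  rw [nevanlinnaT, nevanlinnaT, h.circleMean_posPart_congr h₁ heq (hr.trans hrt) htR,
    h.circleMean_posPart_congr h₁ heq hr (hrt.le.trans htR), diffCounting_lowerVariation htR,
    diffCounting_lowerVariation htR, h.localLowerVariation_congr h₁ heq]

/-- `T_U(r, R)` is bounded by the growth of the circle means of `max u v`. -/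
lemma nevanlinnaT_le (h : IsRepresentation R Ω u v) (h0 : u 0 ≠ ⊥ ∨ v 0 ≠ ⊥) {r : ℝ} (hr : 0 < r)
    (hrR : r < R) : nevanlinnaT Ω u v r R ≤
      ((Real.circleAverage (fun z => (max (u z) (v z)).toReal) 0 R - (max (u 0) (v 0)).toReal : ℝ) :
        EReal) := by
  have hw := h.left.max h.right
  have hwn := exists_max_ne_bot (v := v) h.left_ne_bot
  rw [h.nevanlinnaT_eq hr hrR le_rfl, EReal.coe_le_coe_iff]
  -- The counting term is at most the growth of the mean of v, which cancels the v-terms and leaves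
  -- only the growth of the mean of max(u, v).
  have h1 := h.centeredCounting_localLowerVariation_le hr hrR le_rfl
  have h2 := ENNReal.toReal_mono ENNReal.ofReal_ne_top h1
  rw [ENNReal.toReal_ofReal (sub_nonneg.2 (h.right.circleAverage_mono h.isOpen h.subset
    h.right_ne_bot hr hrR.le le_rfl))] at h2
  have h3 : (max (u 0) (v 0)).toReal ≤
      Real.circleAverage (fun z => (max (u z) (v z)).toReal) 0 r := by
    have h4 := hw.circleMean_le_circleMean
      ((Metric.closedBall_subset_closedBall hrR.le).trans h.subset) le_rfl hr.le
    rw [circleMean_radius_zero, (hw.circleMean_eq h.isOpen h.subset hwn hr hrR.le).2.2] at h4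
    rw [← EReal.coe_le_coe_iff, EReal.coe_toReal
      (hw.lt_top 0 (h.subset (Metric.mem_closedBall_self (hr.trans hrR).le))).ne]
    · exact h4
    · intro hb
      obtain ⟨hb1, hb2⟩ := max_eq_bot.1 hb
      tauto
  linarith

end IsRepresentation

lemma subharmonicOn_zero (Ω : Set ℂ) : SubharmonicOn (0 : ℂ → EReal) Ω where
  lt_top _ _ := EReal.zero_lt_top
  usc := upperSemicontinuousOn_const
  submean _ _ := ⟨1, one_pos, fun r _ _ => by simp [circleMean]⟩

lemma IsRepresentation.of_subharmonicOn (hΩ : IsOpen Ω) (hs : Metric.closedBall 0 R ⊆ Ω)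
    (hu : SubharmonicOn u Ω) (hne : ∃ z ∈ Metric.closedBall (0 : ℂ) R, u z ≠ ⊥) :
    IsRepresentation R Ω u 0 :=
  ⟨hΩ, hs, hu, subharmonicOn_zero Ω, hne, hne.imp fun _ h => ⟨h.1, by simp⟩⟩

/-- The Riesz measure is a chosen one, so its vanishing needs proof: by Jensen's formula all its
counting functions inside the disc are 0. -/
lemma rieszMeasure_zero_restrict (hΩ : IsOpen Ω) (hR : 0 < R) (hs : Metric.closedBall 0 R ⊆ Ω) :
    (rieszMeasure 0 Ω).restrict (Metric.ball 0 R) = 0 := by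
  have h0 := subharmonicOn_zero Ω
  have hne : ∃ z ∈ Metric.closedBall (0 : ℂ) R, (0 : ℂ → EReal) z ≠ ⊥ :=
    ⟨0, Metric.mem_closedBall_self hR.le, by simp⟩
  have := (h0.isRieszMeasure hΩ).isFiniteMeasure_restrict_ball hs
  refine le_antisymm ?_ bot_le
  rw [← Measure.restrict_zero (Metric.ball (0 : ℂ) R)]
  refine restrict_le_restrict_of_centeredCounting_le Metric.isOpen_ball ?_
  filter_upwards [h0.ae_centeredCounting_rieszMeasure hΩ hs hne] with z hz r hr hzr
  have hzc := hzr.trans Metric.ball_subset_closedBall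
  rw [((hz (hzc (Metric.mem_closedBall_self hr.le))).2 r hr hzc).2.2.2]
  simp [Real.circleAverage_const]

/-! ### The pairs (u, 0) and (0, u). -/

section SubharmonicCase

lemma nevanlinnaT_zero_right (hΩ : IsOpen Ω) (hs : Metric.closedBall 0 R ⊆ Ω) (u : ℂ → EReal)
    {r t : ℝ} (hR : 0 < R) (htR : t ≤ R) : nevanlinnaT Ω u 0 r t =
      circleMean (fun z => max 0 (u z)) 0 t - circleMean (fun z => max 0 (u z)) 0 r := by
  have h1 : posPart u 0 = fun z => max 0 (u z) := by
    ext z; simp [posPart]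
  rw [nevanlinnaT, IsRepresentation.diffCounting_lowerVariation htR,
    IsRepresentation.localLowerVariation, rieszMeasure_zero_restrict hΩ hR hs, Measure.zero_sub,
    centeredCounting_zero_measure, h1]
  simp

lemma nevanlinnaT_zero_left (hΩ : IsOpen Ω) (hs : Metric.closedBall 0 R ⊆ Ω) (u : ℂ → EReal)
    {r t : ℝ} (hR : 0 < R) (htR : t ≤ R) : nevanlinnaT Ω 0 u r t =
      circleMean (fun z => max 0 (-u z)) 0 t - circleMean (fun z => max 0 (-u z)) 0 r +
        (diffCounting (rieszMeasure u Ω) r t : EReal) := by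
  have h1 : posPart 0 u = fun z => max 0 (-u z) := by
    ext z; simp [posPart]
  rw [nevanlinnaT, IsRepresentation.diffCounting_lowerVariation htR,
    IsRepresentation.localLowerVariation, rieszMeasure_zero_restrict hΩ hR hs, Measure.sub_zero,
    centeredCounting_restrict, diffCounting_eq, h1]
  exact fun s hs => Metric.closedBall_subset_ball (hs.trans_le htR)

end SubharmonicCase

/-! ### Regularity and convexity of counting functions of a finite measure. -/

section CountingFunction

variable {κ : Measure ℂ} [IsFiniteMeasure κ]

lemma lintegral_inv_Ioc {a b : ℝ} (ha : 0 < a) (hab : a ≤ b) :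
    ∫⁻ t in Ioc a b, (ENNReal.ofReal t)⁻¹ = ENNReal.ofReal (Real.log b - Real.log a) := by
  have hi : IntegrableOn (fun t : ℝ => t⁻¹) (Ioc a b) :=
    (ContinuousOn.integrableOn_Icc (continuousOn_inv₀.mono fun t ht =>
      (ha.trans_le ht.1).ne')).mono_set Ioc_subset_Icc_self
  rw [← Real.log_div (ha.trans_le hab).ne' ha.ne', ← integral_inv_of_pos ha (ha.trans_le hab),
    intervalIntegral.integral_of_le hab, ofReal_integral_eq_lintegral_ofReal hi]
  · refine setLIntegral_congr_fun measurableSet_Ioc fun t ht => ?_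
    exact (ENNReal.ofReal_inv_of_pos (ha.trans ht.1)).symm
  · filter_upwards [ae_restrict_mem measurableSet_Ioc] with t ht
    exact inv_nonneg.2 (ha.trans ht.1).le

lemma centeredCounting_ne_top {a b : ℝ} (ha : 0 < a) : centeredCounting κ 0 a b ≠ ⊤ := by
  refine ((centeredCounting_le κ 0).trans_lt ?_).ne
  exact ENNReal.mul_lt_top (ENNReal.div_lt_top (measure_ne_top _ _) (by simpa using ha))
    ENNReal.ofReal_lt_top

/-- On (a, b] the mass of the disc lies between its values at the endpoints, and dt/t integrates to
the logarithm. These two bounds give both continuity and convexity. -/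
lemma centeredCounting_toReal_bounds {a b : ℝ} (ha : 0 < a) (hab : a ≤ b) :
    κ.real (Metric.closedBall 0 a) * (Real.log b - Real.log a) ≤ (centeredCounting κ 0 a b).toReal ∧
    (centeredCounting κ 0 a b).toReal ≤
      κ.real (Metric.closedBall 0 b) * (Real.log b - Real.log a) := by
  have hlog : 0 ≤ Real.log b - Real.log a := sub_nonneg.2 (Real.log_le_log ha hab)
  have key : ∀ s, κ.real (Metric.closedBall 0 s) * (Real.log b - Real.log a) =
      (∫⁻ t in Ioc a b, κ (Metric.closedBall 0 s) / ENNReal.ofReal t).toReal := fun s => by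
    simp only [ENNReal.div_eq_inv_mul]
    rw [lintegral_mul_const' _ _ (measure_ne_top _ _), lintegral_inv_Ioc ha hab, ENNReal.toReal_mul,
      ENNReal.toReal_ofReal hlog, mul_comm]
    rfl
  have hfin : ∀ s, ∫⁻ t in Ioc a b, κ (Metric.closedBall 0 s) / ENNReal.ofReal t ≠ ⊤ := fun s => by
    simp only [ENNReal.div_eq_inv_mul]
    rw [lintegral_mul_const' _ _ (measure_ne_top _ _), lintegral_inv_Ioc ha hab]
    exact ENNReal.mul_ne_top ENNReal.ofReal_ne_top (measure_ne_top _ _)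
  rw [key, key]
  constructor
  · refine ENNReal.toReal_mono (centeredCounting_ne_top ha)
      (setLIntegral_mono' measurableSet_Ioc fun t ht => ?_)
    have := Metric.closedBall_subset_closedBall (x := (0 : ℂ)) ht.1.le
    gcongr
  · refine ENNReal.toReal_mono (hfin b) (setLIntegral_mono' measurableSet_Ioc fun t ht => ?_)
    have := Metric.closedBall_subset_closedBall (x := (0 : ℂ)) ht.2
    gcongr

lemma centeredCounting_toReal_add {a b d : ℝ} (ha : 0 < a) (hab : a ≤ b) (hbd : b ≤ d) :
    (centeredCounting κ 0 a d).toReal =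
      (centeredCounting κ 0 a b).toReal + (centeredCounting κ 0 b d).toReal := by
  rw [centeredCounting_add κ 0 hab hbd, ENNReal.toReal_add (centeredCounting_ne_top ha)
    (centeredCounting_ne_top (ha.trans_le hab))]

/-- Such an f is Lipschitz in ln t, and the logarithm is continuous at positive points. -/
lemma continuousOn_of_abs_sub_le_log {f : ℝ → ℝ} {S : Set ℝ} (hS : ∀ t ∈ S, 0 < t) (C : ℝ)
    (h : ∀ s ∈ S, ∀ t ∈ S, s ≤ t → |f t - f s| ≤ C * (Real.log t - Real.log s)) :
    ContinuousOn f S := by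
  intro s hs
  have hlog : Tendsto (fun t => C * |Real.log t - Real.log s|) (𝓝[S] s) (𝓝 0) := by
    have : ContinuousAt (fun t => C * |Real.log t - Real.log s|) s := by
      have := Real.continuousAt_log (hS s hs).ne'
      fun_prop
    simpa using this.tendsto.mono_left nhdsWithin_le_nhds
  refine tendsto_iff_dist_tendsto_zero.2 (squeeze_zero' (Eventually.of_forall fun _ => dist_nonneg)
    ?_ hlog)
  filter_upwards [self_mem_nhdsWithin] with t ht
  rw [Real.dist_eq]
  rcases le_total s t with hst | hst
  · rw [abs_of_nonneg (sub_nonneg.2 (Real.log_le_log (hS s hs) hst))]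
    exact h s hs t ht hst
  · rw [abs_sub_comm, abs_sub_comm (Real.log t),
      abs_of_nonneg (sub_nonneg.2 (Real.log_le_log (hS t ht) hst))]
    exact h t ht s hs hst

lemma centeredCounting_toReal_le {a b R : ℝ} (ha : 0 < a) (hab : a ≤ b) (hbR : b ≤ R) :
    (centeredCounting κ 0 a b).toReal ≤
      κ.real (Metric.closedBall 0 R) * (Real.log b - Real.log a) :=
  (centeredCounting_toReal_bounds ha hab).2.trans (mul_le_mul_of_nonneg_right
    (measureReal_mono (Metric.closedBall_subset_closedBall hbR))
    (sub_nonneg.2 (Real.log_le_log ha hab)))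

lemma continuousOn_centeredCounting_right {r : ℝ} (hr : 0 < r) (R : ℝ) :
    ContinuousOn (fun t => (centeredCounting κ 0 r t).toReal) (Ioc r R) := by
  refine continuousOn_of_abs_sub_le_log (fun t ht => hr.trans ht.1)
    (κ.real (Metric.closedBall 0 R)) fun s hs t ht hst => ?_
  rw [centeredCounting_toReal_add hr hs.1.le hst, add_sub_cancel_left, abs_of_nonneg (by positivity)]
  exact centeredCounting_toReal_le (hr.trans hs.1) hst ht.2

lemma continuousOn_centeredCounting_left (R : ℝ) :
    ContinuousOn (fun r => (centeredCounting κ 0 r R).toReal) (Ioo 0 R) := by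
  refine continuousOn_of_abs_sub_le_log (fun t ht => ht.1)
    (κ.real (Metric.closedBall 0 R)) fun s hs t ht hst => ?_
  rw [centeredCounting_toReal_add hs.1 hst ht.2.le, sub_add_cancel_right, abs_neg,
    abs_of_nonneg (by positivity)]
  exact centeredCounting_toReal_le hs.1 hst ht.2.le

/-- The mass of the closed disc of radius `Real.exp y` separates the two slopes. -/
lemma slope_centeredCounting_exp {x y z : ℝ} (hxy : x < y) (hyz : y < z) :
    (centeredCounting κ 0 (Real.exp x) (Real.exp y)).toReal / (y - x) ≤
      (centeredCounting κ 0 (Real.exp y) (Real.exp z)).toReal / (z - y) := by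
  have h1 := (centeredCounting_toReal_bounds (κ := κ) (Real.exp_pos x) (Real.exp_le_exp.2 hxy.le)).2
  have h2 := (centeredCounting_toReal_bounds (κ := κ) (Real.exp_pos y) (Real.exp_le_exp.2 hyz.le)).1
  rw [Real.log_exp, Real.log_exp] at h1 h2
  exact ((div_le_iff₀ (sub_pos.2 hxy)).2 h1).trans ((le_div_iff₀ (sub_pos.2 hyz)).2 h2)

lemma convexOn_centeredCounting_exp {r : ℝ} (hr : 0 < r) (R : ℝ) :
    ConvexOn ℝ (Real.exp ⁻¹' Ioc r R)
      (fun s => (centeredCounting κ 0 r (Real.exp s)).toReal) := by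
  refine convexOn_of_slope_mono_adjacent
    (ordConnected_Ioc.preimage_mono Real.exp_monotone).convex fun {x y z} hx hz hxy hyz => ?_
  have e1 := Real.exp_le_exp.2 hxy.le
  have e2 := Real.exp_le_exp.2 hyz.le
  rw [centeredCounting_toReal_add hr (hx.1.le.trans e1) e2,
    centeredCounting_toReal_add hr hx.1.le e1, add_sub_cancel_left, add_sub_cancel_left]
  exact slope_centeredCounting_exp hxy hyz

lemma concaveOn_centeredCounting_exp (R : ℝ) :
    ConcaveOn ℝ (Real.exp ⁻¹' Ioo 0 R)
      (fun s => (centeredCounting κ 0 (Real.exp s) R).toReal) := by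
  refine concaveOn_of_slope_anti_adjacent
    (ordConnected_Ioo.preimage_mono Real.exp_monotone).convex fun {x y z} hx hz hxy hyz => ?_
  have e1 := Real.exp_le_exp.2 hxy.le
  have e2 := Real.exp_le_exp.2 hyz.le
  rw [centeredCounting_toReal_add (Real.exp_pos x) e1 (e2.trans hz.2.le),
    centeredCounting_toReal_add (Real.exp_pos y) e2 hz.2.le, sub_add_cancel_right,
    sub_add_cancel_right, neg_div, neg_div]
  exact neg_le_neg (slope_centeredCounting_exp hxy hyz)

end CountingFunction

end DeltaSubharmonic

/-! ### Deduction of all assertions from the counting function of κ. -/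

theorem mainTheorem3 (R : ℝ) (hR : 0 < R) (Ω : Set ℂ) (u v : ℂ → EReal)
    (hU : DeltaSubharmonic.IsRepresentation R Ω u v) :
    -- (i) independence of the representation `U = u - v = u₁ - v₁`
    (∀ (Ω₁ : Set ℂ) (u₁ v₁ : ℂ → EReal), DeltaSubharmonic.IsRepresentation R Ω₁ u₁ v₁ →
      (∀ z ∈ Metric.closedBall (0 : ℂ) R, u z + v₁ z = u₁ z + v z) →
      ∀ r ∈ Ioo 0 R, DeltaSubharmonic.nevanlinnaT Ω u v r R =
        DeltaSubharmonic.nevanlinnaT Ω₁ u₁ v₁ r R) ∧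
    -- (ii) finiteness, positivity, continuity in each variable
    (∀ r ∈ Ioo 0 R, 0 ≤ DeltaSubharmonic.nevanlinnaT Ω u v r R ∧
      DeltaSubharmonic.nevanlinnaT Ω u v r R < ⊤) ∧
    (∀ r ∈ Ioo 0 R,
      ContinuousOn (fun t => DeltaSubharmonic.nevanlinnaT Ω u v r t) (Ioc r R)) ∧
    ContinuousOn (fun r => DeltaSubharmonic.nevanlinnaT Ω u v r R) (Ioo 0 R) ∧
    -- (iii) monotonicity, and convexity or concavity with respect to the logarithm
    (∀ r ∈ Ioo 0 R,
      MonotoneOn (fun t => DeltaSubharmonic.nevanlinnaT Ω u v r t) (Ioc r R) ∧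
      ConvexOn ℝ (Real.exp ⁻¹' Ioc r R)
        (fun s => (DeltaSubharmonic.nevanlinnaT Ω u v r (Real.exp s)).toReal)) ∧
    AntitoneOn (fun r => DeltaSubharmonic.nevanlinnaT Ω u v r R) (Ioo 0 R) ∧
    ConcaveOn ℝ (Real.exp ⁻¹' Ioo 0 R)
      (fun s => (DeltaSubharmonic.nevanlinnaT Ω u v (Real.exp s) R).toReal) ∧
    -- (iv) the limit as `r → 0` exists in `[0, +∞]`
    (∃ L : EReal, 0 ≤ L ∧
      Tendsto (fun r => DeltaSubharmonic.nevanlinnaT Ω u v r R) (𝓝[>] 0) (𝓝 L)) ∧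
    -- (v) symmetry `T_U = T_{-U}`
    (∀ r ∈ Ioo 0 R, DeltaSubharmonic.nevanlinnaT Ω u v r R =
      DeltaSubharmonic.nevanlinnaT Ω v u r R) ∧
    -- (vi) the formula for a subharmonic function (`u = u - 0` and `-u = 0 - u`)
    (∀ r ∈ Ioo 0 R,
      DeltaSubharmonic.nevanlinnaT Ω u 0 r R =
        DeltaSubharmonic.circleMean (fun z => max 0 (u z)) 0 R -
          DeltaSubharmonic.circleMean (fun z => max 0 (u z)) 0 r ∧
      DeltaSubharmonic.circleMean (fun z => max 0 (u z)) 0 R -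
          DeltaSubharmonic.circleMean (fun z => max 0 (u z)) 0 r =
        DeltaSubharmonic.circleMean (fun z => max 0 (-u z)) 0 R -
          DeltaSubharmonic.circleMean (fun z => max 0 (-u z)) 0 r +
          (DeltaSubharmonic.diffCounting (DeltaSubharmonic.rieszMeasure u Ω) r R : EReal) ∧
      DeltaSubharmonic.circleMean (fun z => max 0 (-u z)) 0 R -
          DeltaSubharmonic.circleMean (fun z => max 0 (-u z)) 0 r +
          (DeltaSubharmonic.diffCounting (DeltaSubharmonic.rieszMeasure u Ω) r R : EReal) =
        DeltaSubharmonic.nevanlinnaT Ω 0 u r R) ∧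
    -- (vii) the limit as `r → 0` is finite if `u(0)` or `v(0)` is
    (u 0 ≠ ⊥ ∨ v 0 ≠ ⊥ → ∃ L : ℝ, 0 ≤ L ∧
      Tendsto (fun r => DeltaSubharmonic.nevanlinnaT Ω u v r R) (𝓝[>] 0) (𝓝 (L : EReal))) := by
  obtain ⟨κ, hκ, hT⟩ := hU.exists_nevanlinnaT_eq_counting
  -- The counting function is kept in [0, ∞] here, so that its limit at radius 0 may be infinite.
  have hT' : ∀ r ∈ Ioo 0 R, DeltaSubharmonic.nevanlinnaT Ω u v r R =
      (DeltaSubharmonic.centeredCounting κ 0 r R : EReal) := fun r hr => by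
    rw [hT r R hr.1 hr.2 le_rfl, EReal.coe_ennreal_toReal
      (DeltaSubharmonic.centeredCounting_ne_top hr.1)]
  have hlim : Tendsto (fun r => DeltaSubharmonic.nevanlinnaT Ω u v r R) (𝓝[>] 0)
      (𝓝 (DeltaSubharmonic.centeredCounting κ 0 0 R : EReal)) := by
    refine ((continuous_coe_ennreal_ereal.tendsto _).comp
      (DeltaSubharmonic.tendsto_centeredCounting_left κ 0 0 R)).congr' ?_
    filter_upwards [Ioo_mem_nhdsGT hR] with r hr using (hT' r hr).symm
  refine ⟨?_, ?_, ?_, ?_, ?_, ?_, ?_, ⟨_, EReal.coe_ennreal_nonneg _, hlim⟩, ?_, ?_, ?_⟩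
  · exact fun Ω₁ u₁ v₁ h₁ heq r hr => hU.nevanlinnaT_congr h₁ heq hr.1 hr.2 le_rfl
  · intro r hr
    rw [hT r R hr.1 hr.2 le_rfl]
    exact ⟨EReal.coe_nonneg.2 ENNReal.toReal_nonneg, EReal.coe_lt_top _⟩
  · intro r hr
    exact (continuous_coe_real_ereal.comp_continuousOn
      (DeltaSubharmonic.continuousOn_centeredCounting_right (κ := κ) hr.1 R)).congr
      fun t ht => hT r t hr.1 ht.1 ht.2
  · exact (continuous_coe_real_ereal.comp_continuousOn
      (DeltaSubharmonic.continuousOn_centeredCounting_left (κ := κ) R)).congr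
      fun r hr => hT r R hr.1 hr.2 le_rfl
  · intro r hr
    refine ⟨fun s hs t ht hst => ?_,
      (DeltaSubharmonic.convexOn_centeredCounting_exp (κ := κ) hr.1 R).congr fun s hs => ?_⟩
    · simp only
      rw [hT r s hr.1 hs.1 hs.2, hT r t hr.1 ht.1 ht.2, EReal.coe_le_coe_iff,
        DeltaSubharmonic.centeredCounting_toReal_add hr.1 hs.1.le hst]
      exact le_add_of_nonneg_right ENNReal.toReal_nonneg
    · simp only
      rw [hT r _ hr.1 hs.1 hs.2, EReal.toReal_coe]
  · intro s hs t ht hst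
    simp only
    rw [hT s R hs.1 hs.2 le_rfl, hT t R ht.1 ht.2 le_rfl, EReal.coe_le_coe_iff,
      DeltaSubharmonic.centeredCounting_toReal_add hs.1 hst ht.2.le]
    exact le_add_of_nonneg_left ENNReal.toReal_nonneg
  · refine (DeltaSubharmonic.concaveOn_centeredCounting_exp (κ := κ) R).congr fun s hs => ?_
    simp only
    rw [hT _ R hs.1 hs.2 le_rfl, EReal.toReal_coe]
  · exact fun r hr => hU.nevanlinnaT_symm hr.1 hr.2 le_rfl
  · intro r hr
    have h1 := DeltaSubharmonic.nevanlinnaT_zero_right hU.isOpen hU.subset u (r := r) hR le_rfl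
    have h2 := DeltaSubharmonic.nevanlinnaT_zero_left hU.isOpen hU.subset u (r := r) hR le_rfl
    have h3 := (DeltaSubharmonic.IsRepresentation.of_subharmonicOn hU.isOpen hU.subset hU.left
      hU.left_ne_bot).nevanlinnaT_symm hr.1 hr.2 le_rfl
    -- The middle equality is the symmetry of the characteristic for the pair (u, 0).
    exact ⟨h1, by rw [← h1, ← h2, h3], h2.symm⟩
  · intro h0
    -- The bound of `nevanlinnaT_le` is a real number independent of r, so it passes to the limit
    -- and excludes ∞.
    have hle : (DeltaSubharmonic.centeredCounting κ 0 0 R : EReal) ≤ _ :=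
      le_of_tendsto hlim (by
        filter_upwards [Ioo_mem_nhdsGT hR] with r hr using hU.nevanlinnaT_le h0 hr.1 hr.2)
    have hfin : DeltaSubharmonic.centeredCounting κ 0 0 R ≠ ⊤ := by
      intro htop
      rw [htop, EReal.coe_ennreal_top, top_le_iff] at hle
      exact EReal.coe_ne_top _ hle
    refine ⟨(DeltaSubharmonic.centeredCounting κ 0 0 R).toReal, ENNReal.toReal_nonneg, ?_⟩
    rwa [EReal.coe_ennreal_toReal hfin]
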